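/- **Conventions.** Graphs are finite multigraphs described by vertices and half-edges: every half-edge is attached to a vertex, an edge consists of two opposite half-edges, and quotients may also contain standalone half-edges. Edges are coloured and are halvable, undirected or directed; isomorphisms preserve incidences, colours, types and directions. A group $\Gamma\le\mathrm{Aut}(G)$ is *semiregular* if no nontrivial element fixes a vertex or a half-edge, and nontrivial elements reverse only halvable edges. The vertices and half-edges of $G/\Gamma$ are the $\Gamma$-orbits; an edge whose two halves lie in one orbit becomes a standalone half-edge. **Atoms.** Let $G$ be connected, without loops and standalone half-edges. Root its block tree at its centre or, more generally, at any block or articulation $R$ preserved by $\mathrm{Aut}(G)$. *Parts* of $G$ are: (i) *block parts*: subgraphs, other than a single pendant edge, formed by the blocks of a rooted subtree (at a non-root articulation $u$, or at a non-root block with parent articulation $u$); the boundary is $\partial A=\{u\}$; (ii) *proper parts*: for a 2-cut $\{u,v\}$ of a block $B$ with $\deg_B u,\deg_B v\ge 3$, a component of $G-\{u,v\}$ meeting $B$ together with $u,v$ and all edges between them and the component, provided it does not contain $R$; $\partial A=\{u,v\}$; (iii) *dipoles*: two vertices $u\ne v$ of degree at least $3$ with all (at least two) edges joining them; $\partial A=\{u,v\}$.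 *Atoms* are the inclusion-minimal parts (a subgraph that is both a dipole and a block part counts as a dipole). The interior of an atom $A$ is $A$ without the vertices of $\partial A$. Isomorphisms of atoms map boundary to boundary. An atom with $\partial A=\{u,v\}$ is *halvable* if some semiregular involution $\tau\in\mathrm{Aut}(A)$ exchanges $u$ and $v$, *symmetric* if it is not halvable but some automorphism of $A$ exchanges $u,v$, and *asymmetric* otherwise. Its *edge-quotient* is $A$, its *loop-quotient* is $A$ with $u,v$ identified, and its *half-quotients* are the graphs $A/\langle\tau\rangle$ for such $\tau$. A block atom has only the edge-quotient $A$. **Reduction.** $G'$ arises from $G$ by replacing the interior of every atom $A$ by an edge $e_A$ whose new colour encodes the isomorphism class of $A$: for a block atom, an undirected pendant edge at $u$; otherwise an edge $uv$, which is halvable, undirected or directed if $A$ is halvable, symmetric or asymmetric, respectively (orientations are chosen arbitrarily but consistently within each isomorphism class). An automorphism $\pi$ of $G$ induces the automorphism $\Phi(\pi)$ of $G'$ that agrees with $\pi$ on common vertices and half-edges and maps the half-edges of $e_A$ to those of $e_{\pi(A)}$ according to the action of $\pi$ on $\partial A$. A semiregular $\Gamma\le\mathrm{Aut}(G)$ is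 an *extension* of a semiregular $\Gamma'\le\mathrm{Aut}(G')$ if $\Phi(\Gamma)=\Gamma'$. **Expansion.** Let $H'=G'/\Gamma'$ with $\Gamma'$ semiregular. An *expansion* of $H'$ is obtained by choosing, for each edge, loop or standalone half-edge $\varepsilon$ of $H'$ that is the image of some edges $e_A$, one such atom $A$, and replacing $\varepsilon$ by the edge-quotient, the loop-quotient or some half-quotient of $A$, respectively, where the images of the boundary vertices of $A$ are glued to their images in $H'$ (for a block atom, the leaf of the pendant edge is removed). **Theorem.** Let $G'$ be a reduction of $G$ as above. (1) Every semiregular $\Gamma\le\mathrm{Aut}(G)$ is an extension of some semiregular $\Gamma'\le\mathrm{Aut}(G')$, and whenever $\Gamma$ extends $\Gamma'$, the quotient $G/\Gamma$ is an expansion of $G'/\Gamma'$. (2) Conversely, for every semiregular $\Gamma'\le\mathrm{Aut}(G')$ and every expansion $X$ of $G'/\Gamma'$, there is a semiregular $\Gamma\le\mathrm{Aut}(G)$ extending $\Gamma'$ such that $G/\Gamma$ is $X$. In both parts graphs are compared up to an isomorphism that is the identity on the vertices and half-edges common to $G/\Gamma$ and $G'/\Gamma'$. -/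

import Mathlib

/-! ### Multigraphs with coloured edges of three types -/

/-- The role of a half-edge: it belongs to a halvable edge, to an undirected edge, or it is the
initial (`tail`) or the terminal (`head`) half of a directed edge. -/
inductive EdgeKind where
  | halvable
  | undirected
  | tail
  | head

/-- The role of the opposite half-edge. -/
def EdgeKind.flip : EdgeKind → EdgeKind
  | .halvable => .halvable
  | .undirected => .undirected
  | .tail => .head
  | .head => .tail

/-- A multigraph with vertex set `V`, set `D` of half-edges, and edge colours in `C`.
`vert h` is the vertex carrying the half-edge `h`, and `inv h` is the opposite half-edge; so an edge
is an orbit `{h, inv h}`. If `inv h = h`, then `h` is a standalone half-edge. -/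
structure ColGraph (V D C : Type*) where
  vert : D → V
  inv : D → D
  color : D → C
  kind : D → EdgeKind
  inv_inv : ∀ h, inv (inv h) = h
  color_inv : ∀ h, color (inv h) = color h
  kind_inv : ∀ h, kind (inv h) = (kind h).flip

namespace ColGraph

/-- Isomorphisms preserve incidence, edges, colours, edge types and directions. -/
structure Iso {V D V' D' C : Type*} (G : ColGraph V D C) (H : ColGraph V' D' C) where
  onV : V ≃ V'
  onD : D ≃ D'
  vert_map : ∀ h, H.vert (onD h) = onV (G.vert h)
  inv_map : ∀ h, H.inv (onD h) = onD (G.inv h)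
  color_map : ∀ h, H.color (onD h) = G.color h
  kind_map : ∀ h, H.kind (onD h) = G.kind h

variable {V D C : Type*}

/-- The automorphism group, acting on vertices (first component) and on half-edges (second). -/
def aut (G : ColGraph V D C) : Subgroup (Equiv.Perm V × Equiv.Perm D) where
  carrier := {π | ∀ h, G.vert (π.2 h) = π.1 (G.vert h) ∧ G.inv (π.2 h) = π.2 (G.inv h) ∧
    G.color (π.2 h) = G.color h ∧ G.kind (π.2 h) = G.kind h}
  mul_mem' := by
    intro a b ha hb h
    obtain ⟨a1, a2, a3, a4⟩ := ha (b.2 h)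
    obtain ⟨b1, b2, b3, b4⟩ := hb h
    simp only [Prod.fst_mul, Prod.snd_mul, Equiv.Perm.mul_apply]
    exact ⟨by rw [a1, b1], by rw [a2, b2], by rw [a3, b3], by rw [a4, b4]⟩
  one_mem' := by
    intro h
    simp
  inv_mem' := by
    intro a ha h
    obtain ⟨a1, a2, a3, a4⟩ := ha (a.2.symm h)
    rw [Equiv.apply_symm_apply] at a1 a2 a3 a4
    exact ⟨(Equiv.symm_apply_eq a.1).2 a1 |>.symm, (Equiv.symm_apply_eq a.2).2 a2 |>.symm,
      a3.symm, a4.symm⟩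

/-- `Γ` is a semiregular group of automorphisms: a nontrivial element fixes no vertex and no
half-edge, and it may reverse an edge only if that edge is halvable. -/
structure Semiregular (G : ColGraph V D C) (Γ : Subgroup (Equiv.Perm V × Equiv.Perm D)) :
    Prop where
  le_aut : Γ ≤ G.aut
  vert_free : ∀ γ ∈ Γ, γ ≠ 1 → ∀ v, γ.1 v ≠ v
  dart_free : ∀ γ ∈ Γ, γ ≠ 1 → ∀ h, γ.2 h ≠ h
  halvable_of_reversed : ∀ γ ∈ Γ, γ ≠ 1 → ∀ h, γ.2 h = G.inv h → G.kind h = .halvable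

/-! ### Quotients -/

/-- Identifications of vertices and of half-edges that are compatible with the graph structure. -/
structure Congr (G : ColGraph V D C) where
  sv : Setoid V
  sd : Setoid D
  vert_rel : ∀ h k, sd h k → sv (G.vert h) (G.vert k)
  inv_rel : ∀ h k, sd h k → sd (G.inv h) (G.inv k)
  color_rel : ∀ h k, sd h k → G.color h = G.color k
  kind_rel : ∀ h k, sd h k → G.kind h = G.kind k

/-- The graph obtained by carrying out the identifications. -/
def mod (G : ColGraph V D C) (c : G.Congr) : ColGraph (Quotient c.sv) (Quotient c.sd) C where
  vert := Quotient.map G.vert c.vert_rel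
  inv := Quotient.map G.inv c.inv_rel
  color := Quotient.lift G.color c.color_rel
  kind := Quotient.lift G.kind c.kind_rel
  inv_inv := by rintro ⟨h⟩; exact congrArg (Quotient.mk c.sd) (G.inv_inv h)
  color_inv := by rintro ⟨h⟩; exact G.color_inv h
  kind_inv := by rintro ⟨h⟩; exact G.kind_inv h

/-- Identification along the orbits of a group of automorphisms. -/
def orbits (G : ColGraph V D C) (Γ : Subgroup (Equiv.Perm V × Equiv.Perm D)) (hΓ : Γ ≤ G.aut) :
    G.Congr where
  sv :=
    { r := fun v w => ∃ γ ∈ Γ, γ.1 v = w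
      iseqv :=
        { refl := fun _ => ⟨1, Γ.one_mem, rfl⟩
          symm := by
            rintro v _ ⟨γ, hγ, rfl⟩
            exact ⟨γ⁻¹, Γ.inv_mem hγ, by simp⟩
          trans := by
            rintro v _ _ ⟨γ, hγ, rfl⟩ ⟨δ, hδ, rfl⟩
            exact ⟨δ * γ, Γ.mul_mem hδ hγ, rfl⟩ } }
  sd :=
    { r := fun h k => ∃ γ ∈ Γ, γ.2 h = k
      iseqv :=
        { refl := fun _ => ⟨1, Γ.one_mem, rfl⟩
          symm := by
            rintro v _ ⟨γ, hγ, rfl⟩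
            exact ⟨γ⁻¹, Γ.inv_mem hγ, by simp⟩
          trans := by
            rintro v _ _ ⟨γ, hγ, rfl⟩ ⟨δ, hδ, rfl⟩
            exact ⟨δ * γ, Γ.mul_mem hδ hγ, rfl⟩ } }
  vert_rel := by
    rintro h _ ⟨γ, hγ, rfl⟩
    exact ⟨γ, hγ, (hΓ hγ h).1.symm⟩
  inv_rel := by
    rintro h _ ⟨γ, hγ, rfl⟩
    exact ⟨γ, hγ, (hΓ hγ h).2.1.symm⟩
  color_rel := by
    rintro h _ ⟨γ, hγ, rfl⟩
    exact (hΓ hγ h).2.2.1.symm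
  kind_rel := by
    rintro h _ ⟨γ, hγ, rfl⟩
    exact (hΓ hγ h).2.2.2.symm

/-- The quotient `G / Γ`: its vertices and half-edges are the orbits of `Γ`. -/
abbrev quotient (G : ColGraph V D C) (Γ : Subgroup (Equiv.Perm V × Equiv.Perm D))
    (hΓ : Γ ≤ G.aut) := G.mod (G.orbits Γ hΓ)

/-! ### Connectivity and the block tree -/

/-- The underlying simple graph. -/
def simple (G : ColGraph V D C) : SimpleGraph V where
  Adj v w := v ≠ w ∧ ∃ h, G.vert h = v ∧ G.vert (G.inv h) = w
  symm := ⟨by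
    rintro v w ⟨hne, h, rfl, rfl⟩
    exact ⟨hne.symm, G.inv h, rfl, by rw [G.inv_inv]⟩⟩
  loopless := ⟨fun _ h => h.1 rfl⟩

/-- `K` is (the vertex set of) a connected component of `G - S`. -/
def IsComponent (G : ColGraph V D C) (S K : Set V) : Prop :=
  Disjoint K S ∧ (G.simple.induce K).Connected ∧
    ∀ v ∈ K, ∀ w, G.simple.Adj v w → w ∈ K ∨ w ∈ S

def IsArticulation (G : ColGraph V D C) (c : V) : Prop :=
  ¬ (G.simple.induce {c}ᶜ).Preconnected

/-- The blocks, given by their vertex sets: maximal connected subgraphs without a cut vertex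
(in particular, bridges and pendant edges are blocks). -/
def IsBlock (G : ColGraph V D C) (B : Set V) : Prop :=
  Maximal (fun B : Set V => (G.simple.induce B).Connected ∧
    ∀ x ∈ B, (G.simple.induce (B \ {x})).Preconnected) B

/-- The nodes of the block tree: blocks and (singletons of) articulations. -/
def Node (G : ColGraph V D C) : Type _ :=
  {S : Set V // G.IsBlock S ∨ ∃ c, G.IsArticulation c ∧ S = {c}}

/-- The block tree: the incidence graph between articulations and blocks. -/
def blockTree (G : ColGraph V D C) : SimpleGraph G.Node where
  Adj S T := S.1 ⊂ T.1 ∨ T.1 ⊂ S.1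
  symm := ⟨fun _ _ h => h.symm⟩
  loopless := ⟨fun _ h => h.elim (fun h => h.ne rfl) (fun h => h.ne rfl)⟩

/-- The block or articulation `R` with respect to which atoms are defined: it is the centre of the
block tree or, more generally, any node of the block tree preserved by all automorphisms. -/
def IsRoot (G : ColGraph V D C) (R : Set V) : Prop :=
  ∃ r : G.Node, r.1 = R ∧ (G.blockTree.center = {r} ∨ ∀ γ ∈ G.aut, γ.1 '' R = R)

/-- Connected, without loops and without standalone half-edges. -/
structure IsConnectedLoopless (G : ColGraph V D C) : Prop where
  connected : G.simple.Connected
  loopless : ∀ h, G.vert (G.inv h) ≠ G.vert h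
  no_half : ∀ h, G.inv h ≠ h

/-! ### Atoms -/

/-- A subgraph with a boundary: vertices `bdry ∪ inn` and half-edges `darts`, where all half-edges
at vertices of `inn` belong to the subgraph. The interior consists of `inn` and `darts`. -/
@[ext] structure Piece (G : ColGraph V D C) where
  bdry : Set V
  inn : Set V
  darts : Set D
  disj : Disjoint bdry inn
  inv_mem : ∀ h ∈ darts, G.inv h ∈ darts
  vert_mem : ∀ h ∈ darts, G.vert h ∈ bdry ∪ inn
  mem_of_inn : ∀ h, G.vert h ∈ inn → h ∈ darts

/-- A piece as a graph of its own. -/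
def Piece.graph {G : ColGraph V D C} (A : G.Piece) :
    ColGraph {v // v ∈ A.bdry ∪ A.inn} {h // h ∈ A.darts} C where
  vert h := ⟨G.vert h.1, A.vert_mem h.1 h.2⟩
  inv h := ⟨G.inv h.1, A.inv_mem h.1 h.2⟩
  color h := G.color h.1
  kind h := G.kind h.1
  inv_inv h := Subtype.ext (G.inv_inv h.1)
  color_inv h := G.color_inv h.1
  kind_inv h := G.kind_inv h.1

/-- The half-edges of all edges with at least one end in `W`. -/
def touching (G : ColGraph V D C) (W : Set V) : Set D :=
  {h | G.vert h ∈ W ∨ G.vert (G.inv h) ∈ W}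

/-- Block parts. The block tree is rooted at `R`. The rooted subtree at a block with parent
articulation `u` spans `u` and a component of `G - u` avoiding `R`; the rooted subtree at an
articulation `u`, other than the root, spans `u` and all components of `G - u` avoiding `R`.
Single pendant edges are excluded. -/
def IsBlockPart (G : ColGraph V D C) (R : Set V) (A : G.Piece) : Prop :=
  ∃ u, A.bdry = {u} ∧ A.darts = G.touching A.inn ∧ (¬ ∃ h, A.darts = {h, G.inv h}) ∧
    ((G.IsComponent {u} A.inn ∧ Disjoint A.inn R) ∨
      (R ≠ {u} ∧ A.inn.Nonempty ∧ A.inn = ⋃₀ {K | G.IsComponent {u} K ∧ Disjoint K R}))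

/-- Proper parts. Here `{u, v}` is a nontrivial 2-cut of a block `B`, that is, `B - {u, v}` is
disconnected and `u`, `v` have degree at least three in `B`. The part consists of a component of
`G - {u, v}` meeting `B`, together with `u`, `v` and all edges between them and the component. It
must not contain the root `R`. -/
def IsProperPart (G : ColGraph V D C) (R : Set V) (A : G.Piece) : Prop :=
  ∃ B u v, G.IsBlock B ∧ u ∈ B ∧ v ∈ B ∧ u ≠ v ∧
    ¬ (G.simple.induce (B \ {u, v})).Preconnected ∧
    3 ≤ {h | G.vert h = u ∧ G.vert (G.inv h) ∈ B}.ncard ∧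
    3 ≤ {h | G.vert h = v ∧ G.vert (G.inv h) ∈ B}.ncard ∧
    A.bdry = {u, v} ∧ A.darts = G.touching A.inn ∧
    G.IsComponent {u, v} A.inn ∧ (A.inn ∩ B).Nonempty ∧ ¬ R ⊆ A.bdry ∪ A.inn

/-- Dipoles: all edges joining two vertices `u ≠ v` of degree at least three, provided that there
are at least two such edges. -/
def IsDipole (G : ColGraph V D C) (A : G.Piece) : Prop :=
  ∃ u v, u ≠ v ∧ 3 ≤ {h | G.vert h = u}.ncard ∧ 3 ≤ {h | G.vert h = v}.ncard ∧
    2 ≤ {h | G.vert h = u ∧ G.vert (G.inv h) = v}.ncard ∧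
    A.bdry = {u, v} ∧ A.inn = ∅ ∧
    A.darts = {h | (G.vert h = u ∧ G.vert (G.inv h) = v) ∨ (G.vert h = v ∧ G.vert (G.inv h) = u)}

def IsPart (G : ColGraph V D C) (R : Set V) (A : G.Piece) : Prop :=
  G.IsBlockPart R A ∨ G.IsProperPart R A ∨ G.IsDipole A

/-- Atoms are the inclusion-minimal parts. Inclusion is tested on interiors; so a pendant bundle of
at least three parallel edges, which is both a dipole and a block part, counts as a dipole. -/
def IsAtom (G : ColGraph V D C) (R : Set V) (A : G.Piece) : Prop :=
  G.IsPart R A ∧ ∀ B, G.IsPart R B → B.inn ⊆ A.inn → B.darts ⊆ A.darts → B = A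

def Atom (G : ColGraph V D C) (R : Set V) : Type _ := {A : G.Piece // G.IsAtom R A}

/-! ### Symmetry types and quotients of atoms -/

/-- `σ` is an isomorphism of pieces mapping boundary to boundary. -/
def Piece.RespectsBdry {G : ColGraph V D C} {A B : G.Piece} (σ : Iso A.graph B.graph) : Prop :=
  ∀ x, (σ.onV x).1 ∈ B.bdry ↔ x.1 ∈ A.bdry

def Piece.IsoRel {G : ColGraph V D C} (A B : G.Piece) : Prop :=
  ∃ σ : Iso A.graph B.graph, Piece.RespectsBdry σ

/-- `τ` exchanges the vertices of the (two-element) boundary. -/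
def Piece.Exchanges {G : ColGraph V D C} (A : G.Piece)
    (τ : Equiv.Perm {v // v ∈ A.bdry ∪ A.inn} × Equiv.Perm {h // h ∈ A.darts}) : Prop :=
  ∀ x, x.1 ∈ A.bdry → (τ.1 x).1 ∈ A.bdry ∧ τ.1 x ≠ x

/-- `τ` is a semiregular involutory automorphism of `A` exchanging the boundary vertices. -/
def Piece.IsHalving {G : ColGraph V D C} (A : G.Piece)
    (τ : Equiv.Perm {v // v ∈ A.bdry ∪ A.inn} × Equiv.Perm {h // h ∈ A.darts}) : Prop :=
  τ * τ = 1 ∧ A.graph.Semiregular (Subgroup.zpowers τ) ∧ A.Exchanges τ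

def Piece.Halvable {G : ColGraph V D C} (A : G.Piece) : Prop := ∃ τ, A.IsHalving τ

/-- Some automorphism exchanges the boundary vertices. (This includes the halvable atoms; an atom
with two boundary vertices is asymmetric if this fails.) -/
def Piece.Exchangeable {G : ColGraph V D C} (A : G.Piece) : Prop :=
  ∃ τ ∈ A.graph.aut, A.Exchanges τ

/-- No identification. -/
def Congr.trivial (G : ColGraph V D C) : G.Congr where
  sv := ⊥
  sd := ⊥
  vert_rel := by rintro h _ rfl; rfl
  inv_rel := by rintro h _ rfl; rfl
  color_rel := by rintro h _ rfl; rfl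
  kind_rel := by rintro h _ rfl; rfl

/-- Identification of all boundary vertices. -/
def Piece.mergeBdry {G : ColGraph V D C} (A : G.Piece) : A.graph.Congr where
  sv :=
    { r := fun x y => x = y ∨ (x.1 ∈ A.bdry ∧ y.1 ∈ A.bdry)
      iseqv :=
        { refl := fun _ => Or.inl rfl
          symm := by
            rintro x y (rfl | ⟨h, k⟩)
            · exact Or.inl rfl
            · exact Or.inr ⟨k, h⟩
          trans := by
            rintro x y z (rfl | ⟨h, k⟩) (rfl | ⟨h', k'⟩)
            · exact Or.inl rfl
            · exact Or.inr ⟨h', k'⟩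
            · exact Or.inr ⟨h, k⟩
            · exact Or.inr ⟨h, k'⟩ } }
  sd := ⊥
  vert_rel := by rintro h _ rfl; exact Or.inl rfl
  inv_rel := by rintro h _ rfl; rfl
  color_rel := by rintro h _ rfl; rfl
  kind_rel := by rintro h _ rfl; rfl

/-- The quotients of an atom `A`: the edge-quotient is `A` itself, the loop-quotient is `A` with its
boundary vertices identified, and a half-quotient is `A / ⟨τ⟩` for a semiregular involution `τ`
exchanging the boundary vertices. -/
inductive AtomQuotient {G : ColGraph V D C} (A : G.Piece) where
  | edge
  | loop
  | half (τ : Equiv.Perm {v // v ∈ A.bdry ∪ A.inn} × Equiv.Perm {h // h ∈ A.darts})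
      (hτ : A.IsHalving τ)

def AtomQuotient.congr {G : ColGraph V D C} {A : G.Piece} : AtomQuotient A → A.graph.Congr
  | .edge => Congr.trivial A.graph
  | .loop => A.mergeBdry
  | .half τ hτ => A.graph.orbits (Subgroup.zpowers τ) hτ.2.1.le_aut

/-! ### The reduction -/

/-- The arbitrary choices made in a reduction: the ends of the edge replacing an atom are listed in
some order `e A false`, `e A true` (both being the only boundary vertex if `A` is a block atom). For
asymmetric atoms this is the orientation of the edge, and it is chosen consistently within each
isomorphism class. -/
structure Reduction (G : ColGraph V D C) (R : Set V) where
  e : G.Atom R → Bool → V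
  bdry_eq : ∀ A, A.1.bdry = {e A false, e A true}
  consistent : ∀ A B : G.Atom R, ¬ G.IsBlockPart R A.1 → ¬ A.1.Exchangeable →
    ∀ σ : Iso A.1.graph B.1.graph, Piece.RespectsBdry σ →
      ∀ x, x.1 = e A false → (σ.onV x).1 = e B false

end ColGraph

namespace ColGraph.Reduction

variable {V D C : Type*} {G : ColGraph V D C} {R : Set V}

/-- The vertices that survive the reduction: interiors of atoms are deleted, their boundaries are
kept. (As interiors of atoms contain no boundary vertices of atoms, these are exactly the vertices
in no interior.) -/
def OldV (_ρ : G.Reduction R) : Type _ :=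
  {v : V // (∃ A : G.Atom R, v ∈ A.1.bdry) ∨ ∀ A : G.Atom R, v ∉ A.1.inn}

/-- The half-edges that survive the reduction: those belonging to no atom. -/
def OldD (_ρ : G.Reduction R) : Type _ := {h : D // ∀ A : G.Atom R, h ∉ A.1.darts}

/-- Vertices of the reduced graph: the old ones and a new leaf for every block atom. -/
abbrev NewV (ρ : G.Reduction R) : Type _ := ρ.OldV ⊕ {A : G.Atom R // G.IsBlockPart R A.1}

/-- Half-edges of the reduced graph: the old ones and the two halves of an edge for every atom. -/
abbrev NewD (ρ : G.Reduction R) : Type _ := ρ.OldD ⊕ (G.Atom R × Bool)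

/-- Colours of the reduced graph: the old ones and one for every isomorphism class of atoms. -/
abbrev NewC (_ρ : G.Reduction R) : Type _ := C ⊕ Quot fun A B : G.Atom R => A.1.IsoRel B.1

/-- The boundary vertex of the atom `A` listed at position `i`. -/
def endV (ρ : G.Reduction R) (A : G.Atom R) (i : Bool) : ρ.OldV :=
  ⟨ρ.e A i, Or.inl ⟨A, by rw [ρ.bdry_eq A]; cases i <;> simp⟩⟩

/-- The edge replacing an atom with two boundary vertices is halvable, undirected or directed
according to whether the atom is halvable, symmetric or asymmetric; the pendant edge replacing a
block atom is undirected. -/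
noncomputable def newKind (_ρ : G.Reduction R) (A : G.Atom R) (i : Bool) : EdgeKind :=
  open Classical in
  if G.IsBlockPart R A.1 then .undirected
  else if A.1.Halvable then .halvable
  else if A.1.Exchangeable then .undirected
  else if i then .head else .tail

/-- The reduced graph. Every atom `A` is replaced by an edge with half-edges `(A, false)` and
`(A, true)`, joining its boundary vertices or, for a block atom, joining its boundary vertex to a new
leaf. -/
noncomputable def graph (ρ : G.Reduction R) : ColGraph ρ.NewV ρ.NewD ρ.NewC where
  vert
    | .inl h => .inl ⟨G.vert h.1, Or.inr fun A hA => h.2 A (A.1.mem_of_inn _ hA)⟩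
    | .inr (A, false) => .inl (ρ.endV A false)
    | .inr (A, true) =>
      open Classical in if hA : G.IsBlockPart R A.1 then .inr ⟨A, hA⟩ else .inl (ρ.endV A true)
  inv
    | .inl h => .inl ⟨G.inv h.1, fun A hA => h.2 A (by
        simpa only [G.inv_inv] using A.1.inv_mem _ hA)⟩
    | .inr (A, i) => .inr (A, !i)
  color
    | .inl h => .inl (G.color h.1)
    | .inr (A, _) => .inr (Quot.mk _ A)
  kind
    | .inl h => G.kind h.1
    | .inr (A, i) => ρ.newKind A i
  inv_inv := by
    rintro (h | ⟨A, i⟩)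
    · exact congrArg Sum.inl (Subtype.ext (G.inv_inv h.1))
    · simp
  color_inv := by
    rintro (h | ⟨A, i⟩)
    · exact congrArg Sum.inl (G.color_inv h.1)
    · rfl
  kind_inv := by
    rintro (h | ⟨A, i⟩)
    · exact G.kind_inv h.1
    · simp only [newKind]
      split_ifs <;> simp_all [EdgeKind.flip]

/-- The graph of the reduction epimorphism: `π'` is the automorphism of the reduced graph induced
by the automorphism `π` of `G`. It agrees with `π` on old vertices and old half-edges. If `π` maps
the atom `A` to the atom `B`, then `π'` maps the edge of `A` to the edge of `B`, and the
half-edge at `x` to the half-edge at `π x`. -/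
def Induces (ρ : G.Reduction R) (π : Equiv.Perm V × Equiv.Perm D)
    (π' : Equiv.Perm ρ.NewV × Equiv.Perm ρ.NewD) : Prop :=
  (∀ v : ρ.OldV, ∃ w : ρ.OldV, w.1 = π.1 v.1 ∧ π'.1 (.inl v) = .inl w) ∧
  (∀ h : ρ.OldD, ∃ k : ρ.OldD, k.1 = π.2 h.1 ∧ π'.2 (.inl h) = .inl k) ∧
  ∀ A : G.Atom R, ∃ B : G.Atom R, B.1.bdry = π.1 '' A.1.bdry ∧ B.1.inn = π.1 '' A.1.inn ∧
    B.1.darts = π.2 '' A.1.darts ∧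
    ∀ i, ∃ j, π'.2 (.inr (A, i)) = .inr (B, j) ∧ ρ.e B j = π.1 (ρ.e A i) ∧
      (G.IsBlockPart R A.1 → j = i)

/-- `Γ` is an extension of `Γ'`, that is, `Γ'` is the image of `Γ` under the reduction
epimorphism. -/
def Extends (ρ : G.Reduction R) (Γ : Subgroup (Equiv.Perm V × Equiv.Perm D))
    (Γ' : Subgroup (Equiv.Perm ρ.NewV × Equiv.Perm ρ.NewD)) : Prop :=
  (∀ π ∈ Γ, ∃ π' ∈ Γ', ρ.Induces π π') ∧ ∀ π' ∈ Γ', ∃ π ∈ Γ, ρ.Induces π π'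

/-! ### Expansion of quotients of the reduced graph -/

variable (ρ : G.Reduction R) {Γ' : Subgroup (Equiv.Perm ρ.NewV × Equiv.Perm ρ.NewD)}
  (hΓ' : Γ' ≤ ρ.graph.aut)

/-- The projection of the reduced graph onto its quotient, on vertices. -/
noncomputable def projV (v : ρ.NewV) : Quotient (ρ.graph.orbits Γ' hΓ').sv := Quotient.mk _ v

/-- The projection of the reduced graph onto its quotient, on half-edges. -/
noncomputable def projD (h : ρ.NewD) : Quotient (ρ.graph.orbits Γ' hΓ').sd := Quotient.mk _ h

/-- The atom quotient `q` of `A` corresponds to the image of the edge of `A` in the quotient of the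
reduced graph: an edge-quotient to an edge with two different ends, a loop-quotient to a loop, and
a half-quotient to a standalone half-edge. -/
def Corresponds (A : G.Atom R) : AtomQuotient A.1 → Prop
  | .edge => (ρ.graph.quotient Γ' hΓ').vert (ρ.projD hΓ' (.inr (A, false))) ≠
      (ρ.graph.quotient Γ' hΓ').vert (ρ.projD hΓ' (.inr (A, true)))
  | .loop => (ρ.graph.quotient Γ' hΓ').vert (ρ.projD hΓ' (.inr (A, false))) =
      (ρ.graph.quotient Γ' hΓ').vert (ρ.projD hΓ' (.inr (A, true))) ∧
      ρ.projD hΓ' (.inr (A, false)) ≠ ρ.projD hΓ' (.inr (A, true))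
  | .half _ _ => ρ.projD hΓ' (.inr (A, false)) = ρ.projD hΓ' (.inr (A, true))

/-- The choices in an expansion of a quotient of the reduced graph: for every edge, loop or
half-edge coming from atoms, one of these atoms is selected, and a quotient of it of the
corresponding type. -/
structure Expansion where
  reps : Set (G.Atom R)
  reps_unique : ∀ A : G.Atom R, ∃! B, B ∈ reps ∧
    ∃ i, ρ.projD hΓ' (.inr (A, false)) = ρ.projD hΓ' (.inr (B, i))
  q : ∀ A : reps, AtomQuotient A.1.1
  corresponds : ∀ A : reps, ρ.Corresponds hΓ' A.1 (q A)

variable {ρ} {hΓ'}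

/-- The vertex of the quotient of the atom `A` that is the image of its `i`-th boundary vertex. -/
def Expansion.terminal (X : ρ.Expansion hΓ') (A : X.reps) (i : Bool) :
    Quotient (X.q A).congr.sv :=
  Quotient.mk _ ⟨ρ.e A.1 i, Or.inl (by rw [ρ.bdry_eq A.1]; cases i <;> simp)⟩

/-- Vertices of the quotient of the reduced graph that are orbits of old vertices. -/
abbrev Expansion.OldQV (_X : ρ.Expansion hΓ') : Type _ :=
  {x : Quotient (ρ.graph.orbits Γ' hΓ').sv // ∃ v, x = ρ.projV hΓ' (.inl v)}

/-- Half-edges of the quotient of the reduced graph that are orbits of old half-edges. -/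
abbrev Expansion.OldQD (_X : ρ.Expansion hΓ') : Type _ :=
  {x : Quotient (ρ.graph.orbits Γ' hΓ').sd // ∃ h, x = ρ.projD hΓ' (.inl h)}

/-- The image of an old vertex. -/
noncomputable def Expansion.oldV (X : ρ.Expansion hΓ') (v : ρ.OldV) : X.OldQV := ⟨ρ.projV hΓ' (.inl v), v, rfl⟩

/-- The image of an old half-edge. -/
noncomputable def Expansion.oldD (X : ρ.Expansion hΓ') (h : ρ.OldD) : X.OldQD := ⟨ρ.projD hΓ' (.inl h), h, rfl⟩

/-- Vertices of the expanded graph: the old ones and the interior vertices of the inserted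
quotients of atoms. -/
abbrev Expansion.XV (X : ρ.Expansion hΓ') : Type _ :=
  X.OldQV ⊕ Σ A : X.reps, {y : Quotient (X.q A).congr.sv // ∀ i, y ≠ X.terminal A i}

/-- Half-edges of the expanded graph: the old ones and those of the inserted quotients of atoms. -/
abbrev Expansion.XD (X : ρ.Expansion hΓ') : Type _ :=
  X.OldQD ⊕ Σ A : X.reps, Quotient (X.q A).congr.sd

/-- How vertices of an inserted atom quotient are placed: the images of the boundary vertices of the
atom are glued to the ends of the replaced edge, and the other vertices are new. -/
noncomputable def Expansion.place (X : ρ.Expansion hΓ') (A : X.reps)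
    (y : Quotient (X.q A).congr.sv) : X.XV :=
  open Classical in
  if hy : ∃ i, y = X.terminal A i then .inl (X.oldV (ρ.endV A.1 hy.choose))
  else .inr ⟨A, y, fun i hi => hy ⟨i, hi⟩⟩

/-- The graph obtained from the quotient of the reduced graph by replacing all edges, loops and
half-edges coming from atoms by the selected quotients of atoms. -/
noncomputable def Expansion.graph (X : ρ.Expansion hΓ') : ColGraph X.XV X.XD C where
  vert
    | .inl x => .inl ⟨(ρ.graph.quotient Γ' hΓ').vert x.1, by
        obtain ⟨_, h, rfl⟩ := x
        exact ⟨_, rfl⟩⟩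
    | .inr ⟨A, y⟩ => X.place A ((A.1.1.graph.mod (X.q A).congr).vert y)
  inv
    | .inl x => .inl ⟨(ρ.graph.quotient Γ' hΓ').inv x.1, by
        obtain ⟨_, h, rfl⟩ := x
        exact ⟨_, rfl⟩⟩
    | .inr ⟨A, y⟩ => .inr ⟨A, (A.1.1.graph.mod (X.q A).congr).inv y⟩
  color
    | .inl x => ((ρ.graph.quotient Γ' hΓ').color x.1).getLeft (by
        obtain ⟨_, h, rfl⟩ := x
        rfl)
    | .inr ⟨A, y⟩ => (A.1.1.graph.mod (X.q A).congr).color y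
  kind
    | .inl x => (ρ.graph.quotient Γ' hΓ').kind x.1
    | .inr ⟨A, y⟩ => (A.1.1.graph.mod (X.q A).congr).kind y
  inv_inv := by
    rintro (x | ⟨A, y⟩)
    · exact congrArg Sum.inl (Subtype.ext ((ρ.graph.quotient Γ' hΓ').inv_inv x.1))
    · simp only [ColGraph.inv_inv]
  color_inv := by
    rintro (x | ⟨A, y⟩)
    · simp only [ColGraph.color_inv]
    · simp only [ColGraph.color_inv]
  kind_inv := by
    rintro (x | ⟨A, y⟩)
    · simp only [ColGraph.kind_inv]
    · simp only [ColGraph.kind_inv]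

/-- The quotient `G / Γ` is the expanded graph, up to an isomorphism that is the identity on the
common vertices and half-edges. -/
def Expansion.Realizes (X : ρ.Expansion hΓ') (Γ : Subgroup (Equiv.Perm V × Equiv.Perm D))
    (hΓ : Γ ≤ G.aut) : Prop :=
  ∃ φ : Iso (G.quotient Γ hΓ) X.graph,
    (∀ v : ρ.OldV, φ.onV (Quotient.mk _ v.1) = .inl (X.oldV v)) ∧
    ∀ h : ρ.OldD, φ.onD (Quotient.mk _ h.1) = .inl (X.oldD h)

end ColGraph.Reduction

/-! Minimality makes atoms rigidly separated: the interior of an atom contains no boundary vertex of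
any part (`IsAtom.notMem_bdry`), since otherwise a component cut off inside the atom, a pendant
piece or a dipole would be a smaller part. Hence distinct atoms share neither interior vertices nor
half-edges (`IsAtom.eq_of_mem_inn`, `IsAtom.eq_of_mem_darts`), and `G` is the surviving part of the
graph with the atoms glued in along their boundaries. Automorphisms preserve the root, so they
permute the atoms, and `reductionHom` is a homomorphism into the automorphisms of the reduced graph.

Let `Γ` be semiregular. An element preserving an atom either fixes a boundary vertex, and then it is
trivial, or exchanges two boundary vertices, and then its square is trivial and it halves the atom
(`halving_of_exchange`). So in `G / Γ` each orbit of atoms leaves a copy of one representative: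
unchanged in its interior, perhaps with its two boundary vertices identified, or divided by a
halving. These are the three kinds of atom quotients, and `Expansion.realizes` makes the resulting
isomorphism explicit.

For the converse, `Γ'` has to act on the interiors of atoms. An element taking one new edge to
another is matched by an isomorphism of the atoms, because colours record isomorphism classes and
edge types record which exchanges of ends are possible (`exists_matches`). Independent choices would
not compose, so all isomorphisms start from the representatives: `Charts` gives a map from `B` onto
the image atom for every element of `Γ'`, where an element reversing the edge of `B` acts as the
involution selected by the expansion. Left multiplication on the labels of charts is then an action
of `Γ'` on `G` (`Charts.exists_hom`). Its image is the required group, and its quotient is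
identified by `Expansion.realizes` again. -/

namespace ColGraph

variable {V D C : Type*} {G : ColGraph V D C}

/-! ### Connectivity inside a vertex set -/

/-- `a` and `b` are joined by a walk in the subgraph induced by `S`. -/
def Linked (G : ColGraph V D C) (S : Set V) (a b : V) : Prop :=
  a ∈ S ∧ Relation.ReflTransGen (fun x y => G.simple.Adj x y ∧ y ∈ S) a b

theorem Linked.refl {S : Set V} {a : V} (ha : a ∈ S) : G.Linked S a a := ⟨ha, .refl⟩

theorem Linked.right_mem {S : Set V} {a b : V} (h : G.Linked S a b) : b ∈ S := by
  obtain ⟨ha, h⟩ := h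
  induction h with
  | refl => exact ha
  | tail _ h _ => exact h.2

theorem Linked.trans {S : Set V} {a b c : V} (h : G.Linked S a b) (k : G.Linked S b c) :
    G.Linked S a c := ⟨h.1, h.2.trans k.2⟩

theorem Linked.tail {S : Set V} {a b c : V} (h : G.Linked S a b) (k : G.simple.Adj b c)
    (hc : c ∈ S) : G.Linked S a c := ⟨h.1, h.2.tail ⟨k, hc⟩⟩

theorem Linked.of_adj {S : Set V} {a b : V} (ha : a ∈ S) (hb : b ∈ S) (h : G.simple.Adj a b) :
    G.Linked S a b := (Linked.refl ha).tail h hb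

/-- Induction along a walk. -/
theorem Linked.induct {S : Set V} {a b : V} (h : G.Linked S a b) {P : V → Prop} (h0 : P a)
    (h1 : ∀ x y, G.Linked S a x → P x → G.simple.Adj x y → y ∈ S → P y) : P b := by
  obtain ⟨ha, h⟩ := h
  induction h with
  | refl => exact h0
  | tail hx hy ih => exact h1 _ _ ⟨ha, hx⟩ ih hy.1 hy.2

theorem Linked.symm {S : Set V} {a b : V} (h : G.Linked S a b) : G.Linked S b a :=
  h.induct (P := fun b => G.Linked S b a) (Linked.refl h.1) fun _ _ hx ih hxy hy =>
    (Linked.of_adj hy hx.right_mem hxy.symm).trans ih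

theorem Linked.mono {S T : Set V} (hST : S ⊆ T) {a b : V} (h : G.Linked S a b) :
    G.Linked T a b :=
  h.induct (P := fun b => G.Linked T a b) (Linked.refl (hST h.1)) fun _ _ _ ih hxy hy =>
    ih.tail hxy (hST hy)

theorem Linked.iff_reachable {S : Set V} {a b : V} (ha : a ∈ S) (hb : b ∈ S) :
    G.Linked S a b ↔ (G.simple.induce S).Reachable ⟨a, ha⟩ ⟨b, hb⟩ := by
  constructor
  · intro h
    refine h.induct (P := fun b => ∀ hb : b ∈ S, (G.simple.induce S).Reachable ⟨a, ha⟩ ⟨b, hb⟩)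
      (fun _ => SimpleGraph.Reachable.refl _) (fun x y hx ih hxy hy _ => ?_) hb
    exact (ih hx.right_mem).trans (SimpleGraph.Adj.reachable (by simpa using hxy))
  · intro h
    rw [SimpleGraph.reachable_iff_reflTransGen] at h
    generalize hb' : (⟨b, hb⟩ : S) = b' at h
    have : G.Linked S a b'.1 := by
      clear hb'
      induction h with
      | refl => exact Linked.refl ha
      | tail _ h ih => exact ih.tail (by simpa using h) (Subtype.prop _)
    rw [← hb'] at this
    exact this

theorem preconnected_induce_iff {S : Set V} :
    (G.simple.induce S).Preconnected ↔ ∀ a ∈ S, ∀ b ∈ S, G.Linked S a b := by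
  constructor
  · intro h a ha b hb
    exact (Linked.iff_reachable ha hb).2 (h _ _)
  · intro h
    exact fun a b => (Linked.iff_reachable a.2 b.2).1 (h _ a.2 _ b.2)

theorem connected_induce_iff {S : Set V} :
    (G.simple.induce S).Connected ↔ S.Nonempty ∧ ∀ a ∈ S, ∀ b ∈ S, G.Linked S a b := by
  rw [SimpleGraph.connected_iff, preconnected_induce_iff, Set.nonempty_coe_sort, and_comm]

theorem linked_univ (hG : G.simple.Connected) (a b : V) : G.Linked Set.univ a b := by
  have h := hG.preconnected a b
  rw [SimpleGraph.reachable_iff_reflTransGen] at h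
  induction h with
  | refl => exact Linked.refl trivial
  | tail _ h ih => exact ih.tail h trivial

/-- A walk inside `S` starting in `T` stays in `T` until it leaves `T`, for the first time, into
a vertex of `U`. -/
theorem Linked.first_exit {S T U : Set V} {a b : V} (h : G.Linked S a b) (ha : a ∈ T)
    (hTU : ∀ x ∈ T, ∀ y ∈ S, G.simple.Adj x y → y ∈ T ∨ y ∈ U) :
    (b ∈ T ∧ G.Linked (S ∩ T) a b) ∨
      ∃ u ∈ S ∩ U, ∃ c ∈ T, G.Linked (S ∩ T) a c ∧ G.simple.Adj c u := by
  refine h.induct (P := fun b => (b ∈ T ∧ G.Linked (S ∩ T) a b) ∨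
      ∃ u ∈ S ∩ U, ∃ c ∈ T, G.Linked (S ∩ T) a c ∧ G.simple.Adj c u)
    (Or.inl ⟨ha, Linked.refl ⟨h.1, ha⟩⟩) ?_
  rintro x y - (⟨hx, h1⟩ | h1) hxy hy
  · rcases hTU x hx y hy hxy with h2 | h2
    · exact Or.inl ⟨h2, h1.tail hxy ⟨hy, h2⟩⟩
    · exact Or.inr ⟨y, ⟨hy, h2⟩, x, hx, h1, hxy⟩
  · exact Or.inr h1

/-- The part of `G - S` that can be reached from `a`. -/
def component (G : ColGraph V D C) (S : Set V) (a : V) : Set V := {b | G.Linked Sᶜ a b}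

theorem linked_component {S : Set V} {a b : V} (h : b ∈ G.component S a) :
    G.Linked (G.component S a) a b :=
  Linked.induct (P := fun b => G.Linked (G.component S a) a b) h (Linked.refl (Linked.refl h.1))
    fun _ _ hx ih hxy hy => ih.tail hxy (hx.tail hxy hy)

theorem isComponent_iff {S K : Set V} : G.IsComponent S K ↔ Disjoint K S ∧
    (K.Nonempty ∧ ∀ a ∈ K, ∀ b ∈ K, G.Linked K a b) ∧
      ∀ v ∈ K, ∀ w, G.simple.Adj v w → w ∈ K ∨ w ∈ S := by
  rw [IsComponent, connected_induce_iff]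

theorem isComponent_component {S : Set V} {a : V} (ha : a ∉ S) :
    G.IsComponent S (G.component S a) := by
  rw [isComponent_iff]
  refine ⟨Set.disjoint_left.2 fun b hb => hb.right_mem, ⟨⟨a, Linked.refl ha⟩, fun b hb c hc =>
    (linked_component hb).symm.trans (linked_component hc)⟩, fun v hv w hvw => ?_⟩
  by_cases hw : w ∈ S
  · exact Or.inr hw
  · exact Or.inl (hv.tail hvw hw)

theorem IsComponent.nonempty {S K : Set V} (h : G.IsComponent S K) : K.Nonempty :=
  (isComponent_iff.1 h).2.1.1

theorem IsComponent.linked {S K : Set V} (h : G.IsComponent S K) {a b : V} (ha : a ∈ K)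
    (hb : b ∈ K) : G.Linked K a b := (isComponent_iff.1 h).2.1.2 a ha b hb

/-- A set closed under adjacency up to `S` absorbs walks avoiding `S`. -/
theorem Linked.mem_of_closed {S K : Set V} (hK : ∀ v ∈ K, ∀ w, G.simple.Adj v w → w ∈ K ∨ w ∈ S)
    {a b : V} (h : G.Linked Sᶜ a b) (ha : a ∈ K) : b ∈ K :=
  h.induct (P := fun b => b ∈ K) ha fun _ _ _ ih hxy hy => (hK _ ih _ hxy).resolve_right hy

theorem IsComponent.mem_of_linked {S K : Set V} (hK : G.IsComponent S K)
    {a b : V} (h : G.Linked Sᶜ a b) (ha : a ∈ K) : b ∈ K := h.mem_of_closed hK.2.2 ha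

theorem IsComponent.linked_compl {S K : Set V} (h : G.IsComponent S K) {a b : V} (ha : a ∈ K)
    (hb : b ∈ K) : G.Linked Sᶜ a b :=
  (h.linked ha hb).mono fun _ hx => Set.disjoint_left.1 h.1 hx

/-! ### Blocks -/

theorem isBlock_iff {B : Set V} : G.IsBlock B ↔ Maximal (fun B : Set V =>
    (B.Nonempty ∧ ∀ a ∈ B, ∀ b ∈ B, G.Linked B a b) ∧
      ∀ x ∈ B, ∀ a ∈ B \ {x}, ∀ b ∈ B \ {x}, G.Linked (B \ {x}) a b) B := by
  simp only [IsBlock, connected_induce_iff, preconnected_induce_iff]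

theorem IsBlock.nonempty {B : Set V} (hB : G.IsBlock B) : B.Nonempty := (isBlock_iff.1 hB).1.1.1

theorem IsBlock.linked {B : Set V} (hB : G.IsBlock B) {a b : V} (ha : a ∈ B) (hb : b ∈ B) :
    G.Linked B a b := (isBlock_iff.1 hB).1.1.2 a ha b hb

/-- The vertex `x` may lie outside `B`, so that no case distinction is needed when the lemma is
applied. -/
theorem IsBlock.linked_diff {B : Set V} (hB : G.IsBlock B) {x a b : V} (ha : a ∈ B) (hb : b ∈ B)
    (hax : a ≠ x) (hbx : b ≠ x) : G.Linked (B \ {x}) a b := by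
  by_cases hx : x ∈ B
  · exact (isBlock_iff.1 hB).1.2 x hx a ⟨ha, hax⟩ b ⟨hb, hbx⟩
  · rw [Set.sdiff_singleton_eq_self hx]
    exact hB.linked ha hb

/-- Any two vertices of a block are joined in the block avoiding a third vertex. -/
theorem IsBlock.linked_compl {B : Set V} (hB : G.IsBlock B) {x a b : V} (ha : a ∈ B) (hb : b ∈ B)
    (hax : a ≠ x) (hbx : b ≠ x) : G.Linked {x}ᶜ a b :=
  (hB.linked_diff ha hb hax hbx).mono fun _ h => h.2

/-- A superset of a block without a cut vertex is the block. -/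
theorem IsBlock.subset_of_union {B S : Set V} (hB : G.IsBlock B) {o p : V} (ho : o ∈ B)
    (hp : p ∈ B) (hop : o ≠ p)
    (h : ∀ x, ∀ y ∈ S, y ≠ x → ∃ b ∈ B, b ≠ x ∧ G.Linked ((B ∪ S) \ {x}) y b) : S ⊆ B := by
  have key : ∀ x, ∀ a ∈ (B ∪ S) \ {x}, ∀ b ∈ (B ∪ S) \ {x}, G.Linked ((B ∪ S) \ {x}) a b := by
    intro x a ha b hb
    have h1 : ∀ a ∈ (B ∪ S) \ {x}, ∃ b ∈ B, b ≠ x ∧ G.Linked ((B ∪ S) \ {x}) a b := by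
      rintro a ⟨ha | ha, hax⟩
      · exact ⟨a, ha, hax, Linked.refl ⟨Or.inl ha, hax⟩⟩
      · exact h x a ha hax
    obtain ⟨a', ha', hax', h2⟩ := h1 a ha
    obtain ⟨b', hb', hbx', h3⟩ := h1 b hb
    exact (h2.trans ((hB.linked_diff ha' hb' hax' hbx').mono (Set.sdiff_subset_sdiff_left Set.subset_union_left))).trans
      h3.symm
  -- Connectedness of the union comes from deleting `p`; only `p` itself has to be joined to `o`
  -- inside `B`. This is the use of two distinct vertices of `B`.
  have h2 : ∀ a ∈ B ∪ S, G.Linked (B ∪ S) a o := by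
    intro a ha
    by_cases hao : a = o
    · rw [hao]; exact Linked.refl (Or.inl ho)
    by_cases hap : a = p
    · rw [hap]; exact (hB.linked hp ho).mono Set.subset_union_left
    exact ((key p a ⟨ha, hap⟩ o ⟨Or.inl ho, hop⟩).mono Set.sdiff_subset)
  have := (isBlock_iff.1 hB).le_of_ge (y := B ∪ S) ⟨⟨⟨o, Or.inl ho⟩, fun a ha b hb =>
    (h2 a ha).trans (h2 b hb).symm⟩, fun x _ => key x⟩ Set.subset_union_left
  exact Set.subset_union_right.trans this

/-- Two blocks sharing two vertices are equal. -/
theorem IsBlock.eq_of_two {B B' : Set V} (hB : G.IsBlock B) (hB' : G.IsBlock B') {o p : V}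
    (ho : o ∈ B) (ho' : o ∈ B') (hp : p ∈ B) (hp' : p ∈ B') (hop : o ≠ p) : B = B' := by
  have key : ∀ {B B' : Set V}, G.IsBlock B → G.IsBlock B' → o ∈ B → o ∈ B' → p ∈ B → p ∈ B' →
      B' ⊆ B := by
    intro B B' hB hB' ho ho' hp hp'
    refine hB.subset_of_union ho hp hop fun x y hy hyx => ?_
    have : ∃ b ∈ B, b ∈ B' ∧ b ≠ x := by
      by_cases hox : o = x
      · exact ⟨p, hp, hp', fun h => hop (hox.trans h.symm)⟩
      · exact ⟨o, ho, ho', hox⟩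
    obtain ⟨b, hb, hb', hbx⟩ := this
    exact ⟨b, hb, hbx, (hB'.linked_diff hy hb' hyx hbx).mono (Set.sdiff_subset_sdiff_left Set.subset_union_right)⟩
  exact Set.Subset.antisymm (key hB' hB ho' ho hp' hp) (key hB hB' ho ho' hp hp')

/-- A connected set outside a block is adjacent to at most one vertex of the block. -/
theorem IsBlock.eq_of_ear [Finite V] {B : Set V} (hB : G.IsBlock B) {b₁ b₂ c w : V} (h₁ : b₁ ∈ B)
    (h₂ : b₂ ∈ B) (hc : G.simple.Adj b₁ c) (hcw : G.Linked Bᶜ c w) (hw : G.simple.Adj w b₂) :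
    b₁ = b₂ := by
  by_contra hne
  -- A minimal connected set outside `B` with neighbours `b₁` and `b₂` behaves like a path: adding
  -- it to `B` creates no cut vertex, against the maximality of `B`.
  let Q : Set V → Prop := fun S => S ⊆ Bᶜ ∧ (∀ a ∈ S, ∀ b ∈ S, G.Linked S a b) ∧
    (∃ s ∈ S, G.simple.Adj s b₁) ∧ ∃ s ∈ S, G.simple.Adj s b₂
  have hQ : Q (G.component B c) := ⟨fun _ h => h.right_mem, fun a ha b hb =>
    (linked_component ha).symm.trans (linked_component hb), ⟨c, Linked.refl hcw.1, hc.symm⟩,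
    w, hcw, hw⟩
  obtain ⟨S, -, hS⟩ := exists_minimal_le_of_wellFoundedLT Q _ hQ
  obtain ⟨⟨hSB, hSc, ⟨s₁, hs₁, ha₁⟩, s₂, hs₂, ha₂⟩, hmin⟩ := hS
  have hsub : S ⊆ B := by
    refine hB.subset_of_union h₁ h₂ hne fun x y hy hyx => ?_
    by_contra hcon
    push Not at hcon
    by_cases hxS : x ∈ S
    · -- the vertices separated from `B` by `x` could be dropped
      have hxB : ∀ b ∈ B, b ≠ x := fun b hb h => hSB hxS (h ▸ hb)
      let T : Set V := {z | z ∈ S ∧ (z ≠ x → ∃ b ∈ B, G.Linked ((B ∪ S) \ {x}) z b)}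
      have hyT : y ∉ T := fun h => by
        obtain ⟨b, hb, h⟩ := h.2 hyx
        exact hcon b hb (hxB b hb) h
      have hxT : x ∈ T := ⟨hxS, fun h => (h rfl).elim⟩
      -- On a walk in `S` towards `x`, a vertex of `T` is followed by another vertex of `T` or by
      -- `x`, so `T` is still connected.
      have hTx : ∀ a ∈ T, G.Linked T a x := by
        intro a ha
        by_cases hax : a = x
        · rw [hax]; exact Linked.refl hxT
        rcases (hSc a ha.1 x hxS).first_exit (T := T \ {x}) (U := {x}) ⟨ha, hax⟩ (by
          rintro z ⟨hz, hzx⟩ y hy hzy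
          by_cases hyx : y = x
          · exact Or.inr hyx
          · obtain ⟨b, hb, h⟩ := hz.2 hzx
            exact Or.inl ⟨⟨hy, fun _ => ⟨b, hb, (Linked.of_adj (S := (B ∪ S) \ {x}) ⟨Or.inr hy, hyx⟩
              ⟨Or.inr hz.1, hzx⟩ hzy.symm).trans h⟩⟩, hyx⟩) with h | ⟨u, hu, d, hd, h, hdu⟩
        · exact (h.1.2 rfl).elim
        · rw [Set.mem_singleton_iff.1 hu.2] at hdu
          exact (h.mono fun _ h => h.2.1).tail hdu hxT
      have hmem : ∀ s ∈ S, ∀ b ∈ B, G.simple.Adj s b → s ∈ T := fun s hs b hb h =>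
        ⟨hs, fun hsx => ⟨b, hb, Linked.of_adj ⟨Or.inr hs, hsx⟩ ⟨Or.inl hb, hxB b hb⟩ h⟩⟩
      have := hmin (y := T) ⟨fun _ h => hSB h.1, fun a ha b hb => (hTx a ha).trans (hTx b hb).symm,
        ⟨s₁, hmem s₁ hs₁ _ h₁ ha₁, ha₁⟩, s₂, hmem s₂ hs₂ _ h₂ ha₂, ha₂⟩ (fun _ h => h.1)
      exact hyT (this hy)
    · have hSx : S ⊆ (B ∪ S) \ {x} := fun z hz => ⟨Or.inr hz, fun h => hxS (h ▸ hz)⟩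
      by_cases hx : b₁ = x
      · have hx2 : b₂ ≠ x := fun h => hne (hx.trans h.symm)
        exact hcon b₂ h₂ hx2 (((hSc y hy s₂ hs₂).mono hSx).tail ha₂ ⟨Or.inl h₂, hx2⟩)
      · exact hcon b₁ h₁ hx (((hSc y hy s₁ hs₁).mono hSx).tail ha₁ ⟨Or.inl h₁, hx⟩)
  exact hSB hs₁ (hsub hs₁)

/-- Vertices of a block joined by a walk avoiding `S` are joined by such a walk in the block. -/
theorem IsBlock.linked_of_linked [Finite V] {B S : Set V} (hB : G.IsBlock B) {a b : V}
    (ha : a ∈ B) (hb : b ∈ B) (h : G.Linked Sᶜ a b) : G.Linked (B \ S) a b := by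
  -- While the walk is outside `B`, the invariant remembers the vertex `b₁` at which it left. By
  -- `IsBlock.eq_of_ear` it can only return at `b₁`, so excursions can be cut out.
  refine (h.induct (P := fun w => (w ∈ B → G.Linked (B \ S) a w) ∧ (w ∉ B → ∃ b₁ ∈ B,
    G.Linked (B \ S) a b₁ ∧ ∃ c, G.simple.Adj b₁ c ∧ G.Linked Bᶜ c w))
    ⟨fun _ => Linked.refl ⟨ha, h.1⟩, fun h => (h ha).elim⟩ ?_).1 hb
  rintro x y - ⟨h1, h2⟩ hxy hy
  by_cases hx : x ∈ B
  · refine ⟨fun hyB => (h1 hx).tail hxy ⟨hyB, hy⟩, fun hyB => ⟨x, hx, h1 hx, y, hxy,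
      Linked.refl hyB⟩⟩
  · obtain ⟨b₁, hb₁, hl, c, hc, hcx⟩ := h2 hx
    refine ⟨fun hyB => ?_, fun hyB => ⟨b₁, hb₁, hl, c, hc, hcx.tail hxy hyB⟩⟩
    rw [← hB.eq_of_ear hb₁ hyB hc hcx hxy]
    exact hl

end ColGraph

namespace ColGraph

variable {V D C : Type*} {G : ColGraph V D C} {R : Set V}

/-! ### Parts and their interiors -/

theorem adj_vert_inv (hG : G.IsConnectedLoopless) (h : D) :
    G.simple.Adj (G.vert h) (G.vert (G.inv h)) := ⟨(hG.loopless h).symm, h, rfl, rfl⟩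

/-- A set that is only adjacent to `S` is connected to the rest of the graph through `S`. -/
theorem exists_linked_of_closed (hG : G.IsConnectedLoopless) {S W : Set V} (hW : W.Nonempty)
    (hcl : ∀ v ∈ W, ∀ w, G.simple.Adj v w → w ∈ W ∨ w ∈ S) {a : V} (ha : a ∉ W) :
    ∃ s ∈ S, G.Linked Wᶜ a s := by
  obtain ⟨b, hb⟩ := hW
  -- The last vertex before the first entry into `W` is adjacent to `W` from outside, hence belongs
  -- to `S`.
  rcases (linked_univ hG.connected a b).first_exit (T := Wᶜ) (U := W) ha
    (fun x _ y _ _ => (em (y ∈ W)).symm) with h | ⟨w, hw, s, hs, h, hsw⟩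
  · exact (h.1 hb).elim
  · exact ⟨s, (hcl w hw.2 s hsw.symm).resolve_left hs, h.mono Set.inter_subset_right⟩

/-- The only exits from `K` are the vertices of `S`, and the component contains none of them. -/
theorem component_subset {S S' K : Set V} {z : V}
    (hK : ∀ v ∈ K, ∀ w, G.simple.Adj v w → w ∈ K ∨ w ∈ S) (hz : z ∈ K)
    (h : ∀ s ∈ S, s ∉ G.component S' z) : G.component S' z ⊆ K := fun _ hb =>
  ((linked_component hb).mono fun _ hc hs => h _ hs hc).mem_of_closed hK hz

/-- The properties of block parts. -/
theorem IsBlockPart.exists_closed {A : G.Piece} (hA : G.IsBlockPart R A) :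
    ∃ u, A.bdry = {u} ∧ A.darts = G.touching A.inn ∧ A.inn.Nonempty ∧ u ∉ A.inn ∧
      (∀ v ∈ A.inn, ∀ w, G.simple.Adj v w → w ∈ A.inn ∨ w ∈ ({u} : Set V)) ∧ Disjoint A.inn R ∧
      ∀ x ∈ A.inn, ∃ K, G.IsComponent {u} K ∧ Disjoint K R ∧ x ∈ K ∧ K ⊆ A.inn := by
  obtain ⟨u, hb, hd, -, h⟩ := hA
  have hu : u ∉ A.inn := Set.disjoint_left.1 A.disj (by rw [hb]; rfl)
  refine ⟨u, hb, hd, ?_⟩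
  rcases h with ⟨h1, h2⟩ | ⟨-, h2, h3⟩
  · exact ⟨h1.nonempty, hu, h1.2.2, h2, fun x hx => ⟨_, h1, h2, hx, subset_rfl⟩⟩
  · have key : ∀ x ∈ A.inn, ∃ K, G.IsComponent {u} K ∧ Disjoint K R ∧ x ∈ K ∧ K ⊆ A.inn := by
      intro x hx
      rw [h3] at hx ⊢
      obtain ⟨K, hK, hx⟩ := hx
      exact ⟨K, hK.1, hK.2, hx, Set.subset_sUnion_of_mem hK⟩
    refine ⟨h2, hu, fun v hv w hvw => ?_, Set.disjoint_left.2 fun x hx => ?_, key⟩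
    · obtain ⟨K, hK, -, hvK, hKA⟩ := key v hv
      exact (hK.2.2 v hvK w hvw).imp_left fun h => hKA h
    · obtain ⟨K, hK, hKR, hvK, hKA⟩ := key x hx
      exact Set.disjoint_left.1 hKR hvK

/-- The subgraph formed by a component of `G - S` and `S`, without the edges inside `S`. -/
def IsComponent.piece {S K : Set V} (h : G.IsComponent S K) : G.Piece where
  bdry := S
  inn := K
  darts := G.touching K
  disj := h.1.symm
  inv_mem k hk := by
    simp only [touching, Set.mem_ofPred_eq, G.inv_inv] at hk ⊢
    exact hk.symm
  vert_mem k hk := by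
    by_cases hv : G.vert k ∈ K
    · exact Or.inr hv
    · have hk := hk.resolve_left hv
      exact Or.inl ((h.2.2 _ hk (G.vert k) ⟨fun e => hv (e ▸ hk), G.inv k, rfl, by
        rw [G.inv_inv]⟩).resolve_left hv)
  mem_of_inn _ hk := Or.inl hk

/-- All edges between two vertices. -/
def between (G : ColGraph V D C) (u v : V) : G.Piece where
  bdry := {u, v}
  inn := ∅
  darts := {h | (G.vert h = u ∧ G.vert (G.inv h) = v) ∨ (G.vert h = v ∧ G.vert (G.inv h) = u)}
  disj := Set.disjoint_empty _
  inv_mem k hk := by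
    simp only [Set.mem_ofPred_eq, G.inv_inv] at hk ⊢
    tauto
  vert_mem k hk := by
    simp only [Set.mem_ofPred_eq, Set.union_empty, Set.mem_insert_iff, Set.mem_singleton_iff] at hk ⊢
    tauto
  mem_of_inn _ h := h.elim

theorem touching_mono {K L : Set V} (h : K ⊆ L) : G.touching K ⊆ G.touching L :=
  fun _ hk => hk.imp (fun hk => h hk) (fun hk => h hk)

/-- The form in which minimality is used: it suffices to find a part inside `A` that does not have
the interior vertex `x` of `A` in its own interior. -/
theorem IsAtom.false_of_part {A P : G.Piece} (hA : G.IsAtom R A) (hP : G.IsPart R P)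
    (hi : P.inn ⊆ A.inn) (hd : P.darts ⊆ A.darts) {x : V} (hx : x ∈ A.inn) (hxP : x ∉ P.inn) :
    False := hxP (by rwa [hA.2 P hP hi hd])

/-- The degree of `u` in `B`. -/
noncomputable def degreeIn (G : ColGraph V D C) (B : Set V) (u : V) : ℕ :=
  {h | G.vert h = u ∧ G.vert (G.inv h) ∈ B}.ncard

/-- An atom contains no smaller proper part. -/
theorem IsAtom.false_of_cut {A : G.Piece} (hA : G.IsAtom R A) (hd : A.darts = G.touching A.inn)
    (hR : ¬ R ⊆ A.bdry ∪ A.inn) {B : Set V} (hB : G.IsBlock B) {p q z w x : V} (hp : p ∈ B)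
    (hq : q ∈ B) (hpq : p ≠ q) (hdp : 3 ≤ G.degreeIn B p) (hdq : 3 ≤ G.degreeIn B q)
    (hz : z ∈ B) (hw : w ∈ B) (hzS : z ∉ ({p, q} : Set V)) (hwS : w ∉ ({p, q} : Set V))
    (hzw : ¬ G.Linked ({p, q} : Set V)ᶜ z w) (hsub : G.component {p, q} z ⊆ A.inn)
    (hpA : p ∈ A.bdry ∪ A.inn) (hqA : q ∈ A.bdry ∪ A.inn) (hx : x ∈ A.inn)
    (hxS : x ∈ ({p, q} : Set V)) : False := by
  have hK := isComponent_component (G := G) hzS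
  -- The smaller part is the component of `z` together with `p` and `q`. It differs from `A` because
  -- `x` is on its boundary but inside `A`.
  refine hA.false_of_part (P := hK.piece) (Or.inr (Or.inl ⟨B, p, q, hB, hp, hq, hpq, fun h => ?_,
    hdp, hdq, rfl, rfl, hK, ⟨z, Linked.refl hzS, hz⟩, fun h => hR (h.trans ?_)⟩)) hsub ?_ hx
    (Set.disjoint_right.1 hK.1 hxS)
  · exact hzw ((preconnected_induce_iff.1 h z ⟨hz, hzS⟩ w ⟨hw, hwS⟩).mono fun _ h => h.2)
  · rintro a ((rfl | rfl) | ha)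
    · exact hpA
    · exact hqA
    · exact Or.inr (hsub ha)
  · rw [hd]
    exact touching_mono hsub

/-! ### Interiors of atoms contain no boundary vertices of parts -/

/-- All edges of the dipole would end at `x`, hence belong to `A`; as a dipole has no interior
vertices, it would be a smaller part. -/
theorem IsAtom.notMem_of_isDipole {A A' : G.Piece} (hA : G.IsAtom R A) (hA' : G.IsDipole A') {x : V}
    (hx : x ∈ A.inn) : x ∉ A'.bdry := by
  intro hxA
  have hP : G.IsPart R A' := Or.inr (Or.inr hA')
  obtain ⟨u, v, -, -, -, -, hb, hi, hd⟩ := hA'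
  refine hA.false_of_part hP (by rw [hi]; exact Set.empty_subset _) (fun h hh => ?_) hx
    (by rw [hi]; exact Set.notMem_empty _)
  rw [hb] at hxA
  rw [hd] at hh
  have : G.vert h = x ∨ G.vert (G.inv h) = x := by
    rcases hxA with rfl | rfl <;> rcases hh with hh | hh <;> simp [hh]
  rcases this with rfl | rfl
  · exact A.mem_of_inn h hx
  · have := A.inv_mem _ (A.mem_of_inn (G.inv h) hx)
    rwa [G.inv_inv] at this

/-- The boundary of `A` reaches the root without passing through `x`, so a component of `G - x`
avoiding the root contains no boundary vertex of `A`. Being adjacent to `x`, such a component lies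
in the interior of `A`, and `A'` would be a smaller part. For a proper part `A`, one boundary vertex
reaches the root outside `A` and the other joins it through the block. -/
theorem IsAtom.notMem_of_isBlockPart (hG : G.IsConnectedLoopless) (hR : R.Nonempty)
    {A A' : G.Piece} (hA : G.IsAtom R A) (hA' : G.IsBlockPart R A') {x : V}
    (hx : x ∈ A.inn) : x ∉ A'.bdry := by
  intro hxA
  have hP : G.IsPart R A' := Or.inl hA'
  obtain ⟨x', hb', hd', -, hx', -, -, hK'⟩ := hA'.exists_closed
  rw [hb'] at hxA
  obtain rfl : x = x' := hxA
  suffices h : A'.inn ⊆ A.inn by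
    refine hA.false_of_part hP h ?_ hx hx'
    rw [hd']
    rintro h' (hh | hh)
    · exact A.mem_of_inn _ (h hh)
    · have := A.inv_mem _ (A.mem_of_inn _ (h hh))
      rwa [G.inv_inv] at this
  intro y hy
  obtain ⟨K, hK, hKR, hyK, -⟩ := hK' y hy
  -- it suffices that `K` contains no boundary vertex of `A`
  suffices key : ∃ S : Set V, (∀ v ∈ A.inn, ∀ w, G.simple.Adj v w → w ∈ A.inn ∨ w ∈ S) ∧
      ∃ r ∈ R, ∀ s ∈ S, G.Linked {x}ᶜ s r by
    obtain ⟨S, hcl, r, hr, hS⟩ := key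
    have hSK : ∀ s ∈ S, s ∉ K := fun s hs hsK =>
      Set.disjoint_left.1 hKR (hK.mem_of_linked (hS s hs) hsK) hr
    -- `K` is adjacent to `x`
    obtain ⟨s, hs, h⟩ := exists_linked_of_closed hG hK.nonempty hK.2.2
      (Set.disjoint_right.1 hK.1 (Set.mem_singleton x))
    rcases (linked_univ hG.connected y x).first_exit (T := K) (U := {x}) hyK
      (fun a ha b _ hab => hK.2.2 a ha b hab) with h | ⟨x', hx', c, hc, h, hcx⟩
    · exact (Set.disjoint_left.1 hK.1 h.1 rfl).elim
    · rw [Set.mem_singleton_iff.1 hx'.2] at hcx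
      have hcA : c ∈ A.inn := (hcl x hx c hcx.symm).resolve_right fun h => hSK c h hc
      have hKS : ∀ k ∈ K, k ∈ Sᶜ := fun k hk hkS => hSK k hkS hk
      exact ((h.mono Set.inter_subset_right).symm.mono hKS).mem_of_closed hcl hcA
  rcases hA.1 with h | h | h
  · obtain ⟨u, -, -, hne, hu, hcl, hdis, -⟩ := h.exists_closed
    obtain ⟨r, hr⟩ := hR
    refine ⟨{u}, hcl, r, hr, ?_⟩
    rintro _ rfl
    obtain ⟨s, rfl, h⟩ := exists_linked_of_closed hG hne hcl
      (Set.disjoint_right.1 hdis hr)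
    exact h.symm.mono fun a (ha : a ∉ A.inn) (hax : a = x) => ha (hax ▸ hx)
  · obtain ⟨B, u, v, hB, hu, hv, -, -, -, -, hb, -, hK, -, hRA⟩ := h
    obtain ⟨r, hr, hrA⟩ := Set.not_subset.1 hRA
    have hx2 : x ∉ ({u, v} : Set V) := Set.disjoint_left.1 hK.1 hx
    have huv : G.Linked {x}ᶜ u v := hB.linked_compl hu hv
      (fun h => hx2 (h ▸ by simp)) (fun h => hx2 (h ▸ by simp))
    refine ⟨{u, v}, hK.2.2, r, hr, ?_⟩
    obtain ⟨s, hs, h⟩ := exists_linked_of_closed hG hK.nonempty hK.2.2 (fun h => hrA (Or.inr h))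
    have h : G.Linked {x}ᶜ s r := h.symm.mono fun a (ha : a ∉ A.inn) (hax : a = x) => ha (hax ▸ hx)
    rcases hs with rfl | rfl <;> rintro _ (rfl | rfl)
    · exact h
    · exact huv.symm.trans h
    · exact huv.trans h
    · exact h
  · obtain ⟨u, v, -, -, -, -, -, hi, -⟩ := h
    rw [hi] at hx
    exact hx.elim

/-- Apart from possibly the articulation `u` of `A`, the block `B` of the cut lies inside `A`. If
`u` is not in the interior of `A'`, this component cannot leave `A`, and `A'` is a smaller part. If
it is, the cut lies inside `A`, and everything outside `A`, including the root, is joined to `u`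
without meeting the cut; so `A'` would contain the root. -/
theorem IsAtom.notMem_of_block_proper (hG : G.IsConnectedLoopless)
    {A A' : G.Piece} (hA : G.IsAtom R A) (hA1 : G.IsBlockPart R A) (hA' : G.IsProperPart R A')
    {x : V} (hx : x ∈ A.inn) : x ∉ A'.bdry := by
  intro hxA
  have hP : G.IsPart R A' := Or.inr (Or.inl hA')
  obtain ⟨B, p, q, hB, hp, hq, hpq, -, -, -, hb', hd', hK', ⟨b, hbK, hbB⟩, hRA'⟩ := hA'
  obtain ⟨u, hb, hd, hne, hu, hcl, hdis, -⟩ := hA1.exists_closed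
  have hxp : x ∈ ({p, q} : Set V) := hb' ▸ hxA
  have hxB : x ∈ B := by rcases hxp with rfl | rfl <;> assumption
  have hxu : x ≠ u := fun h => hu (h ▸ hx)
  have hBA : ∀ y ∈ B, y ≠ u → y ∈ A.inn := fun y hy hyu =>
    (hB.linked_compl hxB hy hxu hyu).mem_of_closed hcl hx
  suffices h : A'.inn ⊆ A.inn from hA.false_of_part hP h (by rw [hd, hd']; exact touching_mono h) hx
    (Set.disjoint_right.1 hK'.1 hxp)
  by_contra hnot
  have hu' : u ∈ A'.inn := by
    by_contra hu'
    have hbu : b ≠ u := fun h => hu' (h ▸ hbK)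
    refine hnot fun y hy => ?_
    exact ((hK'.linked hbK hy).mono fun c hc (hcu : c = u) => hu' (hcu ▸ hc)).mem_of_closed hcl
      (hBA b hbB hbu)
  have hpqA : ∀ s ∈ ({p, q} : Set V), s ∈ A.inn := by
    intro s hs
    refine hBA s (by rcases hs with rfl | rfl <;> assumption) ?_
    rintro rfl
    exact Set.disjoint_left.1 hK'.1 hu' hs
  refine hRA' fun r hr => Or.inr ?_
  obtain ⟨s, rfl, h⟩ := exists_linked_of_closed hG hne hcl (Set.disjoint_right.1 hdis hr)
  exact hK'.mem_of_linked (h.symm.mono fun a (ha : a ∉ A.inn) has => ha (hpqA a has)) hu'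

/-! ### Proper atoms against the 2-cuts of other proper parts -/

theorem Linked.exists_outside {K U S : Set V}
    (hcl : ∀ v ∈ K, ∀ w, G.simple.Adj v w → w ∈ K ∨ w ∈ U) {b t : V}
    (h : G.Linked S b t) (hb : b ∉ K) (ht : t ∈ U) : ∃ s ∈ U, G.Linked (S ∩ Kᶜ) b s := by
  by_cases hbU : b ∈ U
  · exact ⟨b, hbU, Linked.refl ⟨h.1, hb⟩⟩
  rcases h.first_exit (T := (K ∪ U)ᶜ) (U := U \ K) (fun h => h.elim hb hbU) (by
    intro x hx y _ hxy
    by_cases hy : y ∈ K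
    · exact (hx (hcl y hy x hxy.symm)).elim
    · by_cases hyU : y ∈ U
      · exact Or.inr ⟨hyU, hy⟩
      · exact Or.inl fun h => h.elim hy hyU) with h | ⟨s, hs, c, -, h, hcs⟩
  · exact (h.1 (Or.inr ht)).elim
  · exact ⟨s, hs.2.1, (h.mono (T := S ∩ Kᶜ) fun a ha => ⟨ha.1, fun h => ha.2 (Or.inl h)⟩).tail hcs
      ⟨hs.1, hs.2.2⟩⟩

theorem Linked.exists_inside {K U S : Set V}
    (hcl : ∀ v ∈ K, ∀ w, G.simple.Adj v w → w ∈ K ∨ w ∈ U) {b t : V}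
    (h : G.Linked S b t) (hb : b ∈ K) (ht : t ∉ K) :
    ∃ s ∈ U, s ∈ S ∧ G.Linked (S ∩ (K ∪ {s})) b s := by
  rcases h.first_exit (T := K) (U := U) hb (fun x hx y _ hxy => hcl x hx y hxy) with
    h | ⟨s, hs, c, -, h, hcs⟩
  · exact (ht h.1).elim
  · exact ⟨s, hs.2, hs.1, (h.mono (T := S ∩ (K ∪ {s})) fun a ha => ⟨ha.1, Or.inl ha.2⟩).tail hcs
      ⟨hs.1, Or.inr rfl⟩⟩

/-- By `IsBlock.linked_of_linked`, vertices separated in the block are separated in the whole graph.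
The boundary is listed with the given vertex first. -/
theorem IsProperPart.exists_cut [Finite V] {A : G.Piece} (hA : G.IsProperPart R A) {x : V}
    (hx : x ∈ A.bdry) : ∃ B y, G.IsBlock B ∧ x ∈ B ∧ y ∈ B ∧ x ≠ y ∧ 3 ≤ G.degreeIn B x ∧
      3 ≤ G.degreeIn B y ∧ A.bdry = {x, y} ∧ ∃ z ∈ B, ∃ w ∈ B, z ∉ ({x, y} : Set V) ∧
        w ∉ ({x, y} : Set V) ∧ ¬ G.Linked ({x, y} : Set V)ᶜ z w := by
  obtain ⟨B, u, v, hB, hu, hv, huv, hc, hdu, hdv, hb, -⟩ := hA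
  rw [preconnected_induce_iff] at hc
  push Not at hc
  obtain ⟨z, hz, w, hw, hzw⟩ := hc
  have hzw : ¬ G.Linked ({u, v} : Set V)ᶜ z w := fun h => hzw (hB.linked_of_linked hz.1 hw.1 h)
  rw [hb] at hx
  rcases hx with rfl | rfl
  · exact ⟨B, v, hB, hu, hv, huv, hdu, hdv, hb, z, hz.1, w, hw.1, hz.2, hw.2, hzw⟩
  · rw [Set.pair_comm] at hb hzw hz hw
    exact ⟨B, u, hB, hv, hu, huv.symm, hdv, hdu, hb, z, hz.1, w, hw.1, hz.2, hw.2, hzw⟩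

/-- Two parallel edges with an end inside an atom form a smaller dipole. -/
theorem IsAtom.false_of_parallel {A : G.Piece} (hA : G.IsAtom R A) {x u : V} (hx : x ∈ A.inn)
    (hxu : x ≠ u) (hdx : 3 ≤ {h | G.vert h = x}.ncard) (hdu : 3 ≤ {h | G.vert h = u}.ncard)
    (h2 : 2 ≤ {h | G.vert h = x ∧ G.vert (G.inv h) = u}.ncard) : False :=
  hA.notMem_of_isDipole (A' := G.between x u) ⟨x, u, hxu, hdx, hdu, h2, rfl, rfl, rfl⟩ hx
    (Or.inl rfl)

theorem degreeIn_le [Finite D] {B : Set V} {x : V} {n : ℕ} (h : n ≤ G.degreeIn B x) :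
    n ≤ {h | G.vert h = x}.ncard :=
  h.trans (Set.ncard_le_ncard (fun _ h => h.1) (Set.toFinite _))

/-- A vertex of degree at least three in the interior of a proper atom is not the only interior
vertex in the block. -/
theorem IsAtom.exists_ne_of_proper [Finite D] (hG : G.IsConnectedLoopless) {A : G.Piece}
    (hA : G.IsAtom R A) {B : Set V} {u v x : V}
    (hdu : 3 ≤ G.degreeIn B u) (hdv : 3 ≤ G.degreeIn B v) (hK : G.IsComponent {u, v} A.inn)
    (hx : x ∈ A.inn) (hdx : 3 ≤ G.degreeIn B x) : ∃ z ∈ A.inn, z ∈ B ∧ z ≠ x := by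
  by_contra hcon
  push Not at hcon
  -- All edges counted by the degree of `x` in `B` would lead to `u` or `v`. Of at least three such
  -- edges two are parallel, which gives a dipole at an interior vertex.
  have hsub : {h | G.vert h = x ∧ G.vert (G.inv h) ∈ B} ⊆
      {h | G.vert h = x ∧ G.vert (G.inv h) = u} ∪ {h | G.vert h = x ∧ G.vert (G.inv h) = v} := by
    rintro h ⟨rfl, hB⟩
    rcases hK.2.2 _ hx _ (adj_vert_inv hG h) with h1 | h1 | h1
    · exact (hG.loopless h (hcon _ h1 hB)).elim
    · exact Or.inl ⟨rfl, h1⟩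
    · exact Or.inr ⟨rfl, h1⟩
  have h3 := (hdx.trans (Set.ncard_le_ncard hsub (Set.toFinite _))).trans (Set.ncard_union_le _ _)
  have hxS := Set.disjoint_left.1 hK.1 hx
  rcases le_or_gt 2 {h | G.vert h = x ∧ G.vert (G.inv h) = u}.ncard with h | h
  · exact hA.false_of_parallel hx (fun e => hxS (Or.inl e)) (degreeIn_le hdx) (degreeIn_le hdu) h
  · exact hA.false_of_parallel hx (fun e => hxS (Or.inr e)) (degreeIn_le hdx) (degreeIn_le hdv)
      (by omega)

/-- The interior of a proper atom is not cut by a boundary vertex and an interior vertex. -/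
theorem IsAtom.linked_of_proper {A : G.Piece} (hA : G.IsAtom R A) {B : Set V} {u v x z : V}
    (hB : G.IsBlock B) (hu : u ∈ B) (hv : v ∈ B) (huv : u ≠ v) (hdu : 3 ≤ G.degreeIn B u)
    (hb : A.bdry = {u, v}) (hd : A.darts = G.touching A.inn) (hK : G.IsComponent {u, v} A.inn)
    (hR : ¬ R ⊆ A.bdry ∪ A.inn) (hx : x ∈ A.inn) (hxB : x ∈ B) (hdx : 3 ≤ G.degreeIn B x)
    (hz : z ∈ A.inn) (hzB : z ∈ B) (hzx : z ≠ x) :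
    G.Linked (({u, x} : Set V)ᶜ ∩ (A.inn ∪ {v})) z v := by
  have hS := fun s (hs : s ∈ A.inn) => Set.disjoint_left.1 hK.1 hs
  have hvK : v ∉ A.inn := fun h => hS v h (Or.inr rfl)
  have hux : u ≠ x := fun h => hS x hx (Or.inl h.symm)
  have hvx : v ≠ x := fun h => hvK (h ▸ hx)
  have hzS : z ∉ ({u, x} : Set V) := by
    rintro (h | h)
    · exact hS z hz (Or.inl h)
    · exact hzx h
  by_cases hvz : G.Linked ({u, x} : Set V)ᶜ z v
  · obtain ⟨s, hs, hs', h⟩ := hvz.exists_inside hK.2.2 hz hvK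
    rcases hs with rfl | rfl
    · exact (hs' (Or.inl rfl)).elim
    · exact h
  -- If `{u, x}` separates `z` from `v`, the component of `z` contains neither `u` nor `v`, so it
  -- stays inside `A` and forms a smaller proper part.
  · refine (hA.false_of_cut hd hR hB hu hxB hux hdu hdx hzB hv hzS ?_ hvz (component_subset hK.2.2 hz
      ?_) (Or.inl (hb ▸ Or.inl rfl)) (Or.inr hx) hx (Or.inr rfl)).elim
    · rintro (h | h)
      · exact huv h.symm
      · exact hvx h
    · rintro s (rfl | rfl)
      · exact fun h => h.right_mem (Or.inl rfl)
      · exact hvz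

/-- A pair with exactly one vertex inside `A` cannot cut `B`: every other vertex of `B` is joined to
`u`. Vertices inside `A` get there within `A` by `IsAtom.linked_of_proper`; `v`, unless it is `y`,
gets there through an interior vertex different from `x`; vertices outside `A` reach `u` or `v`
outside `A`, hence without meeting `x`. -/
theorem IsAtom.false_of_crossing [Finite D] (hG : G.IsConnectedLoopless)
    {A : G.Piece} (hA : G.IsAtom R A) {B : Set V} {u v x y z w : V}
    (hB : G.IsBlock B) (hu : u ∈ B) (hv : v ∈ B) (huv : u ≠ v) (hdu : 3 ≤ G.degreeIn B u)
    (hdv : 3 ≤ G.degreeIn B v) (hb : A.bdry = {u, v}) (hd : A.darts = G.touching A.inn)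
    (hK : G.IsComponent {u, v} A.inn) (hR : ¬ R ⊆ A.bdry ∪ A.inn) (hx : x ∈ A.inn) (hxB : x ∈ B)
    (hdx : 3 ≤ G.degreeIn B x) (hyK : y ∉ A.inn) (hyu : y ≠ u)
    (hz : z ∈ B) (hw : w ∈ B) (hzS : z ∉ ({x, y} : Set V)) (hwS : w ∉ ({x, y} : Set V))
    (hzw : ¬ G.Linked ({x, y} : Set V)ᶜ z w) : False := by
  have hS := fun s (hs : s ∈ A.inn) => Set.disjoint_left.1 hK.1 hs
  have hK' : G.IsComponent {v, u} A.inn := by rwa [Set.pair_comm]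
  have hb' : A.bdry = {v, u} := by rwa [Set.pair_comm]
  -- A walk within the interior and the boundary vertex `c` cannot meet `y`, which is neither
  -- interior nor equal to `c`.
  have hin : ∀ {c}, c ∉ A.inn → c ≠ y → ∀ {d}, (({d, x} : Set V)ᶜ ∩ (A.inn ∪ {c})) ⊆
      ({x, y} : Set V)ᶜ := by
    rintro c hc hcy d a ⟨ha, ha'⟩ (rfl | rfl)
    · exact ha (Or.inr rfl)
    · exact ha'.elim hyK fun h => hcy h.symm
  have huK : u ∉ A.inn := fun h => hS u h (Or.inl rfl)
  have hvK : v ∉ A.inn := fun h => hS v h (Or.inr rfl)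
  have h1 : ∀ a ∈ A.inn, a ∈ B → a ≠ x → G.Linked ({x, y} : Set V)ᶜ a u := fun a ha haB hax =>
    (hA.linked_of_proper hB hv hu huv.symm hdv hb' hd hK' hR hx hxB hdx ha haB hax).mono
      (hin huK hyu.symm)
  have h2 : v ≠ y → G.Linked ({x, y} : Set V)ᶜ v u := by
    intro hvy
    obtain ⟨a, ha, haB, hax⟩ := hA.exists_ne_of_proper hG hdu hdv hK hx hdx
    exact ((hA.linked_of_proper hB hu hv huv hdu hb hd hK hR hx hxB hdx ha haB hax).mono
      (hin hvK hvy)).symm.trans (h1 a ha haB hax)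
  have h3 : ∀ a ∈ B, a ∉ ({x, y} : Set V) → G.Linked ({x, y} : Set V)ᶜ a u := by
    intro a haB haS
    by_cases ha : a ∈ A.inn
    · exact h1 a ha haB fun h => haS (Or.inl h)
    · obtain ⟨s, hs, h⟩ := (hB.linked_compl haB hu (fun h => haS (Or.inr h)) hyu.symm).exists_outside
        hK.2.2 ha (Or.inl rfl)
      have h : G.Linked ({x, y} : Set V)ᶜ a s := h.mono (by
        rintro b ⟨hb1, hb2⟩ (rfl | rfl)
        · exact hb2 hx
        · exact hb1 rfl)
      rcases hs with rfl | rfl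
      · exact h
      · exact h.trans (h2 fun e => h.right_mem (Or.inr e))
  exact hzw ((h3 z hz hzS).trans (h3 w hw hwS).symm)

/-- If the cuts `{u, v}` and `{x, y}` lie in the same block, then either `y` is outside `A` and the
cuts cross, or `y` is inside `A`; in the latter case everything outside the interior of `A` lies in
one component of `G - {x, y}`, and another component is a smaller part inside `A`. If the blocks
differ, they share at most one vertex, so `B` is not cut by `{x, y}`, and a component missing `B`
lies inside `A`. -/
theorem IsAtom.notMem_of_proper_proper [Finite V] [Finite D] (hG : G.IsConnectedLoopless)
    {A A' : G.Piece} (hA : G.IsAtom R A) (hA1 : G.IsProperPart R A) (hA' : G.IsProperPart R A')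
    {x : V} (hx : x ∈ A.inn) : x ∉ A'.bdry := by
  intro hxA
  obtain ⟨B', y, hB', hxB', hyB', hxy, hdx, hdy, -, z, hz, w, hw, hzS, hwS, hzw⟩ :=
    hA'.exists_cut hxA
  obtain ⟨B, u, v, hB, hu, hv, huv, hcut, hdu, hdv, hb, hd, hK, -, hR⟩ := id hA1
  have hS := fun s (hs : s ∈ A.inn) => Set.disjoint_left.1 hK.1 hs
  have huK : u ∉ A.inn := fun h => hS u h (Or.inl rfl)
  have hvK : v ∉ A.inn := fun h => hS v h (Or.inr rfl)
  have pick : ∀ t, ∃ z ∈ B', z ∉ ({x, y} : Set V) ∧ ¬ G.Linked ({x, y} : Set V)ᶜ z t := by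
    intro t
    by_contra hcon
    push Not at hcon
    exact hzw ((hcon z hz hzS).trans (hcon w hw hwS).symm)
  by_cases hBB : B' = B
  · subst hBB
    by_cases hyK : y ∈ A.inn
    -- Since `{u, v}` is a cut, `B` has a vertex `c` outside `A`; it reaches `u` avoiding `v`, and
    -- `v` avoiding `u`, in both cases outside the interior of `A`.
    · have huv' : G.Linked A.innᶜ u v := by
        have : ∃ c ∈ B', c ∉ A.inn ∧ c ∉ ({u, v} : Set V) := by
          rw [preconnected_induce_iff] at hcut
          push Not at hcut
          obtain ⟨c, hc, d, hd, hcd⟩ := hcut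
          by_contra hcon
          push Not at hcon
          have hmem : ∀ c ∈ B' \ {u, v}, c ∈ A.inn := fun c hc => by
            by_contra h
            exact hc.2 (hcon c hc.1 h)
          exact hcd (hB.linked_of_linked hc.1 hd.1 (hK.linked_compl (hmem c hc) (hmem d hd)))
        obtain ⟨c, hcB, hcK, hcS⟩ := this
        obtain ⟨s, hs, h⟩ := (hB.linked_compl (x := v) hcB hu (fun h => hcS (Or.inr h))
          huv).exists_outside hK.2.2 hcK (Or.inl rfl)
        obtain ⟨s', hs', h'⟩ := (hB.linked_compl (x := u) hcB hv (fun h => hcS (Or.inl h))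
          huv.symm).exists_outside hK.2.2 hcK (Or.inr rfl)
        obtain rfl : s = u := hs.resolve_right fun e => h.right_mem.1 e
        obtain rfl : s' = v := hs'.resolve_left fun e => h'.right_mem.1 e
        exact (h.symm.mono Set.inter_subset_right).trans (h'.mono Set.inter_subset_right)
      have hout : ∀ a, a ∉ A.inn → G.Linked ({x, y} : Set V)ᶜ a u := by
        intro a ha
        obtain ⟨s, hs, h⟩ := (linked_univ hG.connected a u).exists_outside hK.2.2 ha (Or.inl rfl)
        have h : G.Linked A.innᶜ a u := by
          rcases hs with rfl | rfl
          · exact h.mono Set.inter_subset_right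
          · exact (h.mono Set.inter_subset_right).trans huv'.symm
        refine h.mono ?_
        rintro b hb (rfl | rfl)
        · exact hb hx
        · exact hb hyK
      obtain ⟨c, hc, hcS, hcu⟩ := pick u
      refine hA.false_of_cut hd hR hB hxB' hyB' hxy hdx hdy hc hu hcS (fun h => (hout u huK).1 h)
        hcu ?_ (Or.inr hx) (Or.inr hyK) hx (Or.inl rfl)
      intro b hb
      by_contra hbK
      exact hcu (Linked.trans hb (hout b hbK))
    · by_cases hyu : y = u
      · rw [Set.pair_comm] at hb hK
        exact hA.false_of_crossing hG hB hv hu huv.symm hdv hdu hb hd hK hR hx hxB' hdx hyK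
          (fun h => huv (hyu.symm.trans h)) hz hw hzS hwS hzw
      · exact hA.false_of_crossing hG hB hu hv huv hdu hdv hb hd hK hR hx hxB' hdx hyK
          hyu hz hw hzS hwS hzw
  · -- the block `B'` sits inside the atom
    have huxv : u ≠ x ∧ v ≠ x := ⟨fun h => huK (h ▸ hx), fun h => hvK (h ▸ hx)⟩
    have hnot : ¬ (u ∈ B' ∧ v ∈ B') := fun h => hBB (hB'.eq_of_two hB h.1 hu h.2 hv huv)
    have hin : ∀ s ∈ ({u, v} : Set V), (∀ t ∈ ({u, v} : Set V), t ≠ s → t ∉ B') →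
        ∀ a ∈ B', a ∉ ({u, v} : Set V) → a ∈ A.inn := by
      intro s hs hst a ha haS
      refine ((hB'.linked_diff (x := s) hxB' ha (fun h => hS x hx (h ▸ hs))
        (fun h => haS (h ▸ hs))).mono ?_).mem_of_closed hK.2.2 hx
      exact fun b hb hbS => hst b hbS hb.2 hb.1
    have hin : ∀ a ∈ B', a ∉ ({u, v} : Set V) → a ∈ A.inn := by
      by_cases huB : u ∈ B'
      · refine hin u (Or.inl rfl) ?_
        rintro t (rfl | rfl) h
        · exact (h rfl).elim
        · exact fun h => hnot ⟨huB, h⟩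
      · refine hin v (Or.inr rfl) ?_
        rintro t (rfl | rfl) h
        · exact huB
        · exact (h rfl).elim
    -- At most one of `x`, `y` lies in `B`. That one is taken as `s`, or an irrelevant vertex if
    -- there is none; deleting it leaves `B` connected.
    have hone : ∃ s, B \ {s} ⊆ ({x, y} : Set V)ᶜ ∧ ∃ t ∈ B, t ≠ s ∧
        ∀ b ∈ B, b ∉ ({x, y} : Set V) → b ≠ s := by
      by_cases hxB : x ∈ B
      · refine ⟨x, ?_, u, hu, huxv.1, fun b _ hb h => hb (Or.inl h)⟩
        rintro b hb (rfl | rfl)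
        · exact hb.2 rfl
        · exact hBB (hB'.eq_of_two hB hxB' hxB hyB' hb.1 hxy)
      · have : ∃ t ∈ B, t ≠ y := by
          by_cases h : u = y
          · exact ⟨v, hv, fun e => huv (h.trans e.symm)⟩
          · exact ⟨u, hu, h⟩
        obtain ⟨t, ht, hty⟩ := this
        refine ⟨y, ?_, t, ht, hty, fun b _ hb h => hb (Or.inr h)⟩
        rintro b hb (rfl | rfl)
        · exact hxB hb.1
        · exact hb.2 rfl
    obtain ⟨s, hs, t, ht, hts, hbs⟩ := hone
    have htS := hs ⟨ht, hts⟩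
    obtain ⟨c, hc, hcS, hct⟩ := pick t
    have hcB : ∀ b ∈ B, b ∉ G.component {x, y} c := by
      intro b hb hbc
      exact hct (Linked.trans hbc ((hB.linked_diff hb ht (hbs b hb hbc.right_mem) hts).mono hs))
    have huvc : ∀ r ∈ ({u, v} : Set V), r ∉ G.component {x, y} c := by
      rintro r (rfl | rfl)
      · exact hcB _ hu
      · exact hcB _ hv
    have hcK : c ∈ A.inn := hin c hc fun h => huvc c h (Linked.refl hcS)
    have hpick : ∃ d ∈ B', d ∉ ({x, y} : Set V) ∧ ¬ G.Linked ({x, y} : Set V)ᶜ c d := by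
      obtain ⟨d, hd, hdS, h⟩ := pick c
      exact ⟨d, hd, hdS, fun h' => h h'.symm⟩
    obtain ⟨d, hdB, hdS, hcd⟩ := hpick
    refine hA.false_of_cut hd hR hB' hxB' hyB' hxy hdx hdy hc hdB hcS hdS hcd
      (component_subset hK.2.2 hcK huvc) (Or.inr hx) ?_ hx (Or.inl rfl)
    by_cases hy : y ∈ ({u, v} : Set V)
    · exact Or.inl (hb ▸ hy)
    · exact Or.inr (hin y hyB' hy)

/-- The interior of an atom contains no boundary vertices of parts. -/
theorem IsAtom.notMem_bdry [Finite V] [Finite D] (hG : G.IsConnectedLoopless) (hR : R.Nonempty)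
    {A A' : G.Piece} (hA : G.IsAtom R A) (hA' : G.IsPart R A') {x : V} (hx : x ∈ A.inn) :
    x ∉ A'.bdry := by
  rcases hA' with h | h | h
  · exact hA.notMem_of_isBlockPart hG hR h hx
  · rcases hA.1 with h1 | h1 | ⟨u, v, -, -, -, -, -, hi, -⟩
    · exact hA.notMem_of_block_proper hG h1 h hx
    · exact hA.notMem_of_proper_proper hG h1 h hx
    · rw [hi] at hx
      exact hx.elim
  · exact hA.notMem_of_isDipole h hx

/-! ### Atoms are disjoint -/

/-- Every interior vertex lies in a connected set of interior vertices that is adjacent to the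
boundary only; this set is the whole interior unless the part is the union of all components at an
articulation that avoid the root. -/
theorem IsPart.exists_component {A : G.Piece} (hA : G.IsPart R A) {x : V} (hx : x ∈ A.inn) :
    A.darts = G.touching A.inn ∧ ∃ K, G.IsComponent A.bdry K ∧ x ∈ K ∧ K ⊆ A.inn ∧ (K = A.inn ∨
      ∃ u, A.bdry = {u} ∧ A.inn = ⋃₀ {K | G.IsComponent {u} K ∧ Disjoint K R}) := by
  rcases hA with ⟨u, hb, hd, -, h⟩ | ⟨B, u, v, -, -, -, -, -, -, -, hb, hd, hK, -⟩ |
    ⟨u, v, -, -, -, -, -, hi, -⟩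
  · refine ⟨hd, ?_⟩
    rcases h with ⟨h1, -⟩ | ⟨-, -, h⟩
    · exact ⟨A.inn, hb ▸ h1, hx, subset_rfl, Or.inl rfl⟩
    · have hx' := hx
      rw [h] at hx'
      obtain ⟨K, hK, hxK⟩ := hx'
      refine ⟨K, hb ▸ hK.1, hxK, ?_, Or.inr ⟨u, hb, h⟩⟩
      rw [h]
      exact Set.subset_sUnion_of_mem hK
  · exact ⟨hd, A.inn, hb ▸ hK, hx, subset_rfl, Or.inl rfl⟩
  · rw [hi] at hx
    exact hx.elim

/-- The components around `x` in both interiors coincide, since neither contains a boundary vertex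
of the other atom. If such a component is a whole interior, minimality applies. Otherwise both atoms
are unions of components at an articulation, and the articulations agree because a component
attached to nothing else than itself would be all of `G`. -/
theorem IsAtom.eq_of_mem_inn [Finite V] [Finite D] (hG : G.IsConnectedLoopless) (hR : R.Nonempty)
    {A A' : G.Piece} (hA : G.IsAtom R A) (hA' : G.IsAtom R A') {x : V} (hx : x ∈ A.inn)
    (hx' : x ∈ A'.inn) : A = A' := by
  obtain ⟨hd, K, hK, hxK, hKA, h⟩ := hA.1.exists_component hx
  obtain ⟨hd', K', hK', hxK', hKA', h'⟩ := hA'.1.exists_component hx'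
  have hKK : K ⊆ K' := fun y hy => hK'.mem_of_linked ((hK.linked hxK hy).mono
    fun z hz => hA.notMem_bdry hG hR hA'.1 (hKA hz)) hxK'
  have hKK' : K' ⊆ K := fun y hy => hK.mem_of_linked ((hK'.linked hxK' hy).mono
    fun z hz => hA'.notMem_bdry hG hR hA.1 (hKA' hz)) hxK
  rcases h with rfl | ⟨u, hb, h⟩
  · have := hKK.trans hKA'
    exact hA'.2 A hA.1 this (by rw [hd, hd']; exact touching_mono this)
  rcases h' with rfl | ⟨u', hb', h'⟩
  · have := hKK'.trans hKA
    exact (hA.2 A' hA'.1 this (by rw [hd, hd']; exact touching_mono this)).symm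
  obtain rfl := Set.Subset.antisymm hKK hKK'
  obtain rfl : u = u' := by
    by_contra hne
    have huK : u ∉ K := Set.disjoint_right.1 hK.1 (by rw [hb]; rfl)
    rw [hb] at hK
    rw [hb'] at hK'
    refine huK (((linked_univ hG.connected x u).mono ?_).mem_of_closed (S := ∅) (K := K) ?_ hxK)
    · simp
    · intro a ha b hab
      rcases hK.2.2 a ha b hab with h | rfl
      · exact Or.inl h
      · exact Or.inl ((hK'.2.2 a ha b hab).resolve_right hne)
  have hi : A.inn = A'.inn := h.trans h'.symm
  exact Piece.ext (hb.trans hb'.symm) hi (by rw [hd, hd', hi])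

/-- Unless `A` is a dipole, a common edge has an end interior to `A`; this end is not on the
boundary of `A'`, so it is interior to both. Two dipoles with a common edge have the same ends. -/
theorem IsAtom.eq_of_mem_darts [Finite V] [Finite D] (hG : G.IsConnectedLoopless)
    (hR : R.Nonempty) {A A' : G.Piece} (hA : G.IsAtom R A) (hA' : G.IsAtom R A') {k : D}
    (hk : k ∈ A.darts) (hk' : k ∈ A'.darts) : A = A' := by
  have key : ∀ {A A' : G.Piece}, G.IsAtom R A → G.IsAtom R A' → k ∈ A'.darts → ∀ k', k' ∈ A'.darts →
      G.vert k' ∈ A.inn → A = A' := by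
    intro A A' hA hA' _ k' hk' hv
    rcases A'.vert_mem k' hk' with h | h
    · exact (hA.notMem_bdry hG hR hA'.1 hv h).elim
    · exact hA.eq_of_mem_inn hG hR hA' hv h
  have key2 : ∀ {A A' : G.Piece}, G.IsAtom R A → G.IsAtom R A' → k ∈ A.darts → k ∈ A'.darts →
      A = A' ∨ G.IsDipole A := by
    intro A A' hA hA' hk hk'
    have aux : A.darts = G.touching A.inn → A = A' ∨ G.IsDipole A := by
      intro hd
      rw [hd] at hk
      rcases hk with hk | hk
      · exact Or.inl (key hA hA' hk' k hk' hk)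
      · exact Or.inl (key hA hA' hk' _ (A'.inv_mem _ hk') hk)
    rcases hA.1 with ⟨u, hb, hd, -⟩ | ⟨B, u, v, -, -, -, -, -, -, -, hb, hd, -⟩ | h
    · exact aux hd
    · exact aux hd
    · exact Or.inr h
  rcases key2 hA hA' hk hk' with h | h
  · exact h
  rcases key2 hA' hA hk' hk with h' | h'
  · exact h'.symm
  obtain ⟨u, v, -, -, -, -, hb, hi, hd⟩ := h
  obtain ⟨u', v', -, -, -, -, hb', hi', hd'⟩ := h'
  rw [hd] at hk
  rw [hd'] at hk'
  rcases hk with ⟨rfl, rfl⟩ | ⟨rfl, rfl⟩ <;> rcases hk' with ⟨rfl, rfl⟩ | ⟨rfl, rfl⟩ <;>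
    refine Piece.ext ?_ (hi.trans hi'.symm) ?_ <;> simp only [hb, hb', hd, hd', Set.pair_comm] <;>
    simp only [or_comm]

end ColGraph

namespace ColGraph

variable {V D C : Type*} {G : ColGraph V D C} {R : Set V}

/-! ### Automorphisms preserve parts -/

theorem aut_vert (π : G.aut) (h : D) : G.vert (π.1.2 h) = π.1.1 (G.vert h) := (π.2 h).1

theorem aut_inv (π : G.aut) (h : D) : G.inv (π.1.2 h) = π.1.2 (G.inv h) := (π.2 h).2.1

theorem aut_color (π : G.aut) (h : D) : G.color (π.1.2 h) = G.color h := (π.2 h).2.2.1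

theorem aut_kind (π : G.aut) (h : D) : G.kind (π.1.2 h) = G.kind h := (π.2 h).2.2.2

theorem aut_inv_apply_fst (π : G.aut) (v : V) : (π⁻¹).1.1 (π.1.1 v) = v :=
  π.1.1.symm_apply_apply v

theorem aut_inv_apply_snd (π : G.aut) (h : D) : (π⁻¹).1.2 (π.1.2 h) = h :=
  π.1.2.symm_apply_apply h

theorem aut_inv_image_fst (π : G.aut) (S : Set V) : (π⁻¹).1.1 '' (π.1.1 '' S) = S := by
  rw [Set.image_image]
  simp only [aut_inv_apply_fst, Set.image_id']

theorem aut_inv_image_snd (π : G.aut) (S : Set D) : (π⁻¹).1.2 '' (π.1.2 '' S) = S := by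
  rw [Set.image_image]
  simp only [aut_inv_apply_snd, Set.image_id']

theorem adj_map (π : G.aut) {a b : V} (h : G.simple.Adj a b) :
    G.simple.Adj (π.1.1 a) (π.1.1 b) := by
  obtain ⟨hne, k, rfl, rfl⟩ := h
  exact ⟨fun e => hne (π.1.1.injective e), π.1.2 k, aut_vert π k, by rw [aut_inv, aut_vert]⟩

theorem adj_map_iff (π : G.aut) {a b : V} :
    G.simple.Adj (π.1.1 a) (π.1.1 b) ↔ G.simple.Adj a b := by
  refine ⟨fun h => ?_, adj_map π⟩
  have := adj_map π⁻¹ h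
  rwa [aut_inv_apply_fst, aut_inv_apply_fst] at this

theorem Linked.map (π : G.aut) {S : Set V} {a b : V} (h : G.Linked S a b) :
    G.Linked (π.1.1 '' S) (π.1.1 a) (π.1.1 b) :=
  h.induct (P := fun b => G.Linked (π.1.1 '' S) (π.1.1 a) (π.1.1 b))
    (Linked.refl ⟨a, h.1, rfl⟩) fun _ y _ ih hxy hy => ih.tail (adj_map π hxy) ⟨y, hy, rfl⟩

theorem linked_map_iff (π : G.aut) {S : Set V} {a b : V} :
    G.Linked (π.1.1 '' S) (π.1.1 a) (π.1.1 b) ↔ G.Linked S a b := by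
  refine ⟨fun h => ?_, Linked.map π⟩
  have := h.map π⁻¹
  rwa [aut_inv_apply_fst, aut_inv_apply_fst, aut_inv_image_fst] at this

theorem preconnected_map_iff (π : G.aut) {S : Set V} :
    (G.simple.induce (π.1.1 '' S)).Preconnected ↔ (G.simple.induce S).Preconnected := by
  simp only [preconnected_induce_iff, Set.forall_mem_image, linked_map_iff]

theorem IsComponent.map (π : G.aut) {S K : Set V} (h : G.IsComponent S K) :
    G.IsComponent (π.1.1 '' S) (π.1.1 '' K) := by
  obtain ⟨h1, ⟨h2, h3⟩, h4⟩ := isComponent_iff.1 h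
  refine isComponent_iff.2 ⟨(Set.disjoint_image_iff π.1.1.injective).2 h1, ⟨h2.image _, ?_⟩, ?_⟩
  · rintro _ ⟨a, ha, rfl⟩ _ ⟨b, hb, rfl⟩
    exact (h3 a ha b hb).map π
  · rintro _ ⟨v, hv, rfl⟩ w hvw
    obtain ⟨w, rfl⟩ := π.1.1.surjective w
    exact (h4 v hv w ((adj_map_iff π).1 hvw)).imp (fun h => ⟨w, h, rfl⟩) fun h => ⟨w, h, rfl⟩

theorem isComponent_map_iff (π : G.aut) {S K : Set V} :
    G.IsComponent (π.1.1 '' S) (π.1.1 '' K) ↔ G.IsComponent S K := by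
  refine ⟨fun h => ?_, IsComponent.map π⟩
  have := h.map π⁻¹
  rwa [aut_inv_image_fst, aut_inv_image_fst] at this

theorem IsBlock.map (π : G.aut) {B : Set V} (h : G.IsBlock B) : G.IsBlock (π.1.1 '' B) := by
  have key : ∀ (π : G.aut) (B : Set V),
      ((B.Nonempty ∧ ∀ a ∈ B, ∀ b ∈ B, G.Linked B a b) ∧
        ∀ x ∈ B, ∀ a ∈ B \ {x}, ∀ b ∈ B \ {x}, G.Linked (B \ {x}) a b) →
      (((π.1.1 '' B).Nonempty ∧ ∀ a ∈ π.1.1 '' B, ∀ b ∈ π.1.1 '' B, G.Linked (π.1.1 '' B) a b) ∧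
        ∀ x ∈ π.1.1 '' B, ∀ a ∈ π.1.1 '' B \ {x}, ∀ b ∈ π.1.1 '' B \ {x},
          G.Linked (π.1.1 '' B \ {x}) a b) := by
    rintro π B ⟨⟨h1, h2⟩, h3⟩
    refine ⟨⟨h1.image _, ?_⟩, ?_⟩
    · rintro _ ⟨a, ha, rfl⟩ _ ⟨b, hb, rfl⟩
      exact (h2 a ha b hb).map π
    · rintro _ ⟨x, hx, rfl⟩
      rw [← Set.image_singleton, ← Set.image_sdiff π.1.1.injective]
      rintro _ ⟨a, ha, rfl⟩ _ ⟨b, hb, rfl⟩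
      exact (h3 x hx a ha b hb).map π
  rw [isBlock_iff] at h ⊢
  refine ⟨key π B h.1, fun T hT hBT => ?_⟩
  have := h.2 (key π⁻¹ T hT) (by
    have := Set.image_mono (f := (π⁻¹).1.1) hBT
    rwa [aut_inv_image_fst] at this)
  have := Set.image_mono (f := π.1.1) this
  have h2 := aut_inv_image_fst π⁻¹ T
  rw [_root_.inv_inv] at h2
  rwa [h2] at this

theorem IsArticulation.map (π : G.aut) {c : V} (h : G.IsArticulation c) :
    G.IsArticulation (π.1.1 c) := by
  rw [IsArticulation, ← preconnected_map_iff π, Set.image_compl_eq π.1.1.bijective,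
    Set.image_singleton] at h
  exact h

/-- The action of automorphisms on the nodes of the block tree. -/
def Node.map (π : G.aut) (S : G.Node) : G.Node :=
  ⟨π.1.1 '' S.1, S.2.imp (fun h => h.map π) fun ⟨c, hc, h⟩ =>
    ⟨π.1.1 c, hc.map π, by rw [h, Set.image_singleton]⟩⟩

theorem Node.map_inv_map (π : G.aut) (S : G.Node) : Node.map π⁻¹ (Node.map π S) = S :=
  Subtype.ext (aut_inv_image_fst π S.1)

theorem Node.map_surjective (π : G.aut) : Function.Surjective (Node.map π) := fun S =>
  ⟨Node.map π⁻¹ S, by simpa only [_root_.inv_inv] using Node.map_inv_map π⁻¹ S⟩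

/-- The action of automorphisms on the block tree. -/
def blockTreeHom (π : G.aut) : G.blockTree →g G.blockTree where
  toFun := Node.map π
  map_rel' {_ _} h := h.imp (fun h => π.1.1.injective.image_strictMono h)
    fun h => π.1.1.injective.image_strictMono h

theorem edist_map_le (π : G.aut) (S T : G.Node) :
    G.blockTree.edist (Node.map π S) (Node.map π T) ≤ G.blockTree.edist S T := by
  refine le_iInf fun w => ?_
  have := SimpleGraph.edist_le (w.map (blockTreeHom π))
  rwa [SimpleGraph.Walk.length_map] at this

theorem eccent_map (π : G.aut) (S : G.Node) :
    G.blockTree.eccent (Node.map π S) = G.blockTree.eccent S := by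
  have h : ∀ T, G.blockTree.edist (Node.map π S) (Node.map π T) = G.blockTree.edist S T := by
    refine fun T => le_antisymm (edist_map_le π S T) ?_
    have := edist_map_le π⁻¹ (Node.map π S) (Node.map π T)
    rwa [Node.map_inv_map, Node.map_inv_map] at this
  rw [SimpleGraph.eccent, SimpleGraph.eccent, ← (Node.map_surjective π).iSup_comp]
  simp only [h]

/-- Automorphisms act on the block tree preserving eccentricities, so they fix its centre when this
is a single node. -/
theorem IsRoot.image_eq (hR : G.IsRoot R) (π : G.aut) : π.1.1 '' R = R := by
  obtain ⟨r, rfl, h | h⟩ := hR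
  · have hr : r ∈ G.blockTree.center := by rw [h]; rfl
    have : Node.map π r ∈ G.blockTree.center := by
      rw [SimpleGraph.mem_center_iff, eccent_map]
      exact hr
    rw [h] at this
    exact congrArg Subtype.val (Set.mem_singleton_iff.1 this)
  · exact h π.1 π.2

theorem IsRoot.nonempty (hR : G.IsRoot R) : R.Nonempty := by
  obtain ⟨⟨_, h | ⟨c, -, rfl⟩⟩, rfl, -⟩ := hR
  · exact h.nonempty
  · exact Set.singleton_nonempty c

theorem image_touching (π : G.aut) (W : Set V) :
    π.1.2 '' G.touching W = G.touching (π.1.1 '' W) := by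
  ext h
  obtain ⟨h, rfl⟩ := π.1.2.surjective h
  simp only [touching, Set.mem_ofPred_eq, aut_vert, aut_inv,
    π.1.1.injective.mem_set_image, π.1.2.injective.mem_set_image]

theorem ncard_eq_of_map (π : G.aut) {P Q : D → Prop} (h : ∀ k, Q (π.1.2 k) ↔ P k) :
    {k | Q k}.ncard = {k | P k}.ncard := by
  rw [← Set.ncard_image_of_injective {k | P k} π.1.2.injective]
  congr 1
  ext k
  obtain ⟨k, rfl⟩ := π.1.2.surjective k
  simp only [π.1.2.injective.mem_set_image, Set.mem_ofPred_eq, h]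

/-- The image of a piece under an automorphism. -/
def Piece.map (π : G.aut) (A : G.Piece) : G.Piece where
  bdry := π.1.1 '' A.bdry
  inn := π.1.1 '' A.inn
  darts := π.1.2 '' A.darts
  disj := (Set.disjoint_image_iff π.1.1.injective).2 A.disj
  inv_mem := by
    rintro _ ⟨h, hh, rfl⟩
    exact ⟨G.inv h, A.inv_mem h hh, (aut_inv π h).symm⟩
  vert_mem := by
    rintro _ ⟨h, hh, rfl⟩
    rw [← Set.image_union]
    exact ⟨G.vert h, A.vert_mem h hh, (aut_vert π h).symm⟩
  mem_of_inn h hh := by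
    obtain ⟨h, rfl⟩ := π.1.2.surjective h
    rw [aut_vert, π.1.1.injective.mem_set_image] at hh
    exact ⟨h, A.mem_of_inn h hh, rfl⟩

theorem Piece.map_inv_map (π : G.aut) (A : G.Piece) : (A.map π).map π⁻¹ = A :=
  Piece.ext (aut_inv_image_fst π _) (aut_inv_image_fst π _) (aut_inv_image_snd π _)

theorem Piece.map_map_inv (π : G.aut) (A : G.Piece) : (A.map π⁻¹).map π = A := by
  simpa only [_root_.inv_inv] using Piece.map_inv_map π⁻¹ A

theorem Piece.map_mul (π δ : G.aut) (A : G.Piece) : A.map (π * δ) = (A.map δ).map π :=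
  Piece.ext (Set.image_comp π.1.1 δ.1.1 _) (Set.image_comp π.1.1 δ.1.1 _)
    (Set.image_comp π.1.2 δ.1.2 _)

theorem Piece.map_one (A : G.Piece) : A.map 1 = A :=
  Piece.ext (Set.image_id _) (Set.image_id _) (Set.image_id _)

theorem disjoint_root_map_iff (hR : G.IsRoot R) (π : G.aut) {K : Set V} :
    Disjoint (π.1.1 '' K) R ↔ Disjoint K R := by
  conv_lhs => rw [← hR.image_eq π]
  exact Set.disjoint_image_iff π.1.1.injective

theorem IsBlockPart.map (hR : G.IsRoot R) (π : G.aut) {A : G.Piece} (hA : G.IsBlockPart R A) :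
    G.IsBlockPart R (A.map π) := by
  obtain ⟨u, hb, hd, hp, h⟩ := hA
  refine ⟨π.1.1 u, ?_, ?_, ?_, h.imp ?_ ?_⟩
  · change π.1.1 '' A.bdry = _
    rw [hb, Set.image_singleton]
  · simp only [Piece.map]
    rw [hd, image_touching]
  · rintro ⟨k, hk⟩
    obtain ⟨k, rfl⟩ := π.1.2.surjective k
    refine hp ⟨k, ?_⟩
    rw [aut_inv, ← Set.image_pair] at hk
    exact π.1.2.injective.image_injective hk
  · rintro ⟨h1, h2⟩
    rw [← Set.image_singleton]
    exact ⟨h1.map π, (disjoint_root_map_iff hR π).2 h2⟩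
  · rintro ⟨h1, h2, h3⟩
    refine ⟨fun e => h1 ?_, h2.image _, ?_⟩
    · rw [← hR.image_eq π, ← Set.image_singleton] at e
      exact π.1.1.injective.image_injective e
    · ext x
      obtain ⟨x, rfl⟩ := π.1.1.surjective x
      simp only [Piece.map, π.1.1.injective.mem_set_image]
      rw [h3]
      constructor
      · rintro ⟨K, ⟨hK, hKR⟩, hx⟩
        refine ⟨π.1.1 '' K, ⟨?_, (disjoint_root_map_iff hR π).2 hKR⟩, ⟨x, hx, rfl⟩⟩
        rw [← Set.image_singleton]
        exact hK.map π
      · rintro ⟨K, ⟨hK, hKR⟩, hx⟩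
        obtain ⟨K, rfl⟩ := π.1.1.surjective.image_surjective K
        rw [← Set.image_singleton, isComponent_map_iff] at hK
        exact ⟨K, ⟨hK, (disjoint_root_map_iff hR π).1 hKR⟩, (π.1.1.injective.mem_set_image).1 hx⟩

theorem IsProperPart.map (hR : G.IsRoot R) (π : G.aut) {A : G.Piece} (hA : G.IsProperPart R A) :
    G.IsProperPart R (A.map π) := by
  obtain ⟨B, u, v, hB, hu, hv, huv, hc, hdu, hdv, hb, hd, hK, hKB, hRA⟩ := hA
  refine ⟨π.1.1 '' B, π.1.1 u, π.1.1 v, hB.map π, ⟨u, hu, rfl⟩, ⟨v, hv, rfl⟩,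
    fun e => huv (π.1.1.injective e), ?_, ?_, ?_, ?_, ?_, ?_, ?_, ?_⟩
  · rwa [← Set.image_pair, ← Set.image_sdiff π.1.1.injective, preconnected_map_iff]
  · rwa [ncard_eq_of_map π (P := fun h => G.vert h = u ∧ G.vert (G.inv h) ∈ B) fun k => by
      simp only [aut_vert, aut_inv, π.1.1.injective.mem_set_image, π.1.1.injective.eq_iff]]
  · rwa [ncard_eq_of_map π (P := fun h => G.vert h = v ∧ G.vert (G.inv h) ∈ B) fun k => by
      simp only [aut_vert, aut_inv, π.1.1.injective.mem_set_image, π.1.1.injective.eq_iff]]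
  · change π.1.1 '' A.bdry = _
    rw [hb, Set.image_pair]
  · simp only [Piece.map]
    rw [hd, image_touching]
  · rw [← Set.image_pair]
    exact hK.map π
  · simp only [Piece.map]
    rw [← Set.image_inter π.1.1.injective]
    exact hKB.image _
  · simp only [Piece.map]
    rw [← Set.image_union, ← hR.image_eq π, Set.image_subset_image_iff π.1.1.injective]
    exact hRA

theorem IsDipole.map (π : G.aut) {A : G.Piece} (hA : G.IsDipole A) : G.IsDipole (A.map π) := by
  obtain ⟨u, v, huv, hdu, hdv, h2, hb, hi, hd⟩ := hA
  refine ⟨π.1.1 u, π.1.1 v, fun e => huv (π.1.1.injective e), ?_, ?_, ?_, ?_, ?_, ?_⟩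
  · rwa [ncard_eq_of_map π (P := fun h => G.vert h = u) fun k => by
      simp only [aut_vert, π.1.1.injective.eq_iff]]
  · rwa [ncard_eq_of_map π (P := fun h => G.vert h = v) fun k => by
      simp only [aut_vert, π.1.1.injective.eq_iff]]
  · rwa [ncard_eq_of_map π (P := fun h => G.vert h = u ∧ G.vert (G.inv h) = v) fun k => by
      simp only [aut_vert, aut_inv, π.1.1.injective.eq_iff]]
  · change π.1.1 '' A.bdry = _
    rw [hb, Set.image_pair]
  · change π.1.1 '' A.inn = _
    rw [hi, Set.image_empty]
  · ext k
    obtain ⟨k, rfl⟩ := π.1.2.surjective k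
    simp only [Piece.map, π.1.2.injective.mem_set_image]
    rw [hd]
    simp only [Set.mem_ofPred_eq, aut_vert, aut_inv, π.1.1.injective.eq_iff]

theorem IsPart.map (hR : G.IsRoot R) (π : G.aut) {A : G.Piece} (hA : G.IsPart R A) :
    G.IsPart R (A.map π) :=
  hA.imp (fun h => h.map hR π) fun h => h.imp (fun h => h.map hR π) fun h => h.map π

theorem IsAtom.map (hR : G.IsRoot R) (π : G.aut) {A : G.Piece} (hA : G.IsAtom R A) :
    G.IsAtom R (A.map π) := by
  refine ⟨hA.1.map hR π, fun B hB hi hd => ?_⟩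
  have := hA.2 (B.map π⁻¹) (hB.map hR π⁻¹) (by
    have := Set.image_mono (f := (π⁻¹).1.1) hi
    rwa [Piece.map, aut_inv_image_fst] at this) (by
    have := Set.image_mono (f := (π⁻¹).1.2) hd
    rwa [Piece.map, aut_inv_image_snd] at this)
  rw [← this, Piece.map_map_inv]

/-- The action of automorphisms on atoms. -/
def Atom.map (hR : G.IsRoot R) (π : G.aut) (A : G.Atom R) : G.Atom R := ⟨A.1.map π, A.2.map hR π⟩

theorem Atom.isBlockPart_map_iff (hR : G.IsRoot R) (π : G.aut) (A : G.Atom R) :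
    G.IsBlockPart R (A.map hR π).1 ↔ G.IsBlockPart R A.1 := by
  refine ⟨fun h => ?_, fun h => h.map hR π⟩
  have := h.map hR π⁻¹
  rwa [Atom.map, Piece.map_inv_map] at this

end ColGraph

namespace ColGraph

variable {V D C : Type*} {G : ColGraph V D C} {R : Set V}

/-! ### Isomorphisms of pieces as maps of the ambient graph -/

/-- The vertices of a piece. -/
def Piece.verts (A : G.Piece) : Set V := A.bdry ∪ A.inn

/-- The restrictions of `f` and `d` form an isomorphism of `A` onto `B` respecting the boundary. -/
structure Transport (A B : G.Piece) (f : V → V) (d : D → D) : Prop where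
  bijOn_bdry : Set.BijOn f A.bdry B.bdry
  bijOn_inn : Set.BijOn f A.inn B.inn
  bijOn_darts : Set.BijOn d A.darts B.darts
  vert : ∀ h ∈ A.darts, G.vert (d h) = f (G.vert h)
  inv : ∀ h ∈ A.darts, G.inv (d h) = d (G.inv h)
  color : ∀ h ∈ A.darts, G.color (d h) = G.color h
  kind : ∀ h ∈ A.darts, G.kind (d h) = G.kind h

namespace Transport

variable {A B E : G.Piece} {f g : V → V} {d k : D → D}

theorem refl (A : G.Piece) : Transport A A id id :=
  ⟨Set.bijOn_id _, Set.bijOn_id _, Set.bijOn_id _, fun _ _ => rfl, fun _ _ => rfl, fun _ _ => rfl,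
    fun _ _ => rfl⟩

theorem trans (h : Transport A B f d) (h' : Transport B E g k) :
    Transport A E (g ∘ f) (k ∘ d) where
  bijOn_bdry := h'.bijOn_bdry.comp h.bijOn_bdry
  bijOn_inn := h'.bijOn_inn.comp h.bijOn_inn
  bijOn_darts := h'.bijOn_darts.comp h.bijOn_darts
  vert x hx := by simp only [Function.comp, h'.vert _ (h.bijOn_darts.mapsTo hx), h.vert x hx]
  inv x hx := by simp only [Function.comp, h'.inv _ (h.bijOn_darts.mapsTo hx), h.inv x hx]
  color x hx := by simp only [Function.comp, h'.color _ (h.bijOn_darts.mapsTo hx), h.color x hx]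
  kind x hx := by simp only [Function.comp, h'.kind _ (h.bijOn_darts.mapsTo hx), h.kind x hx]

theorem bijOn_verts (h : Transport A B f d) : Set.BijOn f A.verts B.verts := by
  refine h.bijOn_bdry.union h.bijOn_inn ?_
  rintro x (hx | hx) y (hy | hy) hxy
  · exact h.bijOn_bdry.injOn hx hy hxy
  · exact (Set.disjoint_left.1 B.disj (h.bijOn_bdry.mapsTo hx)
      (hxy ▸ h.bijOn_inn.mapsTo hy)).elim
  · exact (Set.disjoint_left.1 B.disj (h.bijOn_bdry.mapsTo hy)
      (hxy ▸ h.bijOn_inn.mapsTo hx)).elim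
  · exact h.bijOn_inn.injOn hx hy hxy

theorem mem_bdry_iff (h : Transport A B f d) {x : V} (hx : x ∈ A.verts) :
    f x ∈ B.bdry ↔ x ∈ A.bdry := by
  refine ⟨fun hf => hx.resolve_right fun hi => ?_, fun hx => h.bijOn_bdry.mapsTo hx⟩
  exact Set.disjoint_left.1 B.disj hf (h.bijOn_inn.mapsTo hi)

/-- The isomorphism obtained by restriction. -/
noncomputable def toIso (h : Transport A B f d) : Iso A.graph B.graph where
  onV := h.bijOn_verts.equiv f
  onD := h.bijOn_darts.equiv d
  vert_map x := Subtype.ext (h.vert x.1 x.2)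
  inv_map x := Subtype.ext (h.inv x.1 x.2)
  color_map x := h.color x.1 x.2
  kind_map x := h.kind x.1 x.2

theorem respectsBdry_toIso (h : Transport A B f d) : Piece.RespectsBdry h.toIso :=
  fun x => h.mem_bdry_iff x.2

theorem isoRel (h : Transport A B f d) : A.IsoRel B := ⟨h.toIso, h.respectsBdry_toIso⟩

/-- Every isomorphism of pieces is obtained by restriction. -/
theorem exists_of_iso (σ : Iso A.graph B.graph) (hσ : Piece.RespectsBdry σ) :
    ∃ f d, Transport A B f d ∧ (∀ x, f x.1 = (σ.onV x).1) ∧ ∀ h, d h.1 = (σ.onD h).1 := by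
  classical
  let f : V → V := fun x => if h : x ∈ A.bdry ∪ A.inn then (σ.onV ⟨x, h⟩).1 else x
  let d : D → D := fun x => if h : x ∈ A.darts then (σ.onD ⟨x, h⟩).1 else x
  have hf : ∀ x (hx : x ∈ A.bdry ∪ A.inn), f x = (σ.onV ⟨x, hx⟩).1 := fun x hx => dif_pos hx
  have hd : ∀ x (hx : x ∈ A.darts), d x = (σ.onD ⟨x, hx⟩).1 := fun x hx => dif_pos hx
  have hσ' : ∀ x, (σ.onV x).1 ∈ B.inn ↔ x.1 ∈ A.inn := by
    intro x
    have h1 : (σ.onV x).1 ∈ B.inn ↔ (σ.onV x).1 ∉ B.bdry :=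
      ⟨fun h h' => Set.disjoint_left.1 B.disj h' h, (σ.onV x).2.resolve_left⟩
    have h2 : x.1 ∈ A.inn ↔ x.1 ∉ A.bdry :=
      ⟨fun h h' => Set.disjoint_left.1 A.disj h' h, x.2.resolve_left⟩
    rw [h1, h2, hσ]
  refine ⟨f, d, ⟨⟨?_, ?_, ?_⟩, ⟨?_, ?_, ?_⟩, ⟨?_, ?_, ?_⟩, ?_, ?_, ?_, ?_⟩, fun x => hf x.1 x.2,
    fun x => hd x.1 x.2⟩
  · intro x hx
    rw [hf x (Or.inl hx)]
    exact (hσ ⟨x, Or.inl hx⟩).2 hx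
  · intro x hx y hy hxy
    rw [hf x (Or.inl hx), hf y (Or.inl hy)] at hxy
    exact congrArg Subtype.val (σ.onV.injective (Subtype.ext hxy))
  · intro y hy
    obtain ⟨x, hx⟩ := σ.onV.surjective ⟨y, Or.inl hy⟩
    refine ⟨x.1, (hσ x).1 (by rw [hx]; exact hy), ?_⟩
    rw [hf x.1 x.2, Subtype.coe_eta, hx]
  · intro x hx
    rw [hf x (Or.inr hx)]
    exact (hσ' ⟨x, Or.inr hx⟩).2 hx
  · intro x hx y hy hxy
    rw [hf x (Or.inr hx), hf y (Or.inr hy)] at hxy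
    exact congrArg Subtype.val (σ.onV.injective (Subtype.ext hxy))
  · intro y hy
    obtain ⟨x, hx⟩ := σ.onV.surjective ⟨y, Or.inr hy⟩
    refine ⟨x.1, (hσ' x).1 (by rw [hx]; exact hy), ?_⟩
    rw [hf x.1 x.2, Subtype.coe_eta, hx]
  · intro x hx
    rw [hd x hx]
    exact (σ.onD ⟨x, hx⟩).2
  · intro x hx y hy hxy
    rw [hd x hx, hd y hy] at hxy
    exact congrArg Subtype.val (σ.onD.injective (Subtype.ext hxy))
  · intro y hy
    obtain ⟨x, hx⟩ := σ.onD.surjective ⟨y, hy⟩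
    refine ⟨x.1, x.2, ?_⟩
    rw [hd x.1 x.2, Subtype.coe_eta, hx]
  · intro x hx
    rw [hd x hx, hf _ (A.vert_mem x hx)]
    exact congrArg Subtype.val (σ.vert_map ⟨x, hx⟩)
  · intro x hx
    rw [hd x hx, hd _ (A.inv_mem x hx)]
    exact congrArg Subtype.val (σ.inv_map ⟨x, hx⟩)
  · intro x hx
    rw [hd x hx]
    exact σ.color_map ⟨x, hx⟩
  · intro x hx
    rw [hd x hx]
    exact σ.kind_map ⟨x, hx⟩

theorem exists_of_isoRel (h : A.IsoRel B) : ∃ f d, Transport A B f d := by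
  obtain ⟨σ, hσ⟩ := h
  obtain ⟨f, d, h, -⟩ := exists_of_iso σ hσ
  exact ⟨f, d, h⟩

/-- The ambient maps are arbitrary outside the pieces, so they are mutually inverse only on the
pieces. -/
theorem exists_inverse (h : Transport A B f d) : ∃ g k, Transport B A g k ∧
    (∀ x ∈ A.verts, g (f x) = x) ∧ ∀ x ∈ A.darts, k (d x) = x := by
  let σ : Iso B.graph A.graph :=
    { onV := h.toIso.onV.symm
      onD := h.toIso.onD.symm
      vert_map := fun x => by
        rw [Equiv.eq_symm_apply, ← h.toIso.vert_map, Equiv.apply_symm_apply]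
      inv_map := fun x => by
        rw [Equiv.eq_symm_apply, ← h.toIso.inv_map, Equiv.apply_symm_apply]
      color_map := fun x => by
        rw [← h.toIso.color_map, Equiv.apply_symm_apply]
      kind_map := fun x => by
        rw [← h.toIso.kind_map, Equiv.apply_symm_apply] }
  have hσ : Piece.RespectsBdry σ := fun x => by
    rw [← h.respectsBdry_toIso]
    simp only [σ, Equiv.apply_symm_apply]
  obtain ⟨g, k, hgk, hg, hk⟩ := exists_of_iso σ hσ
  refine ⟨g, k, hgk, fun x hx => ?_, fun x hx => ?_⟩
  · have h1 := hg (h.toIso.onV ⟨x, hx⟩)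
    simp only [σ, Equiv.symm_apply_apply] at h1
    exact h1
  · have h1 := hk (h.toIso.onD ⟨x, hx⟩)
    simp only [σ, Equiv.symm_apply_apply] at h1
    exact h1

theorem of_aut (π : G.aut) (A : G.Piece) : Transport A (A.map π) π.1.1 π.1.2 :=
  ⟨π.1.1.injective.injOn.bijOn_image, π.1.1.injective.injOn.bijOn_image,
    π.1.2.injective.injOn.bijOn_image, fun h _ => aut_vert π h, fun h _ => aut_inv π h,
    fun h _ => aut_color π h, fun h _ => aut_kind π h⟩

end Transport

/-! ### Halvings and exchanges of the boundary -/

/-- `f` and `d` restrict to a semiregular involution of `A` exchanging the boundary vertices. -/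
structure Halving (A : G.Piece) (f : V → V) (d : D → D) : Prop where
  transport : Transport A A f d
  invol_vert : ∀ x ∈ A.verts, f (f x) = x
  invol_dart : ∀ h ∈ A.darts, d (d h) = h
  vert_free : ∀ x ∈ A.verts, f x ≠ x
  dart_free : ∀ h ∈ A.darts, d h ≠ h
  halvable : ∀ h ∈ A.darts, d h = G.inv h → G.kind h = .halvable

theorem mem_zpowers_of_mul_self {M : Type*} [Group M] {t s : M} (ht : t * t = 1)
    (hs : s ∈ Subgroup.zpowers t) : s = 1 ∨ s = t := by
  obtain ⟨n, rfl⟩ := Subgroup.mem_zpowers_iff.1 hs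
  rcases Int.even_or_odd' n with ⟨m, rfl | rfl⟩
  · left
    rw [zpow_mul, zpow_two, ht, one_zpow]
  · right
    rw [zpow_add, zpow_mul, zpow_two, ht, one_zpow, one_mul, zpow_one]

theorem Halving.exists_isHalving {A : G.Piece} {f : V → V} {d : D → D} (h : Halving A f d) :
    ∃ τ, A.IsHalving τ ∧ (∀ x, (τ.1 x).1 = f x.1) ∧ ∀ k, (τ.2 k).1 = d k.1 := by
  let τ : Equiv.Perm {v // v ∈ A.bdry ∪ A.inn} × Equiv.Perm {h // h ∈ A.darts} :=
    (h.transport.toIso.onV, h.transport.toIso.onD)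
  have hτ : τ * τ = 1 := Prod.ext (Equiv.ext fun x => Subtype.ext (h.invol_vert x.1 x.2))
    (Equiv.ext fun x => Subtype.ext (h.invol_dart x.1 x.2))
  refine ⟨τ, ⟨hτ, ⟨?_, ?_, ?_, ?_⟩, fun x hx => ⟨h.transport.bijOn_bdry.mapsTo hx, fun e =>
    h.vert_free x.1 x.2 (congrArg Subtype.val e)⟩⟩, fun _ => rfl, fun _ => rfl⟩
  · rw [Subgroup.zpowers_le]
    exact fun k => ⟨Subtype.ext (h.transport.vert k.1 k.2), Subtype.ext (h.transport.inv k.1 k.2),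
      h.transport.color k.1 k.2, h.transport.kind k.1 k.2⟩
  · rintro γ hγ hne x e
    obtain rfl := (mem_zpowers_of_mul_self hτ hγ).resolve_left hne
    exact h.vert_free x.1 x.2 (congrArg Subtype.val e)
  · rintro γ hγ hne x e
    obtain rfl := (mem_zpowers_of_mul_self hτ hγ).resolve_left hne
    exact h.dart_free x.1 x.2 (congrArg Subtype.val e)
  · rintro γ hγ hne x e
    obtain rfl := (mem_zpowers_of_mul_self hτ hγ).resolve_left hne
    exact h.halvable x.1 x.2 (congrArg Subtype.val e)

/-- An exchange of the boundary vertices respects the boundary. -/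
theorem Piece.Exchanges.exists_transport {A : G.Piece} {u v : V} (hb : A.bdry = {u, v})
    {τ : Equiv.Perm {v // v ∈ A.bdry ∪ A.inn} × Equiv.Perm {h // h ∈ A.darts}}
    (hτ : τ ∈ A.graph.aut) (hex : A.Exchanges τ) :
    ∃ f d, Transport A A f d ∧ (∀ x, f x.1 = (τ.1 x).1) ∧ ∀ h, d h.1 = (τ.2 h).1 := by
  let σ : Iso A.graph A.graph := ⟨τ.1, τ.2, fun h => (hτ h).1, fun h => (hτ h).2.1,
    fun h => (hτ h).2.2.1, fun h => (hτ h).2.2.2⟩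
  refine Transport.exists_of_iso σ fun x => ⟨fun h => ?_, fun h => (hex x h).1⟩
  have hu : u ∈ A.bdry := by rw [hb]; exact Or.inl rfl
  have hv : v ∈ A.bdry := by rw [hb]; exact Or.inr rfl
  have aux : ∀ y, y.1 ∈ A.bdry → ∀ z, z.1 ∈ A.bdry → y ≠ z → τ.1 y = z := by
    intro y hy z hz hyz
    obtain ⟨h1, h2⟩ := hex y hy
    have h2 : (τ.1 y).1 ≠ y.1 := fun e => h2 (Subtype.ext e)
    have hyz : y.1 ≠ z.1 := fun e => hyz (Subtype.ext e)
    refine Subtype.ext ?_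
    have hb' : ∀ w ∈ A.bdry, w = u ∨ w = v := fun w hw => by rwa [hb] at hw
    rcases hb' _ hy with hy | hy <;> rcases hb' _ hz with hz | hz <;> rcases hb' _ h1 with h1 | h1 <;>
      first
      | exact h1.trans hz.symm
      | exact (h2 (h1.trans hy.symm)).elim
      | exact (hyz (hy.trans hz.symm)).elim
  -- If `τ x` is on the boundary, so is `τ (τ x)`, and it is the other boundary vertex. A further
  -- application of `τ` returns to `τ x`; by injectivity `x = τ (τ x)`.
  obtain ⟨h1, h2⟩ := hex (τ.1 x) h
  have h3 := aux (τ.1 (τ.1 x)) h1 (τ.1 x) h h2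
  rw [← τ.1.injective h3]
  exact h1

theorem Piece.IsHalving.exists_halving {A : G.Piece} {u v : V} (hb : A.bdry = {u, v})
    {τ : Equiv.Perm {v // v ∈ A.bdry ∪ A.inn} × Equiv.Perm {h // h ∈ A.darts}}
    (hτ : A.IsHalving τ) :
    ∃ f d, Halving A f d ∧ (∀ x, f x.1 = (τ.1 x).1) ∧ ∀ h, d h.1 = (τ.2 h).1 := by
  obtain ⟨h1, h2, h3⟩ := hτ
  have hmem := Subgroup.mem_zpowers τ
  obtain ⟨f, d, h, hf, hd⟩ := h3.exists_transport hb (h2.le_aut hmem)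
  have hne : τ ≠ 1 := by
    rintro rfl
    have hu : u ∈ A.bdry := by rw [hb]; exact Or.inl rfl
    exact (h3 ⟨u, Or.inl hu⟩ hu).2 rfl
  refine ⟨f, d, ⟨h, fun x hx => ?_, fun x hx => ?_, fun x hx e => ?_, fun x hx e => ?_,
    fun x hx e => ?_⟩, hf, hd⟩
  · rw [hf ⟨x, hx⟩, hf]
    exact congrArg (fun t => (t.1 ⟨x, hx⟩).1) h1
  · rw [hd ⟨x, hx⟩, hd]
    exact congrArg (fun t => (t.2 ⟨x, hx⟩).1) h1
  · rw [hf ⟨x, hx⟩] at e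
    exact h2.vert_free τ hmem hne ⟨x, hx⟩ (Subtype.ext e)
  · rw [hd ⟨x, hx⟩] at e
    exact h2.dart_free τ hmem hne ⟨x, hx⟩ (Subtype.ext e)
  · rw [hd ⟨x, hx⟩] at e
    exact h2.halvable_of_reversed τ hmem hne ⟨x, hx⟩ (Subtype.ext e)

/-- Transport of halvings. -/
theorem Transport.halvable {A B : G.Piece} {u v : V} (hb : A.bdry = {u, v}) {f : V → V} {d : D → D}
    (h : Transport A B f d) (hA : A.Halvable) : B.Halvable := by
  obtain ⟨τ, hτ⟩ := hA
  obtain ⟨t, s, hts, -⟩ := hτ.exists_halving hb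
  obtain ⟨g, k, hgk, hg, hk⟩ := h.exists_inverse
  have hg' : ∀ x ∈ B.verts, f (g x) = x := fun x hx => by
    obtain ⟨y, hy, rfl⟩ := h.bijOn_verts.surjOn hx
    rw [hg y hy]
  have hk' : ∀ x ∈ B.darts, d (k x) = x := fun x hx => by
    obtain ⟨y, hy, rfl⟩ := h.bijOn_darts.surjOn hx
    rw [hk y hy]
  have hgm := hgk.bijOn_verts.mapsTo
  have hkm := hgk.bijOn_darts.mapsTo
  have htm := hts.transport.bijOn_verts.mapsTo
  have hsm := hts.transport.bijOn_darts.mapsTo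
  have H : Halving B (f ∘ t ∘ g) (d ∘ s ∘ k) := by
    refine ⟨(hgk.trans hts.transport).trans h, fun x hx => ?_, fun x hx => ?_, fun x hx e => ?_,
      fun x hx e => ?_, fun x hx e => ?_⟩
    · simp only [Function.comp]
      rw [hg _ (htm (hgm hx)), hts.invol_vert _ (hgm hx), hg' x hx]
    · simp only [Function.comp]
      rw [hk _ (hsm (hkm hx)), hts.invol_dart _ (hkm hx), hk' x hx]
    · have := congrArg g e
      simp only [Function.comp] at this
      rw [hg _ (htm (hgm hx))] at this
      exact hts.vert_free _ (hgm hx) this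
    · have := congrArg k e
      simp only [Function.comp] at this
      rw [hk _ (hsm (hkm hx))] at this
      exact hts.dart_free _ (hkm hx) this
    · have := congrArg k e
      simp only [Function.comp] at this
      rw [hk _ (hsm (hkm hx)), ← hgk.inv x hx] at this
      rw [← hgk.kind x hx]
      exact hts.halvable _ (hkm hx) this
  obtain ⟨τ, hτ, -⟩ := H.exists_isHalving
  exact ⟨τ, hτ⟩

theorem Transport.exchangeable_self {A : G.Piece} {f : V → V} {d : D → D} (h : Transport A A f d)
    (hf : ∀ x ∈ A.bdry, f x ≠ x) : A.Exchangeable :=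
  ⟨(h.toIso.onV, h.toIso.onD), fun k => ⟨h.toIso.vert_map k, h.toIso.inv_map k,
    h.toIso.color_map k, h.toIso.kind_map k⟩, fun x hx => ⟨h.bijOn_bdry.mapsTo hx, fun e =>
      hf x.1 hx (congrArg Subtype.val e)⟩⟩

theorem Piece.Exchangeable.exists_transport {A : G.Piece} {u v : V} (hb : A.bdry = {u, v})
    (hA : A.Exchangeable) : ∃ f d, Transport A A f d ∧ ∀ x ∈ A.bdry, f x ≠ x := by
  obtain ⟨τ, hτ, hex⟩ := hA
  obtain ⟨t, s, hts, ht, -⟩ := hex.exists_transport hb hτ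
  refine ⟨t, s, hts, fun x hx e => (hex ⟨x, Or.inl hx⟩ hx).2 (Subtype.ext ?_)⟩
  rw [← ht]
  exact e

theorem Piece.Halvable.exchangeable {A : G.Piece} (h : A.Halvable) : A.Exchangeable := by
  obtain ⟨τ, h1, h2, h3⟩ := h
  exact ⟨τ, h2.le_aut (Subgroup.mem_zpowers τ), h3⟩

theorem Transport.exchangeable {A B : G.Piece} {u v : V} (hb : A.bdry = {u, v}) {f : V → V}
    {d : D → D} (h : Transport A B f d) (hA : A.Exchangeable) : B.Exchangeable := by
  obtain ⟨t, s, hts, ht⟩ := hA.exists_transport hb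
  obtain ⟨g, k, hgk, hg, -⟩ := h.exists_inverse
  refine ((hgk.trans hts).trans h).exchangeable_self fun x hx e => ?_
  have := congrArg g e
  simp only [Function.comp] at this
  rw [hg _ (Or.inl (hts.bijOn_bdry.mapsTo (hgk.bijOn_bdry.mapsTo hx)))] at this
  exact ht _ (hgk.bijOn_bdry.mapsTo hx) this

end ColGraph

namespace ColGraph.Reduction

variable {V D C : Type*} {G : ColGraph V D C} {R : Set V} (ρ : G.Reduction R)

/-! ### Old vertices and half-edges -/

theorem e_mem (A : G.Atom R) (i : Bool) : ρ.e A i ∈ A.1.bdry := by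
  rw [ρ.bdry_eq A]
  cases i <;> simp

theorem exists_e {A : G.Atom R} {x : V} (hx : x ∈ A.1.bdry) : ∃ i, x = ρ.e A i := by
  rw [ρ.bdry_eq A] at hx
  rcases hx with rfl | rfl
  · exact ⟨false, rfl⟩
  · exact ⟨true, rfl⟩

theorem e_eq_of_isBlockPart {A : G.Atom R} (hA : G.IsBlockPart R A.1) (i j : Bool) :
    ρ.e A i = ρ.e A j := by
  obtain ⟨u, hb, -⟩ := hA
  have h : ∀ i, ρ.e A i = u := fun i => by simpa [hb] using ρ.e_mem A i
  rw [h, h]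

theorem e_ne_of_not_isBlockPart {A : G.Atom R} (hA : ¬ G.IsBlockPart R A.1) :
    ρ.e A false ≠ ρ.e A true := by
  intro h
  have key : ∀ u v, u ≠ v → A.1.bdry = {u, v} → False := by
    intro u v huv hb
    rw [ρ.bdry_eq A, h, Set.pair_eq_singleton] at hb
    have hu : u ∈ ({u, v} : Set V) := Or.inl rfl
    have hv : v ∈ ({u, v} : Set V) := Or.inr rfl
    rw [← hb] at hu hv
    exact huv (hu.trans hv.symm)
  rcases A.2.1 with h | ⟨-, u, v, -, -, -, huv, -, -, -, hb, -⟩ | ⟨u, v, huv, -, -, -, hb, -⟩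
  · exact hA h
  · exact key u v huv hb
  · exact key u v huv hb

theorem eq_of_e_eq {A : G.Atom R} (hA : ¬ G.IsBlockPart R A.1) {i j : Bool}
    (h : ρ.e A i = ρ.e A j) : i = j := by
  have := ρ.e_ne_of_not_isBlockPart hA
  cases i <;> cases j <;> simp_all

theorem notMem_inn [Finite V] [Finite D] (hG : G.IsConnectedLoopless) (hR : G.IsRoot R)
    (v : ρ.OldV) (A : G.Atom R) : v.1 ∉ A.1.inn := by
  rcases v.2 with ⟨B, hB⟩ | h
  · exact fun hA => A.2.notMem_bdry hG hR.nonempty B.2.1 hA hB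
  · exact h A

theorem _root_.ColGraph.Atom.eq_of_mem_inn [Finite V] [Finite D] (hG : G.IsConnectedLoopless)
    (hR : G.IsRoot R) {A B : G.Atom R} {v : V} (hA : v ∈ A.1.inn) (hB : v ∈ B.1.inn) : A = B :=
  Subtype.ext (A.2.eq_of_mem_inn hG hR.nonempty B.2 hA hB)

theorem _root_.ColGraph.Atom.eq_of_mem_darts [Finite V] [Finite D] (hG : G.IsConnectedLoopless)
    (hR : G.IsRoot R) {A B : G.Atom R} {h : D} (hA : h ∈ A.1.darts) (hB : h ∈ B.1.darts) : A = B :=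
  Subtype.ext (A.2.eq_of_mem_darts hG hR.nonempty B.2 hA hB)

theorem old_or_inn (v : V) : (∃ w : ρ.OldV, w.1 = v) ∨ ∃ A : G.Atom R, v ∈ A.1.inn := by
  by_cases h : ∃ A : G.Atom R, v ∈ A.1.inn
  · exact Or.inr h
  · exact Or.inl ⟨⟨v, Or.inr fun A hA => h ⟨A, hA⟩⟩, rfl⟩

theorem old_or_dart (h : D) : (∃ k : ρ.OldD, k.1 = h) ∨ ∃ A : G.Atom R, h ∈ A.1.darts := by
  by_cases hh : ∃ A : G.Atom R, h ∈ A.1.darts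
  · exact Or.inr hh
  · exact Or.inl ⟨⟨h, fun A hA => hh ⟨A, hA⟩⟩, rfl⟩

theorem graph_vert_inl (h : ρ.OldD) : ∃ v : ρ.OldV, v.1 = G.vert h.1 ∧
    ρ.graph.vert (.inl h) = .inl v := ⟨_, rfl, rfl⟩

theorem graph_vert_leaf {A : G.Atom R} (hA : G.IsBlockPart R A.1) :
    ρ.graph.vert (.inr (A, true)) = .inr ⟨A, hA⟩ := dif_pos hA

theorem graph_vert_inr {A : G.Atom R} (hA : ¬ G.IsBlockPart R A.1) (i : Bool) :
    ρ.graph.vert (.inr (A, i)) = .inl (ρ.endV A i) := by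
  cases i
  · rfl
  · exact dif_neg hA

/-- The type of the edge replacing an atom is determined by the isomorphism class of the atom. -/
theorem newKind_eq {A B : G.Atom R} (hAB : G.IsBlockPart R A.1 ↔ G.IsBlockPart R B.1) {f : V → V}
    {d : D → D} (h : Transport A.1 B.1 f d) {i j : Bool} (hij : f (ρ.e A i) = ρ.e B j) :
    ρ.newKind A i = ρ.newKind B j := by
  by_cases hA : G.IsBlockPart R A.1
  · rw [newKind, newKind, if_pos hA, if_pos (hAB.1 hA)]
  have hB := fun h => hA (hAB.2 h)
  obtain ⟨g, k, hgk, -⟩ := h.exists_inverse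
  have h1 : A.1.Halvable ↔ B.1.Halvable :=
    ⟨h.halvable (ρ.bdry_eq A), hgk.halvable (ρ.bdry_eq B)⟩
  have h2 : A.1.Exchangeable ↔ B.1.Exchangeable :=
    ⟨h.exchangeable (ρ.bdry_eq A), hgk.exchangeable (ρ.bdry_eq B)⟩
  rw [newKind, newKind, if_neg hA, if_neg hB, h1, h2]
  by_cases hex : B.1.Exchangeable
  · simp only [if_pos hex]
  -- For an asymmetric atom the type depends on the position; the consistency of orientations forces
  -- `i = j`.
  · have hf : f (ρ.e A false) = ρ.e B false :=
      ρ.consistent A B hA (fun h => hex (h2.1 h)) h.toIso h.respectsBdry_toIso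
        ⟨ρ.e A false, Or.inl (ρ.e_mem A false)⟩ rfl
    have : i = j := by
      by_cases hi : i = false
      · subst hi
        exact ρ.eq_of_e_eq hB (hf.symm.trans hij)
      · rw [Bool.not_eq_false] at hi
        subst hi
        cases j
        · exact (ρ.e_ne_of_not_isBlockPart hA (h.bijOn_bdry.injOn (ρ.e_mem _ _) (ρ.e_mem _ _)
            (hf.trans hij.symm))).elim
        · rfl
    rw [this]

/-! ### The reduction epimorphism -/

section

variable (hR : G.IsRoot R)

/-- The action of automorphisms on old vertices. -/
def mapOldV (π : G.aut) (v : ρ.OldV) : ρ.OldV := ⟨π.1.1 v.1, by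
  refine v.2.imp ?_ ?_
  · rintro ⟨A, hA⟩
    exact ⟨A.map hR π, ⟨v.1, hA, rfl⟩⟩
  · intro h A hA
    refine h (A.map hR π⁻¹) ⟨_, hA, ?_⟩
    exact aut_inv_apply_fst π v.1⟩

/-- The action of automorphisms on old half-edges. -/
def mapOldD (π : G.aut) (h : ρ.OldD) : ρ.OldD := ⟨π.1.2 h.1, fun A hA =>
  h.2 (A.map hR π⁻¹) ⟨_, hA, aut_inv_apply_snd π h.1⟩⟩

/-- Both positions of a block atom list the same vertex, so the position of the image is not
determined by the vertices; the leaf has to stay a leaf, whence `j = i`. -/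
theorem exists_end (π : G.aut) (A : G.Atom R) (i : Bool) :
    ∃ j, ρ.e (A.map hR π) j = π.1.1 (ρ.e A i) ∧ (G.IsBlockPart R A.1 → j = i) := by
  have hmem : π.1.1 (ρ.e A i) ∈ (A.map hR π).1.bdry := ⟨_, ρ.e_mem A i, rfl⟩
  obtain ⟨j, hj⟩ := ρ.exists_e hmem
  by_cases hA : G.IsBlockPart R A.1
  · refine ⟨i, ?_, fun _ => rfl⟩
    rw [hj]
    exact ρ.e_eq_of_isBlockPart (hA.map hR π) i j
  · exact ⟨j, hj.symm, fun h => (hA h).elim⟩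

/-- The action of automorphisms on the ends of the new edges. -/
noncomputable def mapEnd (π : G.aut) (A : G.Atom R) (i : Bool) : Bool :=
  (ρ.exists_end hR π A i).choose

theorem e_mapEnd (π : G.aut) (A : G.Atom R) (i : Bool) :
    ρ.e (A.map hR π) (ρ.mapEnd hR π A i) = π.1.1 (ρ.e A i) := (ρ.exists_end hR π A i).choose_spec.1

theorem mapEnd_of_isBlockPart (π : G.aut) {A : G.Atom R} (hA : G.IsBlockPart R A.1) (i : Bool) :
    ρ.mapEnd hR π A i = i := (ρ.exists_end hR π A i).choose_spec.2 hA

/-- Uniqueness of the position, from which the homomorphism laws for `permD` follow. -/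
theorem mapEnd_eq (π : G.aut) {A B : G.Atom R} {i j : Bool} (hB : B = A.map hR π)
    (h : ρ.e B j = π.1.1 (ρ.e A i)) (hb : G.IsBlockPart R A.1 → j = i) :
    ρ.mapEnd hR π A i = j := by
  subst hB
  by_cases hA : G.IsBlockPart R A.1
  · rw [ρ.mapEnd_of_isBlockPart hR π hA, hb hA]
  · refine ρ.eq_of_e_eq (fun h => hA ((A.isBlockPart_map_iff hR π).1 h)) ?_
    rw [ρ.e_mapEnd, h]

theorem mapEnd_not (π : G.aut) (A : G.Atom R) (i : Bool) :
    ρ.mapEnd hR π A (!i) = !(ρ.mapEnd hR π A i) := by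
  by_cases hA : G.IsBlockPart R A.1
  · rw [ρ.mapEnd_of_isBlockPart hR π hA, ρ.mapEnd_of_isBlockPart hR π hA]
  · have h1 : ρ.mapEnd hR π A (!i) ≠ ρ.mapEnd hR π A i := by
      intro e
      have h2 := ρ.e_mapEnd hR π A (!i)
      rw [e, ρ.e_mapEnd] at h2
      have := ρ.eq_of_e_eq hA (π.1.1.injective h2)
      simp at this
    cases h : ρ.mapEnd hR π A i <;> rw [h] at h1 <;> simpa using h1

theorem _root_.ColGraph.Atom.map_mul (hR : G.IsRoot R) (π δ : G.aut) (A : G.Atom R) :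
    A.map hR (π * δ) = (A.map hR δ).map hR π := Subtype.ext (Piece.map_mul π δ A.1)

theorem _root_.ColGraph.Atom.map_one (hR : G.IsRoot R) (A : G.Atom R) : A.map hR 1 = A :=
  Subtype.ext (Piece.map_one A.1)

/-- The action of the automorphism group on the vertices of the reduced graph. -/
def permV : G.aut →* Equiv.Perm ρ.NewV := MonoidHom.toHomPerm
  { toFun := fun π x => match x with
      | .inl v => .inl (ρ.mapOldV hR π v)
      | .inr A => .inr ⟨A.1.map hR π, A.2.map hR π⟩
    map_one' := by
      funext x
      rcases x with v | A
      · rfl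
      · exact congrArg Sum.inr (Subtype.ext (A.1.map_one hR))
    map_mul' := fun π δ => by
      funext x
      rcases x with v | A
      · rfl
      · exact congrArg Sum.inr (Subtype.ext (A.1.map_mul hR π δ)) }

/-- The action of the automorphism group on the half-edges of the reduced graph. -/
noncomputable def permD : G.aut →* Equiv.Perm ρ.NewD := MonoidHom.toHomPerm
  { toFun := fun π x => match x with
      | .inl h => .inl (ρ.mapOldD hR π h)
      | .inr (A, i) => .inr (A.map hR π, ρ.mapEnd hR π A i)
    map_one' := by
      funext x
      rcases x with v | ⟨A, i⟩
      · rfl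
      · exact congrArg Sum.inr (Prod.ext (A.map_one hR)
          (ρ.mapEnd_eq hR 1 (A.map_one hR).symm rfl fun _ => rfl))
    map_mul' := fun π δ => by
      funext x
      rcases x with v | ⟨A, i⟩
      · rfl
      · refine congrArg Sum.inr (Prod.ext (A.map_mul hR π δ)
          (ρ.mapEnd_eq hR (π * δ) (A.map_mul hR π δ).symm ?_ fun hA => ?_))
        · rw [ρ.e_mapEnd, ρ.e_mapEnd]
          rfl
        · rw [ρ.mapEnd_of_isBlockPart hR π (hA.map hR δ), ρ.mapEnd_of_isBlockPart hR δ hA] }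

/-- The reduction homomorphism. -/
noncomputable def reductionHom : G.aut →* Equiv.Perm ρ.NewV × Equiv.Perm ρ.NewD :=
  (ρ.permV hR).prod (ρ.permD hR)

theorem reductionHom_inl (π : G.aut) (v : ρ.OldV) :
    (ρ.reductionHom hR π).1 (.inl v) = .inl (ρ.mapOldV hR π v) := rfl

theorem reductionHom_leaf (π : G.aut) (A : {A : G.Atom R // G.IsBlockPart R A.1}) :
    (ρ.reductionHom hR π).1 (.inr A) = .inr ⟨A.1.map hR π, A.2.map hR π⟩ := rfl

theorem reductionHom_inl_dart (π : G.aut) (h : ρ.OldD) :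
    (ρ.reductionHom hR π).2 (.inl h) = .inl (ρ.mapOldD hR π h) := rfl

theorem reductionHom_inr_dart (π : G.aut) (A : G.Atom R) (i : Bool) :
    (ρ.reductionHom hR π).2 (.inr (A, i)) = .inr (A.map hR π, ρ.mapEnd hR π A i) := rfl

/-- For new edges, colours agree because `π` restricts to an isomorphism of atoms, and types agree
by `newKind_eq`. -/
theorem reductionHom_mem_aut (π : G.aut) : ρ.reductionHom hR π ∈ ρ.graph.aut := by
  rintro (h | ⟨A, i⟩)
  · rw [reductionHom_inl_dart]
    exact ⟨congrArg Sum.inl (Subtype.ext (aut_vert π h.1)),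
      congrArg Sum.inl (Subtype.ext (aut_inv π h.1)), congrArg Sum.inl (aut_color π h.1),
      aut_kind π h.1⟩
  · rw [reductionHom_inr_dart]
    have hi := A.isBlockPart_map_iff hR π
    refine ⟨?_, ?_, ?_, ?_⟩
    · by_cases hA : G.IsBlockPart R A.1
      · rw [ρ.mapEnd_of_isBlockPart hR π hA]
        cases i
        · refine congrArg Sum.inl (Subtype.ext ?_)
          have := ρ.e_mapEnd hR π A false
          rwa [ρ.mapEnd_of_isBlockPart hR π hA] at this
        · rw [ρ.graph_vert_leaf hA, ρ.graph_vert_leaf (hi.2 hA), reductionHom_leaf]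
      · rw [ρ.graph_vert_inr hA, ρ.graph_vert_inr (fun h => hA (hi.1 h))]
        exact congrArg Sum.inl (Subtype.ext (ρ.e_mapEnd hR π A i))
    · refine congrArg Sum.inr (Prod.ext rfl ?_)
      exact (ρ.mapEnd_not hR π A i).symm
    · exact congrArg Sum.inr (Quot.sound ((Transport.of_aut π A.1).exists_inverse.elim
        fun g h => h.elim fun k h => h.1.isoRel))
    · exact (ρ.newKind_eq hi.symm (Transport.of_aut π A.1) (ρ.e_mapEnd hR π A i).symm).symm

theorem induces_reductionHom (π : G.aut) : ρ.Induces π.1 (ρ.reductionHom hR π) :=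
  ⟨fun _ => ⟨_, rfl, rfl⟩, fun _ => ⟨_, rfl, rfl⟩, fun A => ⟨A.map hR π, rfl, rfl, rfl, fun i =>
    ⟨_, rfl, ρ.e_mapEnd hR π A i, ρ.mapEnd_of_isBlockPart hR π (i := i)⟩⟩⟩

end

/-! ### Semiregular groups and their images -/

/-- Freeness of the action, applied to `δ⁻¹ * γ`. -/
theorem _root_.ColGraph.Semiregular.eq_of_vert {Γ : Subgroup (Equiv.Perm V × Equiv.Perm D)}
    (hΓ : G.Semiregular Γ) {γ δ : Equiv.Perm V × Equiv.Perm D} (hγ : γ ∈ Γ) (hδ : δ ∈ Γ) {v : V}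
    (h : γ.1 v = δ.1 v) : γ = δ := by
  by_contra hne
  refine hΓ.vert_free (δ⁻¹ * γ) (Γ.mul_mem (Γ.inv_mem hδ) hγ)
    (fun e => hne (inv_mul_eq_one.1 e).symm) v ?_
  change δ.1⁻¹ (γ.1 v) = v
  rw [h]
  exact δ.1.symm_apply_apply v

theorem _root_.ColGraph.Semiregular.eq_of_dart {Γ : Subgroup (Equiv.Perm V × Equiv.Perm D)}
    (hΓ : G.Semiregular Γ) {γ δ : Equiv.Perm V × Equiv.Perm D} (hγ : γ ∈ Γ) (hδ : δ ∈ Γ) {v : D}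
    (h : γ.2 v = δ.2 v) : γ = δ := by
  by_contra hne
  refine hΓ.dart_free (δ⁻¹ * γ) (Γ.mul_mem (Γ.inv_mem hδ) hγ)
    (fun e => hne (inv_mul_eq_one.1 e).symm) v ?_
  change δ.2⁻¹ (γ.2 v) = v
  rw [h]
  exact δ.2.symm_apply_apply v

/-- An element of a semiregular group exchanging the boundary vertices of an atom halves it. -/
theorem halving_of_exchange {Γ : Subgroup (Equiv.Perm V × Equiv.Perm D)}
    (hΓ : G.Semiregular Γ) {A : G.Atom R} (hA : ¬ G.IsBlockPart R A.1)
    {γ : Equiv.Perm V × Equiv.Perm D} (hγ : γ ∈ Γ)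
    (hmap : A.1.map ⟨γ, hΓ.le_aut hγ⟩ = A.1) (hex : γ.1 (ρ.e A false) = ρ.e A true) :
    Halving A.1 γ.1 γ.2 := by
  have hne : γ ≠ 1 := by
    rintro rfl
    exact ρ.e_ne_of_not_isBlockPart hA hex
  have h := Transport.of_aut ⟨γ, hΓ.le_aut hγ⟩ A.1
  rw [hmap] at h
  have hex2 : γ.1 (ρ.e A true) = ρ.e A false := by
    obtain ⟨i, hi⟩ := ρ.exists_e (h.bijOn_bdry.mapsTo (ρ.e_mem A true))
    change γ.1 _ = _ at hi
    cases i
    · exact hi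
    · exact (hΓ.vert_free γ hγ hne _ hi).elim
  -- The square fixes a boundary vertex.
  have hsq : γ * γ = 1 := hΓ.eq_of_vert (Γ.mul_mem hγ hγ) Γ.one_mem (v := ρ.e A false) (by
    change γ.1 (γ.1 _) = _
    rw [hex, hex2]
    rfl)
  exact ⟨h, fun x _ => congrArg (fun t => t.1 x) hsq, fun x _ => congrArg (fun t => t.2 x) hsq,
    fun x _ => hΓ.vert_free γ hγ hne x, fun x _ => hΓ.dart_free γ hγ hne x,
    fun x _ => hΓ.halvable_of_reversed γ hγ hne x⟩

/-- Every semiregular group is an extension of a semiregular group. -/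
theorem exists_extends (hR : G.IsRoot R) {Γ : Subgroup (Equiv.Perm V × Equiv.Perm D)}
    (hΓ : G.Semiregular Γ) : ∃ Γ', ρ.graph.Semiregular Γ' ∧ ρ.Extends Γ Γ' := by
  refine ⟨(Γ.subgroupOf G.aut).map (ρ.reductionHom hR), ⟨?_, ?_, ?_, ?_⟩, ?_, ?_⟩
  · rintro _ ⟨π, -, rfl⟩
    exact ρ.reductionHom_mem_aut hR π
  · rintro _ ⟨π, hπ, rfl⟩ hne v hv
    have hπ1 : π.1 ≠ 1 := fun e => hne (by rw [show π = 1 from Subtype.ext e, map_one])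
    rcases v with v | A
    · rw [reductionHom_inl] at hv
      exact hΓ.vert_free π.1 hπ hπ1 v.1 (congrArg Subtype.val (Sum.inl_injective hv))
    · rw [reductionHom_leaf] at hv
      -- A fixed leaf means a preserved block atom, whose only boundary vertex is then fixed by `π`.
      have hA : A.1.map hR π = A.1 := congrArg Subtype.val (Sum.inr_injective hv)
      have h1 := ρ.e_mapEnd hR π A.1 false
      rw [ρ.mapEnd_of_isBlockPart hR π A.2, hA] at h1
      exact hΓ.vert_free π.1 hπ hπ1 _ h1.symm
  · rintro _ ⟨π, hπ, rfl⟩ hne h hh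
    have hπ1 : π.1 ≠ 1 := fun e => hne (by rw [show π = 1 from Subtype.ext e, map_one])
    rcases h with h | ⟨A, i⟩
    · rw [reductionHom_inl_dart] at hh
      exact hΓ.dart_free π.1 hπ hπ1 h.1 (congrArg Subtype.val (Sum.inl_injective hh))
    · rw [reductionHom_inr_dart] at hh
      have hA := Sum.inr_injective hh
      have h1 := ρ.e_mapEnd hR π A i
      rw [show A.map hR π = A from congrArg Prod.fst hA,
        show ρ.mapEnd hR π A i = i from congrArg Prod.snd hA] at h1
      exact hΓ.vert_free π.1 hπ hπ1 _ h1.symm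
  · rintro _ ⟨π, hπ, rfl⟩ hne h hh
    have hπ1 : π.1 ≠ 1 := fun e => hne (by rw [show π = 1 from Subtype.ext e, map_one])
    rcases h with h | ⟨A, i⟩
    · rw [reductionHom_inl_dart] at hh
      exact hΓ.halvable_of_reversed π.1 hπ hπ1 h.1 (congrArg Subtype.val (Sum.inl_injective hh))
    · rw [reductionHom_inr_dart] at hh
      have hA := Sum.inr_injective hh
      have hA1 : A.map hR π = A := congrArg Prod.fst hA
      have hA2 : ρ.mapEnd hR π A i = !i := congrArg Prod.snd hA
      -- Positions at block atoms are never swapped, so the reversed edge comes from an atom with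
      -- two boundary vertices, and `π` halves this atom.
      have hb : ¬ G.IsBlockPart R A.1 := fun hb => by
        rw [ρ.mapEnd_of_isBlockPart hR π hb] at hA2
        simp at hA2
      have hex : π.1.1 (ρ.e A false) = ρ.e A true := by
        have : ρ.mapEnd hR π A false = true := by
          cases i
          · exact hA2
          · have := ρ.mapEnd_not hR π A true
            rw [hA2] at this
            exact this
        rw [← ρ.e_mapEnd hR, hA1, this]
      obtain ⟨τ, hτ, -⟩ := (ρ.halving_of_exchange hΓ hb hπ (congrArg Subtype.val hA1)
        hex).exists_isHalving
      change ρ.newKind A i = _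
      rw [newKind, if_neg hb, if_pos ⟨τ, hτ⟩]
  · intro π hπ
    exact ⟨_, ⟨⟨π, hΓ.le_aut hπ⟩, hπ, rfl⟩, ρ.induces_reductionHom hR ⟨π, hΓ.le_aut hπ⟩⟩
  · rintro _ ⟨π, hπ, rfl⟩
    exact ⟨π.1, hπ, ρ.induces_reductionHom hR π⟩

end ColGraph.Reduction

namespace ColGraph

/-! ### Identifications in quotients of atoms -/

section

variable {V D C : Type*} {G : ColGraph V D C} {A : G.Piece} {q : AtomQuotient A}

theorem AtomQuotient.eq_or_of_sv {x y} (h : q.congr.sv x y) : x = y ∨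
    (q = .loop ∧ x.1 ∈ A.bdry ∧ y.1 ∈ A.bdry) ∨ ∃ τ hτ, q = .half τ hτ ∧ τ.1 x = y := by
  rcases q with _ | _ | ⟨τ, hτ⟩
  · exact Or.inl h
  · exact h.imp_right fun h => Or.inl ⟨rfl, h⟩
  · obtain ⟨γ, hγ, rfl⟩ := h
    rcases mem_zpowers_of_mul_self hτ.1 hγ with rfl | rfl
    · exact Or.inl rfl
    · exact Or.inr (Or.inr ⟨γ, hτ, rfl, rfl⟩)

theorem AtomQuotient.eq_or_of_sd {x y} (h : q.congr.sd x y) : x = y ∨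
    ∃ τ hτ, q = .half τ hτ ∧ τ.2 x = y := by
  rcases q with _ | _ | ⟨τ, hτ⟩
  · exact Or.inl h
  · exact Or.inl h
  · obtain ⟨γ, hγ, rfl⟩ := h
    rcases mem_zpowers_of_mul_self hτ.1 hγ with rfl | rfl
    · exact Or.inl rfl
    · exact Or.inr ⟨γ, hτ, rfl, rfl⟩

theorem AtomQuotient.sv_of_half {τ hτ} (h : q = .half τ hτ) (x) : q.congr.sv x (τ.1 x) := by
  subst h
  exact ⟨τ, Subgroup.mem_zpowers τ, rfl⟩

theorem AtomQuotient.sd_of_half {τ hτ} (h : q = .half τ hτ) (x) : q.congr.sd x (τ.2 x) := by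
  subst h
  exact ⟨τ, Subgroup.mem_zpowers τ, rfl⟩

end

/-! ### Quotients by an extension as expansions -/

namespace Reduction

variable {V D C : Type*} {G : ColGraph V D C} {R : Set V} {ρ : G.Reduction R}
  {Γ : Subgroup (Equiv.Perm V × Equiv.Perm D)}
  {Γ' : Subgroup (Equiv.Perm ρ.NewV × Equiv.Perm ρ.NewD)}

/-- The relation `Induces` determines the action on new half-edges: a piece is determined by its
three sets, and the position by `mapEnd_eq`. -/
theorem Induces.inr_dart (hR : G.IsRoot R) {π : G.aut}
    {π' : Equiv.Perm ρ.NewV × Equiv.Perm ρ.NewD} (h : ρ.Induces π.1 π') (A : G.Atom R) (i : Bool) :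
    π'.2 (.inr (A, i)) = .inr (A.map hR π, ρ.mapEnd hR π A i) := by
  obtain ⟨B, hb, hi, hd, h⟩ := h.2.2 A
  obtain rfl : B = A.map hR π := Subtype.ext (Piece.ext hb hi hd)
  obtain ⟨j, hj, he, hj'⟩ := h i
  rw [hj, ρ.mapEnd_eq hR π rfl he hj']

theorem projD_eq_iff {hΓ' : Γ' ≤ ρ.graph.aut} {x y : ρ.NewD} :
    ρ.projD hΓ' x = ρ.projD hΓ' y ↔ ∃ γ ∈ Γ', γ.2 x = y := Quotient.eq

theorem projV_eq_iff {hΓ' : Γ' ≤ ρ.graph.aut} {x y : ρ.NewV} :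
    ρ.projV hΓ' x = ρ.projV hΓ' y ↔ ∃ γ ∈ Γ', γ.1 x = y := Quotient.eq

theorem projD_not {hΓ' : Γ' ≤ ρ.graph.aut} {A B : G.Atom R} {i j : Bool}
    (h : ρ.projD hΓ' (.inr (A, i)) = ρ.projD hΓ' (.inr (B, j))) :
    ρ.projD hΓ' (.inr (A, !i)) = ρ.projD hΓ' (.inr (B, !j)) :=
  congrArg (ρ.graph.quotient Γ' hΓ').inv h

/-- Old vertices with the same image in the quotient of the reduced graph lie in one orbit. -/
theorem Extends.exists_of_projV_eq (hE : ρ.Extends Γ Γ') {hΓ' : Γ' ≤ ρ.graph.aut} {v w : ρ.OldV} :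
    ρ.projV hΓ' (.inl v) = ρ.projV hΓ' (.inl w) ↔ ∃ γ ∈ Γ, γ.1 v.1 = w.1 := by
  rw [projV_eq_iff]
  constructor
  · rintro ⟨γ', hγ', h⟩
    obtain ⟨γ, hγ, h1, -⟩ := hE.2 γ' hγ'
    obtain ⟨w', hw', h2⟩ := h1 v
    rw [h] at h2
    exact ⟨γ, hγ, by rw [← hw', Sum.inl_injective h2]⟩
  · rintro ⟨γ, hγ, h⟩
    obtain ⟨γ', hγ', h1, -⟩ := hE.1 γ hγ
    obtain ⟨w', hw', h2⟩ := h1 v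
    exact ⟨γ', hγ', h2.trans (congrArg Sum.inl (Subtype.ext (hw'.trans h)))⟩

/-- Old half-edges with the same image in the quotient of the reduced graph lie in one orbit. -/
theorem Extends.exists_of_projD_eq (hE : ρ.Extends Γ Γ') {hΓ' : Γ' ≤ ρ.graph.aut} {v w : ρ.OldD} :
    ρ.projD hΓ' (.inl v) = ρ.projD hΓ' (.inl w) ↔ ∃ γ ∈ Γ, γ.2 v.1 = w.1 := by
  rw [projD_eq_iff]
  constructor
  · rintro ⟨γ', hγ', h⟩
    obtain ⟨γ, hγ, -, h1, -⟩ := hE.2 γ' hγ'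
    obtain ⟨w', hw', h2⟩ := h1 v
    rw [h] at h2
    exact ⟨γ, hγ, by rw [← hw', Sum.inl_injective h2]⟩
  · rintro ⟨γ, hγ, h⟩
    obtain ⟨γ', hγ', -, h1, -⟩ := hE.1 γ hγ
    obtain ⟨w', hw', h2⟩ := h1 v
    exact ⟨γ', hγ', h2.trans (congrArg Sum.inl (Subtype.ext (hw'.trans h)))⟩

/-- The half-quotients selected by an expansion come from elements of `Γ`. -/
def Expansion.HalvedBy {hΓ' : Γ' ≤ ρ.graph.aut} (X : ρ.Expansion hΓ')
    (Γ : Subgroup (Equiv.Perm V × Equiv.Perm D)) : Prop :=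
  ∀ B : X.reps, ∀ τ hτ, X.q B = .half τ hτ →
    ∃ γ ∈ Γ, (∀ x, (τ.1 x).1 = γ.1 x.1) ∧ ∀ h, (τ.2 h).1 = γ.2 h.1

/-- Both ends of a loop lie in one orbit of `Γ'`, and orbits of old vertices lift to `Γ`. For a
block atom the two listed ends are equal anyway. -/
theorem Extends.exists_of_loop (hE : ρ.Extends Γ Γ')
    {hΓ' : Γ' ≤ ρ.graph.aut} {A : G.Atom R} (hA : ρ.Corresponds hΓ' A .loop) :
    ∃ γ ∈ Γ, γ.1 (ρ.e A false) = ρ.e A true := by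
  have h := hA.1
  change ρ.projV hΓ' (.inl (ρ.endV A false)) = ρ.projV hΓ' (ρ.graph.vert (.inr (A, true))) at h
  by_cases hb : G.IsBlockPart R A.1
  · exact ⟨1, Γ.one_mem, ρ.e_eq_of_isBlockPart hb _ _⟩
  · rw [ρ.graph_vert_inr hb, hE.exists_of_projV_eq] at h
    exact h

variable {hΓ' : Γ' ≤ ρ.graph.aut} {X : ρ.Expansion hΓ'}

/-- Every atom is the image of a representative. -/
theorem Expansion.exists_rep (hR : G.IsRoot R) (hE : ρ.Extends Γ Γ') (hΓ : Γ ≤ G.aut)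
    (X : ρ.Expansion hΓ') (A : G.Atom R) : ∃ B : X.reps, ∃ γ : G.aut, γ.1 ∈ Γ ∧ B.1.map hR γ = A := by
  obtain ⟨B, ⟨hB, i, hi⟩, -⟩ := X.reps_unique A
  rw [eq_comm, projD_eq_iff] at hi
  obtain ⟨γ', hγ', h⟩ := hi
  obtain ⟨γ, hγ, h1⟩ := hE.2 γ' hγ'
  rw [Induces.inr_dart hR (π := ⟨γ, hΓ hγ⟩) h1] at h
  exact ⟨⟨B, hB⟩, ⟨γ, hΓ hγ⟩, hγ, congrArg Prod.fst (Sum.inr_injective h)⟩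

/-- An element of `Γ` mapping a representative to a representative is trivial or a selected
halving. -/
theorem Expansion.eq_one_or_half (hR : G.IsRoot R) (hE : ρ.Extends Γ Γ') (hΓ : G.Semiregular Γ)
    (hX : X.HalvedBy Γ) {B B' : X.reps} {γ : G.aut} (hγ : γ.1 ∈ Γ) (h : B.1.map hR γ = B'.1) :
    B = B' ∧ (γ.1 = 1 ∨ ∃ τ hτ, X.q B = .half τ hτ ∧ (∀ x, (τ.1 x).1 = γ.1.1 x.1) ∧
      ∀ h, (τ.2 h).1 = γ.1.2 h.1) := by
  obtain ⟨γ', hγ', hind⟩ := hE.1 γ.1 hγ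
  have h1 := hind.inr_dart hR B.1 false
  rw [h] at h1
  have h2 : ρ.projD hΓ' (.inr (B.1, false)) =
      ρ.projD hΓ' (.inr (B'.1, ρ.mapEnd hR γ B.1 false)) := projD_eq_iff.2 ⟨γ', hγ', h1⟩
  obtain rfl : B = B' := Subtype.ext
    ((X.reps_unique B.1).unique ⟨B.2, false, rfl⟩ ⟨B'.2, _, h2⟩)
  refine ⟨rfl, ?_⟩
  have he := ρ.e_mapEnd hR γ B.1 false
  rw [h] at he
  -- If the listed end keeps its position, `γ` fixes a vertex. Otherwise the edge of `B` is
  -- reversed, so its image is a standalone half-edge and a half-quotient was selected; its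
  -- involution comes from some `δ` in `Γ` that agrees with `γ` at one vertex.
  cases hj : ρ.mapEnd hR γ B.1 false
  · left
    rw [hj] at he
    exact hΓ.eq_of_vert hγ Γ.one_mem he.symm
  · right
    rw [hj] at h2 he
    have hc := X.corresponds B
    cases hq : X.q B with
    | edge =>
      rw [hq] at hc
      exact (hc (congrArg _ h2)).elim
    | loop =>
      rw [hq] at hc
      exact (hc.2 h2).elim
    | half τ hτ =>
      obtain ⟨δ, hδ, hv, hd⟩ := hX B τ hτ hq
      have hex : δ.1 (ρ.e B.1 false) = ρ.e B.1 true := by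
        have h3 := hτ.2.2 ⟨ρ.e B.1 false, Or.inl (ρ.e_mem _ _)⟩ (ρ.e_mem _ _)
        have h4 : δ.1 (ρ.e B.1 false) ∈ B.1.1.bdry := by
          rw [← hv ⟨ρ.e B.1 false, Or.inl (ρ.e_mem _ _)⟩]
          exact h3.1
        obtain ⟨j, hj⟩ := ρ.exists_e h4
        cases j
        · refine (h3.2 (Subtype.ext ?_)).elim
          rw [hv]
          exact hj
        · exact hj
      obtain rfl := hΓ.eq_of_vert hγ hδ (he.symm.trans hex.symm)
      exact ⟨τ, hτ, rfl, hv, hd⟩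

variable [Finite V] [Finite D]

/-- Each vertex of the expanded graph is sent to the orbit of any vertex of `G` it comes from.
Injectivity inside the atoms is `Expansion.eq_one_or_half`: two interior points of representatives
in one orbit are equal or exchanged by the selected involution. Surjectivity holds since every atom
is the image of a representative. -/
theorem Expansion.exists_equiv_vert (hG : G.IsConnectedLoopless) (hR : G.IsRoot R)
    (hE : ρ.Extends Γ Γ') (hΓ : G.Semiregular Γ) (hX : X.HalvedBy Γ) :
    ∃ ψ : X.XV ≃ Quotient (G.orbits Γ hΓ.le_aut).sv,
      (∀ v : ρ.OldV, ψ (.inl (X.oldV v)) = Quotient.mk _ v.1) ∧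
      ∀ (B : X.reps) x, ψ (X.place B (Quotient.mk _ x)) = Quotient.mk _ x.1 := by
  have hκ : ∀ (B : X.reps) x y, (X.q B).congr.sv x y →
      (Quotient.mk _ x.1 : Quotient (G.orbits Γ hΓ.le_aut).sv) = Quotient.mk _ y.1 := by
    intro B x y h
    rcases (X.q B).eq_or_of_sv h with rfl | ⟨hq, hx, hy⟩ | ⟨τ, hτ, hq, rfl⟩
    · rfl
    · have hc := X.corresponds B
      rw [hq] at hc
      obtain ⟨γ, hγ, he⟩ := hE.exists_of_loop hc
      have key : (Quotient.mk _ (ρ.e B.1 false) : Quotient (G.orbits Γ hΓ.le_aut).sv) =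
          Quotient.mk _ (ρ.e B.1 true) := Quotient.sound ⟨γ, hγ, he⟩
      obtain ⟨i, hi⟩ := ρ.exists_e hx
      obtain ⟨j, hj⟩ := ρ.exists_e hy
      rw [hi, hj]
      cases i <;> cases j
      · rfl
      · exact key
      · exact key.symm
      · rfl
    · obtain ⟨γ, hγ, hv, -⟩ := hX B τ hτ hq
      exact Quotient.sound ⟨γ, hγ, (hv x).symm⟩
  let ψ : X.XV → Quotient (G.orbits Γ hΓ.le_aut).sv := fun z => match z with
    | .inl z => Quotient.mk _ z.2.choose.1
    | .inr ⟨B, y⟩ => Quotient.lift (fun x : {v // v ∈ B.1.1.bdry ∪ B.1.1.inn} =>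
        (Quotient.mk _ x.1 : Quotient (G.orbits Γ hΓ.le_aut).sv)) (hκ B) y.1
  have h1 : ∀ v : ρ.OldV, ψ (.inl (X.oldV v)) = Quotient.mk _ v.1 := fun v =>
    Quotient.sound (hE.exists_of_projV_eq.1 (X.oldV v).2.choose_spec.symm)
  -- `place` picks a matching terminal by choice; by `hκ` the orbit does not depend on it.
  have h2 : ∀ (B : X.reps) x, ψ (X.place B (Quotient.mk _ x)) = Quotient.mk _ x.1 := by
    intro B x
    rw [place]
    split_ifs with h
    · rw [h1]
      exact (hκ B _ _ (Quotient.exact h.choose_spec)).symm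
    · rfl
  have hinn : ∀ (B : X.reps) x, (∀ i, (Quotient.mk _ x : Quotient (X.q B).congr.sv) ≠
      X.terminal B i) → x.1 ∈ B.1.1.inn := by
    intro B x h
    refine x.2.resolve_left fun hx => ?_
    obtain ⟨i, hi⟩ := ρ.exists_e hx
    exact h i (congrArg (Quotient.mk _) (Subtype.ext hi))
  -- Images of old vertices are old, hence never interior to an atom.
  have hold : ∀ (v : ρ.OldV) (B : X.reps) x, x ∈ B.1.1.inn →
      (Quotient.mk _ v.1 : Quotient (G.orbits Γ hΓ.le_aut).sv) ≠ Quotient.mk _ x := by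
    intro v B x hx h
    obtain ⟨γ, hγ, h⟩ := Quotient.exact h
    exact ρ.notMem_inn hG hR (ρ.mapOldV hR ⟨γ, hΓ.le_aut hγ⟩ v) B.1 (by
      rw [← h] at hx
      exact hx)
  have hinj : Function.Injective ψ := by
    rintro (⟨_, v, rfl⟩ | ⟨B, ⟨⟨x⟩, hx⟩⟩) (⟨_, w, rfl⟩ | ⟨B', ⟨⟨x'⟩, hx'⟩⟩) h
    · have h : ψ (.inl (X.oldV v)) = ψ (.inl (X.oldV w)) := h
      rw [h1, h1] at h
      exact congrArg Sum.inl (Subtype.ext (hE.exists_of_projV_eq.2 (Quotient.exact h)))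
    · have h : ψ (.inl (X.oldV v)) = Quotient.mk _ x'.1 := h
      rw [h1] at h
      exact (hold v B' _ (hinn B' x' hx') h).elim
    · have h : Quotient.mk _ x.1 = ψ (.inl (X.oldV w)) := h
      rw [h1] at h
      exact (hold w B _ (hinn B x hx) h.symm).elim
    · obtain ⟨γ, hγ, h⟩ := Quotient.exact h
      have hB : B.1.map hR ⟨γ, hΓ.le_aut hγ⟩ = B'.1 :=
        Atom.eq_of_mem_inn hG hR (v := x'.1) ⟨x.1, hinn B x hx, h⟩ (hinn B' x' hx')
      obtain ⟨rfl, h3⟩ := Expansion.eq_one_or_half hR hE hΓ hX hγ hB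
      suffices h4 : (Quotient.mk _ x : Quotient (X.q B).congr.sv) = Quotient.mk _ x' from
        congrArg (fun y => (Sum.inr ⟨B, y⟩ : X.XV)) (Subtype.ext h4)
      rcases h3 with h3 | ⟨τ, hτ, hq, hv, -⟩
      · obtain rfl : γ = 1 := h3
        exact congrArg _ (Subtype.ext h)
      · refine Quotient.sound ?_
        obtain rfl : τ.1 x = x' := Subtype.ext ((hv x).trans h)
        exact AtomQuotient.sv_of_half hq x
  have hsurj : Function.Surjective ψ := by
    rintro ⟨v⟩
    rcases ρ.old_or_inn v with ⟨w, rfl⟩ | ⟨A, hA⟩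
    · exact ⟨.inl (X.oldV w), h1 w⟩
    · obtain ⟨B, γ, hγ, rfl⟩ := X.exists_rep hR hE hΓ.le_aut A
      obtain ⟨x, hx, rfl⟩ := hA
      exact ⟨X.place B (Quotient.mk _ ⟨x, Or.inr hx⟩), (h2 B ⟨x, Or.inr hx⟩).trans (Quotient.sound ⟨γ.1, hγ, rfl⟩)⟩
  exact ⟨Equiv.ofBijective ψ ⟨hinj, hsurj⟩, h1, h2⟩

/-- As for vertices, but without gluing: a loop-quotient identifies no half-edges, so only halvings
contribute identifications. -/
theorem Expansion.exists_equiv_dart (hG : G.IsConnectedLoopless) (hR : G.IsRoot R)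
    (hE : ρ.Extends Γ Γ') (hΓ : G.Semiregular Γ) (hX : X.HalvedBy Γ) :
    ∃ ψ : X.XD ≃ Quotient (G.orbits Γ hΓ.le_aut).sd,
      (∀ h : ρ.OldD, ψ (.inl (X.oldD h)) = Quotient.mk _ h.1) ∧
      ∀ (B : X.reps) x, ψ (.inr ⟨B, Quotient.mk _ x⟩) = Quotient.mk _ x.1 := by
  have hκ : ∀ (B : X.reps) x y, (X.q B).congr.sd x y →
      (Quotient.mk _ x.1 : Quotient (G.orbits Γ hΓ.le_aut).sd) = Quotient.mk _ y.1 := by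
    intro B x y h
    rcases (X.q B).eq_or_of_sd h with rfl | ⟨τ, hτ, hq, rfl⟩
    · rfl
    · obtain ⟨γ, hγ, -, hd⟩ := hX B τ hτ hq
      exact Quotient.sound ⟨γ, hγ, (hd x).symm⟩
  let ψ : X.XD → Quotient (G.orbits Γ hΓ.le_aut).sd := fun z => match z with
    | .inl z => Quotient.mk _ z.2.choose.1
    | .inr ⟨B, y⟩ => Quotient.lift (fun x : {h // h ∈ B.1.1.darts} =>
        (Quotient.mk _ x.1 : Quotient (G.orbits Γ hΓ.le_aut).sd)) (hκ B) y
  have h1 : ∀ v : ρ.OldD, ψ (.inl (X.oldD v)) = Quotient.mk _ v.1 := fun v =>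
    Quotient.sound (hE.exists_of_projD_eq.1 (X.oldD v).2.choose_spec.symm)
  have h2 : ∀ (B : X.reps) x, ψ (.inr ⟨B, Quotient.mk _ x⟩) = Quotient.mk _ x.1 :=
    fun B x => rfl
  have hold : ∀ (v : ρ.OldD) (B : X.reps) x, x ∈ B.1.1.darts →
      (Quotient.mk _ v.1 : Quotient (G.orbits Γ hΓ.le_aut).sd) ≠ Quotient.mk _ x := by
    intro v B x hx h
    obtain ⟨γ, hγ, h⟩ := Quotient.exact h
    exact (ρ.mapOldD hR ⟨γ, hΓ.le_aut hγ⟩ v).2 B.1 (by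
      rw [← h] at hx
      exact hx)
  have hinj : Function.Injective ψ := by
    rintro (⟨_, v, rfl⟩ | ⟨B, ⟨x⟩⟩) (⟨_, w, rfl⟩ | ⟨B', ⟨x'⟩⟩) h
    · have h : ψ (.inl (X.oldD v)) = ψ (.inl (X.oldD w)) := h
      rw [h1, h1] at h
      exact congrArg Sum.inl (Subtype.ext (hE.exists_of_projD_eq.2 (Quotient.exact h)))
    · have h : ψ (.inl (X.oldD v)) = Quotient.mk _ x'.1 := h
      rw [h1] at h
      exact (hold v B' _ x'.2 h).elim
    · have h : Quotient.mk _ x.1 = ψ (.inl (X.oldD w)) := h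
      rw [h1] at h
      exact (hold w B _ x.2 h.symm).elim
    · obtain ⟨γ, hγ, h⟩ := Quotient.exact h
      have hB : B.1.map hR ⟨γ, hΓ.le_aut hγ⟩ = B'.1 :=
        Atom.eq_of_mem_darts hG hR (h := x'.1) ⟨x.1, x.2, h⟩ x'.2
      obtain ⟨rfl, h3⟩ := Expansion.eq_one_or_half hR hE hΓ hX hγ hB
      suffices h4 : (Quotient.mk _ x : Quotient (X.q B).congr.sd) = Quotient.mk _ x' from
        congrArg (fun y => (Sum.inr ⟨B, y⟩ : X.XD)) h4
      rcases h3 with h3 | ⟨τ, hτ, hq, -, hd⟩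
      · obtain rfl : γ = 1 := h3
        exact congrArg _ (Subtype.ext h)
      · refine Quotient.sound ?_
        obtain rfl : τ.2 x = x' := Subtype.ext ((hd x).trans h)
        exact AtomQuotient.sd_of_half hq x
  have hsurj : Function.Surjective ψ := by
    rintro ⟨v⟩
    rcases ρ.old_or_dart v with ⟨w, rfl⟩ | ⟨A, hA⟩
    · exact ⟨.inl (X.oldD w), h1 w⟩
    · obtain ⟨B, γ, hγ, rfl⟩ := X.exists_rep hR hE hΓ.le_aut A
      obtain ⟨x, hx, rfl⟩ := hA
      exact ⟨.inr ⟨B, Quotient.mk _ ⟨x, hx⟩⟩, (h2 B ⟨x, hx⟩).trans (Quotient.sound ⟨γ.1, hγ, rfl⟩)⟩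
  exact ⟨Equiv.ofBijective ψ ⟨hinj, hsurj⟩, h1, h2⟩

/-- An expansion whose half-quotients come from `Γ` is the quotient by `Γ`. -/
theorem Expansion.realizes (hG : G.IsConnectedLoopless) (hR : G.IsRoot R)
    (hE : ρ.Extends Γ Γ') (hΓ : G.Semiregular Γ) (hX : X.HalvedBy Γ) :
    X.Realizes Γ hΓ.le_aut := by
  obtain ⟨ψV, hv1, hv2⟩ := Expansion.exists_equiv_vert hG hR hE hΓ hX
  obtain ⟨ψD, hd1, hd2⟩ := Expansion.exists_equiv_dart hG hR hE hΓ hX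
  have hvert : ∀ k, ψV (X.graph.vert k) = (G.quotient Γ hΓ.le_aut).vert (ψD k) := by
    rintro (⟨_, h, rfl⟩ | ⟨B, ⟨h⟩⟩)
    · exact (hv1 ⟨G.vert h.1, _⟩).trans
        (congrArg (G.quotient Γ hΓ.le_aut).vert (hd1 h)).symm
    · exact (hv2 B _).trans (congrArg (G.quotient Γ hΓ.le_aut).vert (hd2 B h)).symm
  have hinv : ∀ k, ψD (X.graph.inv k) = (G.quotient Γ hΓ.le_aut).inv (ψD k) := by
    rintro (⟨_, h, rfl⟩ | ⟨B, ⟨h⟩⟩)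
    · exact (hd1 ⟨G.inv h.1, _⟩).trans
        (congrArg (G.quotient Γ hΓ.le_aut).inv (hd1 h)).symm
    · exact (hd2 B _).trans (congrArg (G.quotient Γ hΓ.le_aut).inv (hd2 B h)).symm
  have hcol : ∀ k, X.graph.color k = (G.quotient Γ hΓ.le_aut).color (ψD k) := by
    rintro (⟨_, h, rfl⟩ | ⟨B, ⟨h⟩⟩)
    · exact (congrArg (G.quotient Γ hΓ.le_aut).color (hd1 h)).symm
    · exact (congrArg (G.quotient Γ hΓ.le_aut).color (hd2 B h)).symm
  have hkind : ∀ k, X.graph.kind k = (G.quotient Γ hΓ.le_aut).kind (ψD k) := by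
    rintro (⟨_, h, rfl⟩ | ⟨B, ⟨h⟩⟩)
    · exact (congrArg (G.quotient Γ hΓ.le_aut).kind (hd1 h)).symm
    · exact (congrArg (G.quotient Γ hΓ.le_aut).kind (hd2 B h)).symm
  refine ⟨⟨ψV.symm, ψD.symm, fun h => ?_, fun h => ?_, fun h => ?_, fun h => ?_⟩, fun v => ?_,
    fun h => ?_⟩
  · rw [Equiv.eq_symm_apply, hvert, Equiv.apply_symm_apply]
  · rw [Equiv.eq_symm_apply, hinv, Equiv.apply_symm_apply]
  · rw [hcol, Equiv.apply_symm_apply]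
  · rw [hkind, Equiv.apply_symm_apply]
  · exact (Equiv.symm_apply_eq ψV).2 (hv1 v).symm
  · exact (Equiv.symm_apply_eq ψD).2 (hd1 h).symm

/-- The quotient by an extension is an expansion. -/
theorem Extends.exists_expansion (hG : G.IsConnectedLoopless) (hR : G.IsRoot R)
    (hE : ρ.Extends Γ Γ') (hΓ : G.Semiregular Γ) (hΓ' : ρ.graph.Semiregular Γ') :
    ∃ X : ρ.Expansion hΓ'.le_aut, X.Realizes Γ hΓ.le_aut := by
  -- The image of the new edge dictates the kind of quotient. For a standalone half-edge, the
  -- reversing element of `Γ'` lifts to an element of `Γ` that halves the atom, and this halving is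
  -- selected.
  have hq : ∀ A : G.Atom R, ∃ q, ρ.Corresponds hΓ'.le_aut A q ∧ ∀ τ hτ, q = .half τ hτ →
      ∃ γ ∈ Γ, (∀ x, (τ.1 x).1 = γ.1 x.1) ∧ ∀ h, (τ.2 h).1 = γ.2 h.1 := by
    intro A
    by_cases h1 : (ρ.graph.quotient Γ' hΓ'.le_aut).vert (ρ.projD hΓ'.le_aut (.inr (A, false))) =
      (ρ.graph.quotient Γ' hΓ'.le_aut).vert (ρ.projD hΓ'.le_aut (.inr (A, true)))
    · by_cases h2 : ρ.projD hΓ'.le_aut (.inr (A, false)) = ρ.projD hΓ'.le_aut (.inr (A, true))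
      · obtain ⟨γ', hγ', h⟩ := projD_eq_iff.1 h2
        obtain ⟨γ, hγ, hind⟩ := hE.2 γ' hγ'
        rw [Induces.inr_dart hR (π := ⟨γ, hΓ.le_aut hγ⟩) hind] at h
        have h := Sum.inr_injective h
        have hA : A.map hR ⟨γ, hΓ.le_aut hγ⟩ = A := congrArg Prod.fst h
        have hi : ρ.mapEnd hR ⟨γ, hΓ.le_aut hγ⟩ A false = true := congrArg Prod.snd h
        have hb : ¬ G.IsBlockPart R A.1 := fun hb => by
          rw [ρ.mapEnd_of_isBlockPart hR _ hb] at hi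
          exact Bool.noConfusion hi
        have hex := ρ.e_mapEnd hR ⟨γ, hΓ.le_aut hγ⟩ A false
        rw [hA, hi] at hex
        obtain ⟨τ, hτ, hv, hd⟩ := (ρ.halving_of_exchange hΓ hb hγ (congrArg Subtype.val hA)
          hex.symm).exists_isHalving
        refine ⟨.half τ hτ, h2, fun τ' hτ' e => ?_⟩
        obtain rfl : τ = τ' := by injection e
        exact ⟨γ, hγ, hv, hd⟩
      · exact ⟨.loop, ⟨h1, h2⟩, fun _ _ e => by cases e⟩
    · exact ⟨.edge, h1, fun _ _ e => by cases e⟩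
  choose q hq1 hq2 using hq
  -- Atoms are equivalent if their edges have the same image, irrespective of the ends; one atom is
  -- taken from every class.
  let s : Setoid (G.Atom R) :=
    { r := fun A B => ∃ i, ρ.projD hΓ'.le_aut (.inr (A, false)) = ρ.projD hΓ'.le_aut (.inr (B, i))
      iseqv :=
        { refl := fun _ => ⟨false, rfl⟩
          symm := by
            rintro A B ⟨i, h⟩
            cases i
            · exact ⟨false, h.symm⟩
            · exact ⟨true, (projD_not h).symm⟩
          trans := by
            rintro A B E ⟨i, h⟩ ⟨j, h'⟩
            cases i
            · exact ⟨j, h.trans h'⟩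
            · exact ⟨!j, h.trans (projD_not h')⟩ } }
  let X : ρ.Expansion hΓ'.le_aut :=
    { reps := Set.range (Quotient.out (s := s))
      reps_unique := by
        intro A
        refine ⟨(Quotient.mk s A).out, ⟨⟨_, rfl⟩, s.symm (Quotient.mk_out A)⟩, ?_⟩
        rintro _ ⟨⟨B, rfl⟩, h⟩
        have : Quotient.mk s A = B := by
          rw [← B.out_eq]
          exact Quotient.sound h
        rw [this]
      q := fun A => q A.1
      corresponds := fun A => hq1 A.1 }
  exact ⟨X, X.realizes hG hR hE hΓ fun B => hq2 B.1⟩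

end Reduction

end ColGraph

namespace ColGraph.Reduction

variable {V D C : Type*} {G : ColGraph V D C} {R : Set V} {ρ : G.Reduction R}
  {Γ' : Subgroup (Equiv.Perm ρ.NewV × Equiv.Perm ρ.NewD)}

/-! ### Automorphisms of the reduced graph -/

/-- Old and new half-edges have colours in different summands of `NewC`. -/
theorem exists_inl_dart (γ : ρ.graph.aut) (k : ρ.OldD) : ∃ l, γ.1.2 (.inl k) = .inl l := by
  have h := aut_color γ (.inl k)
  rcases hγ : γ.1.2 (.inl k) with l | A
  · exact ⟨l, rfl⟩
  · rw [hγ] at h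
    change Sum.inr _ = Sum.inl _ at h
    cases h

/-- Equality of colours only gives the equivalence relation generated by isomorphism; the existence
of a `Transport` is already an equivalence relation. -/
theorem exists_transport_of_mk_eq {A B : G.Atom R}
    (h : Quot.mk (fun A B : G.Atom R => A.1.IsoRel B.1) A = Quot.mk _ B) :
    ∃ f d, Transport A.1 B.1 f d := by
  rw [Quot.eq] at h
  induction h with
  | rel A B h => exact Transport.exists_of_isoRel h
  | refl A => exact ⟨id, id, Transport.refl A.1⟩
  | symm A B _ ih =>
    obtain ⟨f, d, h⟩ := ih
    obtain ⟨g, k, h, -⟩ := h.exists_inverse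
    exact ⟨g, k, h⟩
  | trans A B E _ _ ih ih' =>
    obtain ⟨f, d, h⟩ := ih
    obtain ⟨g, k, h'⟩ := ih'
    exact ⟨_, _, h.trans h'⟩

theorem exists_inr_dart (γ : ρ.graph.aut) (A : G.Atom R) (i : Bool) :
    ∃ B j, γ.1.2 (.inr (A, i)) = .inr (B, j) := by
  have h := aut_color γ (.inr (A, i))
  rcases hγ : γ.1.2 (.inr (A, i)) with l | ⟨B, j⟩
  · rw [hγ] at h
    change Sum.inl _ = Sum.inr _ at h
    cases h
  · exact ⟨B, j, rfl⟩

theorem exists_transport {γ : ρ.graph.aut} {A B : G.Atom R} {i j : Bool}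
    (h : γ.1.2 (.inr (A, i)) = .inr (B, j)) : ∃ f d, Transport A.1 B.1 f d := by
  have h' := aut_color γ (.inr (A, i))
  rw [h] at h'
  exact exists_transport_of_mk_eq (Sum.inr_injective h').symm

theorem act_not {γ : ρ.graph.aut} {A B : G.Atom R} {i j : Bool}
    (h : γ.1.2 (.inr (A, i)) = .inr (B, j)) : γ.1.2 (.inr (A, !i)) = .inr (B, !j) := by
  have h' := aut_inv γ (.inr (A, i))
  rw [h] at h'
  exact h'.symm

/-- Among atoms, block atoms are those with a single boundary vertex; this makes the notion
invariant under isomorphisms of atoms, which need not extend to `G`. -/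
theorem isBlockPart_iff_e_eq (ρ : G.Reduction R) (A : G.Atom R) :
    G.IsBlockPart R A.1 ↔ ρ.e A false = ρ.e A true :=
  ⟨fun h => ρ.e_eq_of_isBlockPart h _ _, fun h => by
    by_contra hA
    exact ρ.e_ne_of_not_isBlockPart hA h⟩

theorem isBlockPart_of_transport (ρ : G.Reduction R) {A B : G.Atom R} {f : V → V} {d : D → D}
    (h : Transport A.1 B.1 f d) (hA : G.IsBlockPart R A.1) : G.IsBlockPart R B.1 := by
  rw [isBlockPart_iff_e_eq ρ] at hA ⊢
  obtain ⟨x, hx, hx'⟩ := h.bijOn_bdry.surjOn (ρ.e_mem B false)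
  obtain ⟨y, hy, hy'⟩ := h.bijOn_bdry.surjOn (ρ.e_mem B true)
  rw [ρ.bdry_eq A, hA, Set.pair_eq_singleton] at hx hy
  rw [← hx', ← hy', Set.mem_singleton_iff.1 hx, Set.mem_singleton_iff.1 hy]

theorem isBlockPart_iff {γ : ρ.graph.aut} {A B : G.Atom R} {i j : Bool}
    (h : γ.1.2 (.inr (A, i)) = .inr (B, j)) : G.IsBlockPart R A.1 ↔ G.IsBlockPart R B.1 := by
  obtain ⟨f, d, h⟩ := exists_transport h
  obtain ⟨g, k, h', -⟩ := h.exists_inverse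
  exact ⟨isBlockPart_of_transport ρ h, isBlockPart_of_transport ρ h'⟩

theorem eq_of_graph_vert_eq_leaf {A B : G.Atom R} {i : Bool} (hB : G.IsBlockPart R B.1)
    (h : ρ.graph.vert (.inr (A, i)) = .inr ⟨B, hB⟩) : A = B ∧ i = true := by
  by_cases hA : G.IsBlockPart R A.1
  · cases i
    · cases h
    · rw [ρ.graph_vert_leaf hA] at h
      exact ⟨congrArg Subtype.val (Sum.inr_injective h), rfl⟩
  · rw [ρ.graph_vert_inr hA] at h
    cases h

section

variable [Finite V] [Finite D]

/-- Semiregular groups do not exchange the two ends of pendant edges. -/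
theorem act_ne_of_isBlockPart (hG : G.IsConnectedLoopless) (hR : G.IsRoot R)
    (hΓ' : ρ.graph.Semiregular Γ') {γ : ρ.graph.aut} (hγ : γ.1 ∈ Γ')
    {A B : G.Atom R} (hA : G.IsBlockPart R A.1) :
    γ.1.2 (.inr (A, false)) ≠ .inr (B, true) := by
  intro h
  have hB := (isBlockPart_iff h).1 hA
  -- The articulation would be mapped to a leaf. Then only one edge of the reduced graph ends at the
  -- articulation, so `A` is all of `G`; hence `B = A`, and `γ` reverses an undirected edge.
  have hleaf : γ.1.1 (.inl (ρ.endV A false)) = .inr ⟨B, hB⟩ := by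
    have := aut_vert γ (.inr (A, false))
    rwa [h, ρ.graph_vert_leaf hB, eq_comm] at this
  -- all half-edges at the articulation belong to `A`
  have h1 : ∀ k, G.vert k = ρ.e A false → k ∈ A.1.darts := by
    intro k hk
    rcases ρ.old_or_dart k with ⟨k, rfl⟩ | ⟨A', hk'⟩
    · obtain ⟨v, hv, hv'⟩ := ρ.graph_vert_inl k
      obtain ⟨l, hl⟩ := exists_inl_dart γ k
      have := aut_vert γ (.inl k)
      rw [hl, hv', show v = ρ.endV A false from Subtype.ext (hv.trans hk), hleaf] at this
      cases this
    · have hmem : ρ.e A false ∈ A'.1.bdry := by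
        have := A'.1.vert_mem k hk'
        rw [hk] at this
        exact this.resolve_right (ρ.notMem_inn hG hR (ρ.endV A false) A')
      obtain ⟨i, hi⟩ : ∃ i, ρ.graph.vert (.inr (A', i)) = .inl (ρ.endV A false) := by
        obtain ⟨i, hi⟩ := ρ.exists_e hmem
        by_cases hA' : G.IsBlockPart R A'.1
        · refine ⟨false, congrArg Sum.inl (Subtype.ext ?_)⟩
          exact (ρ.e_eq_of_isBlockPart hA' _ _).trans hi.symm
        · refine ⟨i, ?_⟩
          rw [ρ.graph_vert_inr hA']
          exact congrArg Sum.inl (Subtype.ext hi.symm)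
      obtain ⟨B', j, hj⟩ := exists_inr_dart γ A' i
      have h2 := aut_vert γ (.inr (A', i))
      rw [hi, hleaf, hj] at h2
      obtain ⟨rfl, rfl⟩ := eq_of_graph_vert_eq_leaf hB h2
      have := γ.1.2.injective (h.trans hj.symm)
      obtain rfl : A = A' := congrArg Prod.fst (Sum.inr_injective this)
      exact hk'
  obtain ⟨u, hb, -, -, -, hcl, -, -⟩ := hA.exists_closed
  have hu : ρ.e A false = u := by simpa [hb] using ρ.e_mem A false
  have h2 : ∀ v, v ∈ A.1.inn ∪ {u} := by
    intro v
    refine ((linked_univ hG.connected u v).mono (T := (∅ : Set V)ᶜ) (by simp)).mem_of_closed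
      (S := ∅) ?_ (Or.inr rfl)
    rintro x (hx | rfl) y hxy
    · exact Or.inl (hcl x hx y hxy)
    · obtain ⟨-, k, hk, rfl⟩ := hxy
      refine Or.inl ?_
      have := A.1.vert_mem _ (A.1.inv_mem k (h1 k (hk.trans hu.symm)))
      rwa [hb, Set.union_comm] at this
  obtain ⟨-, -, -, ⟨x, hx⟩, -⟩ := hB.exists_closed
  have hxA : x ∈ A.1.inn := by
    refine (h2 x).resolve_right fun hxu => ρ.notMem_inn hG hR (ρ.endV A false) B ?_
    change ρ.e A false ∈ _
    rw [hu, ← Set.mem_singleton_iff.1 hxu]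
    exact hx
  obtain rfl := Atom.eq_of_mem_inn hG hR hxA hx
  have := hΓ'.halvable_of_reversed γ.1 hγ (by
    intro e
    rw [e] at h
    cases h) _ h
  change ρ.newKind A false = _ at this
  rw [newKind, if_pos hA] at this
  cases this

/-- Semiregular groups respect the ends of the new edges. -/
theorem act_end (hG : G.IsConnectedLoopless) (hR : G.IsRoot R)
    (hΓ' : ρ.graph.Semiregular Γ') {γ : ρ.graph.aut} (hγ : γ.1 ∈ Γ') {A B : G.Atom R}
    {i j : Bool} (h : γ.1.2 (.inr (A, i)) = .inr (B, j)) :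
    γ.1.1 (.inl (ρ.endV A i)) = .inl (ρ.endV B j) ∧ (G.IsBlockPart R A.1 → j = i) := by
  by_cases hA : G.IsBlockPart R A.1
  · have hB := (isBlockPart_iff h).1 hA
    have hij : j = i := by
      cases i <;> cases j
      · rfl
      · exact (act_ne_of_isBlockPart hG hR hΓ' hγ hA h).elim
      · exact (act_ne_of_isBlockPart hG hR hΓ' hγ hA (act_not h)).elim
      · rfl
    subst hij
    have h1 : ∀ j, ρ.endV A j = ρ.endV A false := fun j =>
      Subtype.ext (ρ.e_eq_of_isBlockPart hA _ _)
    have h2 : ∀ j, ρ.endV B j = ρ.endV B false := fun j =>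
      Subtype.ext (ρ.e_eq_of_isBlockPart hB _ _)
    refine ⟨?_, fun _ => rfl⟩
    have h : γ.1.2 (.inr (A, false)) = .inr (B, false) := by
      cases j
      · exact h
      · exact act_not h
    rw [h1, h2]
    have := aut_vert γ (.inr (A, false))
    rw [h] at this
    exact this.symm
  · have hB := fun h' => hA ((isBlockPart_iff h).2 h')
    refine ⟨?_, fun h => (hA h).elim⟩
    have := aut_vert γ (.inr (A, i))
    rw [h, ρ.graph_vert_inr hA, ρ.graph_vert_inr hB] at this
    exact this.symm

/-- Pulling back by `γ⁻¹`, the half-edge at a leaf goes to a half-edge at a leaf by `act_end`, so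
leaves go to leaves. -/
theorem exists_inl (hG : G.IsConnectedLoopless) (hR : G.IsRoot R)
    (hΓ' : ρ.graph.Semiregular Γ') {γ : ρ.graph.aut} (hγ : γ.1 ∈ Γ') (v : ρ.OldV) :
    ∃ w, γ.1.1 (.inl v) = .inl w := by
  rcases h : γ.1.1 (.inl v) with w | ⟨B, hB⟩
  · exact ⟨w, rfl⟩
  · obtain ⟨A, i, hA⟩ := exists_inr_dart γ⁻¹ B true
    have hA' : G.IsBlockPart R A.1 := (isBlockPart_iff hA).1 hB
    obtain rfl := (act_end hG hR hΓ' (Γ'.inv_mem hγ) hA).2 hB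
    have := aut_vert γ⁻¹ (.inr (B, true))
    rw [hA, ρ.graph_vert_leaf hB, ρ.graph_vert_leaf hA', ← h, aut_inv_apply_fst] at this
    cases this

end

/-! ### Isomorphisms of atoms matching an automorphism of the reduced graph -/

/-- The isomorphism `(f, d)` of atoms agrees with `γ` on the boundary. -/
structure Matches (γ : Equiv.Perm ρ.NewV × Equiv.Perm ρ.NewD) (A B : G.Atom R) (f : V → V)
    (d : D → D) : Prop extends Transport A.1 B.1 f d where
  agrees : ∀ v : ρ.OldV, v.1 ∈ A.1.bdry → ∃ w : ρ.OldV, w.1 = f v.1 ∧ γ.1 (.inl v) = .inl w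

theorem Matches.comp {γ δ : Equiv.Perm ρ.NewV × Equiv.Perm ρ.NewD} {A B E : G.Atom R}
    {f g : V → V} {d k : D → D} (h : Matches γ B E g k) (h' : Matches δ A B f d) :
    Matches (γ * δ) A E (g ∘ f) (k ∘ d) := by
  refine ⟨h'.toTransport.trans h.toTransport, fun v hv => ?_⟩
  obtain ⟨w, hw, h1⟩ := h'.agrees v hv
  obtain ⟨x, hx, h2⟩ := h.agrees w (hw ▸ h'.bijOn_bdry.mapsTo hv)
  refine ⟨x, by rw [hx, hw]; rfl, ?_⟩
  change γ.1 (δ.1 _) = _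
  rw [h1, h2]

theorem Matches.of_ends {γ : Equiv.Perm ρ.NewV × Equiv.Perm ρ.NewD} {A B : G.Atom R}
    {f : V → V} {d : D → D} (h : Transport A.1 B.1 f d)
    (hf : ∀ i, ∃ w : ρ.OldV, w.1 = f (ρ.e A i) ∧ γ.1 (.inl (ρ.endV A i)) = .inl w) :
    Matches γ A B f d := by
  refine ⟨h, fun v hv => ?_⟩
  obtain ⟨i, hi⟩ := ρ.exists_e hv
  obtain rfl : v = ρ.endV A i := Subtype.ext hi
  exact hf i

/-- Agreement at one end suffices: an isomorphism is bijective on a boundary of at most two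
vertices, so the other end follows. -/
theorem Matches.of_act [Finite V] [Finite D] (hG : G.IsConnectedLoopless) (hR : G.IsRoot R)
    (hΓ' : ρ.graph.Semiregular Γ') {γ : ρ.graph.aut} (hγ : γ.1 ∈ Γ') {A B : G.Atom R}
    {i j : Bool} (h : γ.1.2 (.inr (A, i)) = .inr (B, j)) {f : V → V} {d : D → D}
    (hfd : Transport A.1 B.1 f d) (hf : f (ρ.e A i) = ρ.e B j) : Matches γ.1 A B f d := by
  refine Matches.of_ends hfd fun k => ⟨_, ?_, (act_end hG hR hΓ' hγ (A := A) (B := B) (i := k)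
    (j := if k = i then j else !j) ?_).1⟩
  · change ρ.e B _ = _
    by_cases hki : k = i
    · rw [if_pos hki, hki, hf]
    · rw [if_neg hki]
      obtain ⟨l, hl⟩ := ρ.exists_e (hfd.bijOn_bdry.mapsTo (ρ.e_mem A k))
      rw [hl]
      by_cases hB : G.IsBlockPart R B.1
      · exact ρ.e_eq_of_isBlockPart hB _ _
      · have hA := fun hA => hB ((isBlockPart_iff h).1 hA)
        have hlj : l ≠ j := by
          rintro rfl
          exact hki (ρ.eq_of_e_eq hA (hfd.bijOn_bdry.injOn (ρ.e_mem A k) (ρ.e_mem A i)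
            (hl.trans hf.symm)))
        congr 1
        revert hlj
        cases l <;> cases j <;> simp
  · by_cases hki : k = i
    · rw [if_pos hki, hki, h]
    · obtain rfl : k = !i := by
        revert hki
        cases k <;> cases i <;> simp
      rw [if_neg hki]
      exact act_not h

/-- Every element of a semiregular group mapping the edge of `A` to the edge of `B` is matched by
an isomorphism of atoms. -/
theorem exists_matches [Finite V] [Finite D] (hG : G.IsConnectedLoopless) (hR : G.IsRoot R)
    (hΓ' : ρ.graph.Semiregular Γ') {γ : ρ.graph.aut} (hγ : γ.1 ∈ Γ') {A B : G.Atom R}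
    {j : Bool} (h : γ.1.2 (.inr (A, false)) = .inr (B, j)) : ∃ f d, Matches γ.1 A B f d := by
  obtain ⟨f, d, hfd⟩ := exists_transport h
  suffices key : ∃ f d, Transport A.1 B.1 f d ∧ f (ρ.e A false) = ρ.e B j by
    obtain ⟨f, d, hfd, hf⟩ := key
    exact ⟨f, d, Matches.of_act hG hR hΓ' hγ h hfd hf⟩
  obtain ⟨l, hl⟩ := ρ.exists_e (hfd.bijOn_bdry.mapsTo (ρ.e_mem A false))
  by_cases hA : G.IsBlockPart R A.1
  · exact ⟨f, d, hfd, hl.trans (ρ.e_eq_of_isBlockPart ((isBlockPart_iff h).1 hA) _ _)⟩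
  have hB := fun hB => hA ((isBlockPart_iff h).2 hB)
  -- If the given isomorphism hits the wrong end, it is preceded by an exchange of the boundary of
  -- `A`.
  by_cases hex : A.1.Exchangeable
  · by_cases hlj : l = j
    · exact ⟨f, d, hfd, hlj ▸ hl⟩
    · obtain ⟨t, s, hts, ht⟩ := hex.exists_transport (ρ.bdry_eq A)
      refine ⟨_, _, hts.trans hfd, ?_⟩
      have h1 : t (ρ.e A false) ≠ ρ.e A false := ht _ (ρ.e_mem A false)
      have h2 := hts.bijOn_bdry.mapsTo (ρ.e_mem A false)
      obtain ⟨m, hm⟩ := ρ.exists_e (hfd.bijOn_bdry.mapsTo h2)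
      rw [Function.comp, hm]
      have hml : m ≠ l := by
        rintro rfl
        exact h1 (hfd.bijOn_bdry.injOn h2 (ρ.e_mem A false) (hm.trans hl.symm))
      congr 1
      revert hml hlj
      cases m <;> cases l <;> cases j <;> simp
  · refine ⟨f, d, hfd, ?_⟩
    have hexB : ¬ B.1.Exchangeable := fun hexB => by
      obtain ⟨g, k, hgk, -⟩ := hfd.exists_inverse
      exact hex (hgk.exchangeable (ρ.bdry_eq B) hexB)
    -- For asymmetric atoms both edges are directed, and `γ` preserves directions.
    have hj : j = false := by
      have hk := aut_kind γ (.inr (A, false))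
      rw [h] at hk
      change ρ.newKind B j = ρ.newKind A false at hk
      rw [newKind, newKind, if_neg hA, if_neg hB, if_neg hex, if_neg hexB,
        if_neg (mt Piece.Halvable.exchangeable hex),
        if_neg (mt Piece.Halvable.exchangeable hexB)] at hk
      cases j
      · rfl
      · cases hk
    rw [hj]
    exact ρ.consistent A B hA hex hfd.toIso hfd.respectsBdry_toIso
      ⟨ρ.e A false, Or.inl (ρ.e_mem A false)⟩ rfl

end ColGraph.Reduction

namespace ColGraph.Reduction

variable {V D C : Type*} {G : ColGraph V D C} {R : Set V} {ρ : G.Reduction R}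
  {Γ' : Subgroup (Equiv.Perm ρ.NewV × Equiv.Perm ρ.NewD)}

/-! ### Charts: coherent isomorphisms from the representatives onto all atoms -/

/-- Isomorphisms from each representative `B` onto the atoms `g B`, for `g ∈ Γ'`. An element of
`Γ'` reversing the edge of `B` corresponds to the selected halving of `B`. -/
structure Charts (hΓ' : ρ.graph.Semiregular Γ') (X : ρ.Expansion hΓ'.le_aut) where
  cV : X.reps → Γ' → V → V
  cD : X.reps → Γ' → D → D
  tV : X.reps → V → V
  tD : X.reps → D → D
  isMatch : ∀ (B : X.reps) (g : Γ') A j, g.1.2 (.inr (B.1, false)) = .inr (A, j) →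
    Matches g.1 B.1 A (cV B g) (cD B g)
  halving : ∀ (B : X.reps) (σ : Γ'), σ.1.2 (.inr (B.1, false)) = .inr (B.1, true) →
    Halving B.1.1 (tV B) (tD B)
  -- The charts labelled `g` and `g * σ` have the same target atom; this relation makes the action
  -- on it independent of the chart in use.
  cV_swap : ∀ (B : X.reps) (σ : Γ'), σ.1.2 (.inr (B.1, false)) = .inr (B.1, true) →
    ∀ g, ∀ x ∈ B.1.1.verts, cV B (g * σ) x = cV B g (tV B x)
  cD_swap : ∀ (B : X.reps) (σ : Γ'), σ.1.2 (.inr (B.1, false)) = .inr (B.1, true) →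
    ∀ g, ∀ x ∈ B.1.1.darts, cD B (g * σ) x = cD B g (tD B x)
  tV_eq : ∀ (B : X.reps) τ hτ, X.q B = .half τ hτ → ∀ x, tV B x.1 = (τ.1 x).1
  tD_eq : ∀ (B : X.reps) τ hτ, X.q B = .half τ hτ → ∀ x, tD B x.1 = (τ.2 x).1
  cV_one : ∀ (B : X.reps), ∀ x ∈ B.1.1.verts, cV B 1 x = x
  cD_one : ∀ (B : X.reps), ∀ x ∈ B.1.1.darts, cD B 1 x = x

variable {hΓ' : ρ.graph.Semiregular Γ'} {X : ρ.Expansion hΓ'.le_aut}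

theorem act_not_of_mem (hΓ' : ρ.graph.Semiregular Γ') {g : Γ'} {A B : G.Atom R} {i j : Bool}
    (h : g.1.2 (.inr (A, i)) = .inr (B, j)) : g.1.2 (.inr (A, !i)) = .inr (B, !j) :=
  act_not (γ := ⟨g.1, hΓ'.le_aut g.2⟩) h

theorem eq_of_act_eq (hΓ' : ρ.graph.Semiregular Γ') {g g' : Γ'} {k : ρ.NewD}
    (h : g.1.2 k = g'.1.2 k) : g = g' := Subtype.ext (hΓ'.eq_of_dart g.2 g'.2 h)

/-- Elements mapping the edges of two representatives to the same edge differ at most by an element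
reversing the edge of the representative. -/
theorem Expansion.eq_or_swap {B B' : X.reps} {g g' : Γ'} {A : G.Atom R} {j j' : Bool}
    (h : g.1.2 (.inr (B.1, false)) = .inr (A, j))
    (h' : g'.1.2 (.inr (B'.1, false)) = .inr (A, j')) :
    B = B' ∧ (g = g' ∨ ∃ σ : Γ', σ.1.2 (.inr (B.1, false)) = .inr (B.1, true) ∧ g = g' * σ) := by
  have key : ∀ {B : X.reps} {g : Γ'} {j : Bool}, g.1.2 (.inr (B.1, false)) = .inr (A, j) →
      ∃ i, ρ.projD hΓ'.le_aut (.inr (A, false)) = ρ.projD hΓ'.le_aut (.inr (B.1, i)) := by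
    intro B g j h
    cases j
    · exact ⟨false, (projD_eq_iff.2 ⟨g.1, g.2, h⟩).symm⟩
    · exact ⟨true, (projD_eq_iff.2 ⟨g.1, g.2, act_not_of_mem hΓ' h⟩).symm⟩
  obtain rfl : B = B' := Subtype.ext ((X.reps_unique A).unique ⟨B.2, key h⟩ ⟨B'.2, key h'⟩)
  refine ⟨rfl, ?_⟩
  by_cases hj : j = j'
  · left
    exact eq_of_act_eq hΓ' (h.trans (hj ▸ h'.symm))
  · right
    refine ⟨g'⁻¹ * g, ?_, (mul_inv_cancel_left _ _).symm⟩
    obtain rfl : j = !j' := by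
      revert hj
      cases j <;> cases j' <;> simp
    have h2 := act_not_of_mem hΓ' h'
    change g'.1.2⁻¹ (g.1.2 _) = _
    rw [h, ← h2]
    exact g'.1.2.symm_apply_apply _

/-- The square fixes a half-edge. -/
theorem swap_mul_self (hΓ' : ρ.graph.Semiregular Γ') {σ : Γ'} {B : G.Atom R}
    (h : σ.1.2 (.inr (B, false)) = .inr (B, true)) : σ * σ = 1 := by
  refine eq_of_act_eq hΓ' (k := .inr (B, false)) ?_
  change σ.1.2 (σ.1.2 _) = _
  rw [h]
  exact act_not_of_mem hΓ' h

theorem swap_ne_one {σ : Γ'} {B : G.Atom R}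
    (h : σ.1.2 (.inr (B, false)) = .inr (B, true)) : σ ≠ 1 := by
  rintro rfl
  cases h

namespace Charts

theorem exists_act (hΓ' : ρ.graph.Semiregular Γ') (g : Γ') (A : G.Atom R) (i : Bool) :
    ∃ B j, g.1.2 (.inr (A, i)) = .inr (B, j) := exists_inr_dart ⟨g.1, hΓ'.le_aut g.2⟩ A i

/-- Every atom is the image of a chart. -/
theorem exists_chart (X : ρ.Expansion hΓ'.le_aut) (A : G.Atom R) :
    ∃ (B : X.reps) (h : Γ') (j : Bool), h.1.2 (.inr (B.1, false)) = .inr (A, j) := by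
  obtain ⟨B, ⟨hB, i, hi⟩, -⟩ := X.reps_unique A
  cases i
  · obtain ⟨γ, hγ, h⟩ := projD_eq_iff.1 hi.symm
    exact ⟨⟨B, hB⟩, ⟨γ, hγ⟩, false, h⟩
  · obtain ⟨γ, hγ, h⟩ := projD_eq_iff.1 hi.symm
    exact ⟨⟨B, hB⟩, ⟨γ, hγ⟩, true, act_not_of_mem hΓ' (g := ⟨γ, hγ⟩) h⟩

theorem exists_vert (K : Charts hΓ' X) (v : V) :
    (∃ w : ρ.OldV, w.1 = v) ∨ ∃ (B : X.reps) (h : Γ'), ∃ x ∈ B.1.1.inn, K.cV B h x = v := by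
  refine (ρ.old_or_inn v).imp_right ?_
  rintro ⟨A, hA⟩
  obtain ⟨B, h, j, hB⟩ := exists_chart (hΓ' := hΓ') X A
  obtain ⟨x, hx, rfl⟩ := (K.isMatch B h A j hB).bijOn_inn.surjOn hA
  exact ⟨B, h, x, hx, rfl⟩

theorem exists_dart (K : Charts hΓ' X) (v : D) :
    (∃ w : ρ.OldD, w.1 = v) ∨ ∃ (B : X.reps) (h : Γ'), ∃ x ∈ B.1.1.darts, K.cD B h x = v := by
  refine (ρ.old_or_dart v).imp_right ?_
  rintro ⟨A, hA⟩
  obtain ⟨B, h, j, hB⟩ := exists_chart (hΓ' := hΓ') X A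
  obtain ⟨x, hx, rfl⟩ := (K.isMatch B h A j hB).bijOn_darts.surjOn hA
  exact ⟨B, h, x, hx, rfl⟩

theorem cD_ne_old (K : Charts hΓ' X) {B : X.reps} {h : Γ'} {x : D} (hx : x ∈ B.1.1.darts) (v : ρ.OldD) :
    K.cD B h x ≠ v.1 := by
  obtain ⟨A, j, hA⟩ := exists_act hΓ' h B.1 false
  intro e
  exact v.2 A (e ▸ (K.isMatch B h A j hA).bijOn_darts.mapsTo hx)

end Charts

/-! ### Construction of the charts -/

variable [Finite V] [Finite D]

/-- An element reversing the edge of `B` makes its image a standalone half-edge, so a half-quotient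
was selected, and its involution serves as the exchange. -/
theorem Expansion.exists_swap (hG : G.IsConnectedLoopless) (hR : G.IsRoot R)
    (X : ρ.Expansion hΓ'.le_aut) (B : X.reps) : ∃ (t : V → V) (s : D → D),
    (∀ σ : Γ', σ.1.2 (.inr (B.1, false)) = .inr (B.1, true) →
      Halving B.1.1 t s ∧ Matches σ.1 B.1 B.1 t s) ∧
    ∀ τ hτ, X.q B = .half τ hτ → (∀ x, t x.1 = (τ.1 x).1) ∧ ∀ x, s x.1 = (τ.2 x).1 := by
  have hc := X.corresponds B
  have hproj : ∀ σ : Γ', σ.1.2 (.inr (B.1, false)) = .inr (B.1, true) →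
      ρ.projD hΓ'.le_aut (.inr (B.1, false)) = ρ.projD hΓ'.le_aut (.inr (B.1, true)) :=
    fun σ h => projD_eq_iff.2 ⟨σ.1, σ.2, h⟩
  cases hq : X.q B with
  | edge =>
    rw [hq] at hc
    -- No element reverses this edge; the identities are placeholders.
    exact ⟨id, id, fun σ h => (hc (congrArg _ (hproj σ h))).elim, fun _ _ e => by cases e⟩
  | loop =>
    rw [hq] at hc
    exact ⟨id, id, fun σ h => (hc.2 (hproj σ h)).elim, fun _ _ e => by cases e⟩
  | half τ hτ =>
    obtain ⟨t, s, hts, ht, hs⟩ := hτ.exists_halving (ρ.bdry_eq B.1)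
    refine ⟨t, s, fun σ h => ⟨hts, ?_⟩, fun τ' hτ' e => ?_⟩
    · refine Matches.of_act hG hR hΓ' (γ := ⟨σ.1, hΓ'.le_aut σ.2⟩) σ.2 h hts.transport ?_
      obtain ⟨i, hi⟩ := ρ.exists_e (hts.transport.bijOn_bdry.mapsTo (ρ.e_mem B.1 false))
      cases i
      · exact (hts.vert_free _ (Or.inl (ρ.e_mem _ _)) hi).elim
      · exact hi
    · obtain rfl : τ = τ' := by injection e
      exact ⟨ht, hs⟩

/-- Representatives receive the identity labelled by `1`, which later yields `cV_one` and `cD_one`.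
-/
theorem Expansion.exists_chart (hG : G.IsConnectedLoopless) (hR : G.IsRoot R)
    (X : ρ.Expansion hΓ'.le_aut) (A : G.Atom R) : ∃ (B : X.reps) (g : Γ') (f : V → V) (d : D → D),
    (∃ j, g.1.2 (.inr (B.1, false)) = .inr (A, j)) ∧ Matches g.1 B.1 A f d ∧
      (A ∈ X.reps → g = 1 ∧ f = id ∧ d = id) := by
  by_cases hA : A ∈ X.reps
  · exact ⟨⟨A, hA⟩, 1, id, id, ⟨false, rfl⟩, ⟨Transport.refl A.1, fun v _ => ⟨v, rfl, rfl⟩⟩,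
      fun _ => ⟨rfl, rfl, rfl⟩⟩
  · obtain ⟨B, ⟨hB, i, hi⟩, -⟩ := X.reps_unique A
    have : ∃ j, ρ.projD hΓ'.le_aut (.inr (B, false)) = ρ.projD hΓ'.le_aut (.inr (A, j)) := by
      cases i
      · exact ⟨false, hi.symm⟩
      · exact ⟨true, (projD_not hi).symm⟩
    obtain ⟨j, hj⟩ := this
    obtain ⟨γ, hγ, h⟩ := projD_eq_iff.1 hj
    obtain ⟨f, d, hfd⟩ := exists_matches hG hR hΓ' (γ := ⟨γ, hΓ'.le_aut hγ⟩) hγ h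
    exact ⟨⟨B, hB⟩, ⟨γ, hγ⟩, f, d, ⟨j, h⟩, hfd, fun h => (hA h).elim⟩

/-- One isomorphism, labelled `g A`, is fixed for every atom `A`. At most one other element, `g A *
σ`, takes the edge of the representative to that of `A`, and its chart is the same isomorphism
preceded by the halving. The swap relations hold in both directions since `σ` and the halving are
involutions. -/
theorem Expansion.nonempty_charts (hG : G.IsConnectedLoopless) (hR : G.IsRoot R)
    (X : ρ.Expansion hΓ'.le_aut) : Nonempty (Charts hΓ' X) := by
  classical
  choose t s hts ht using Expansion.exists_swap (hΓ' := hΓ') hG hR X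
  choose b g f d hb hfd h1 using Expansion.exists_chart (hΓ' := hΓ') hG hR X
  choose a ja ha using fun (B : X.reps) (k : Γ') =>
    exists_inr_dart ⟨k.1, hΓ'.le_aut k.2⟩ B.1 false
  have ha' : ∀ {B : X.reps} {k : Γ'} {A j}, k.1.2 (.inr (B.1, false)) = .inr (A, j) →
      a B k = A := fun {B k A j} h => congrArg Prod.fst (Sum.inr_injective ((ha B k).symm.trans h))
  have hmain : ∀ (B : X.reps) (k : Γ') A j, k.1.2 (.inr (B.1, false)) = .inr (A, j) →
      b A = B ∧ (k = g A ∨ (k ≠ g A ∧ ∃ σ : Γ', σ.1.2 (.inr (B.1, false)) = .inr (B.1, true) ∧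
        k = g A * σ)) := by
    intro B k A j h
    obtain ⟨l, hl⟩ := hb A
    obtain ⟨h2, h3⟩ := Expansion.eq_or_swap (hΓ' := hΓ') h hl
    refine ⟨h2.symm, h3.imp_right ?_⟩
    rintro ⟨σ, hσ, rfl⟩
    exact ⟨fun e => swap_ne_one hσ (mul_eq_left.1 e), σ, hσ, rfl⟩
  -- Right multiplication by `σ` interchanges the two labels belonging to one atom.
  have hswap : ∀ (B : X.reps) (σ : Γ'), σ.1.2 (.inr (B.1, false)) = .inr (B.1, true) →
      ∀ k : Γ', a B (k * σ) = a B k ∧ ((k = g (a B k) ∧ k * σ ≠ g (a B k)) ∨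
        (k ≠ g (a B k) ∧ k * σ = g (a B k))) := by
    intro B σ hσ k
    have h2 : (k * σ).1.2 (.inr (B.1, false)) = .inr (a B k, !(ja B k)) := by
      change k.1.2 (σ.1.2 _) = _
      rw [hσ]
      exact act_not_of_mem hΓ' (ha B k)
    refine ⟨ha' h2, ?_⟩
    obtain ⟨-, h3 | ⟨h3, σ', hσ', h4⟩⟩ := hmain B k _ _ (ha B k)
    · exact Or.inl ⟨h3, fun e => swap_ne_one hσ (mul_eq_left.1 (e.trans h3.symm))⟩
    · obtain rfl : σ = σ' := eq_of_act_eq hΓ' (hσ.trans hσ'.symm)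
      refine Or.inr ⟨h3, ?_⟩
      conv_lhs => rw [h4]
      rw [mul_assoc, swap_mul_self hΓ' hσ, mul_one]
  have hinvV : ∀ (B : X.reps) (σ : Γ'), σ.1.2 (.inr (B.1, false)) = .inr (B.1, true) →
      ∀ x ∈ B.1.1.verts, t B (t B x) = x := fun B σ hσ x hx => (hts B σ hσ).1.invol_vert x hx
  have hinvD : ∀ (B : X.reps) (σ : Γ'), σ.1.2 (.inr (B.1, false)) = .inr (B.1, true) →
      ∀ x ∈ B.1.1.darts, s B (s B x) = x := fun B σ hσ x hx => (hts B σ hσ).1.invol_dart x hx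
  have hone : ∀ B : X.reps, a B 1 = B.1 := fun B => ha' (k := 1) (j := false) rfl
  refine ⟨{
    cV := fun B k => if k = g (a B k) then f (a B k) else f (a B k) ∘ t B
    cD := fun B k => if k = g (a B k) then d (a B k) else d (a B k) ∘ s B
    tV := t
    tD := s
    isMatch := ?_
    halving := fun B σ hσ => (hts B σ hσ).1
    cV_swap := ?_
    cD_swap := ?_
    tV_eq := fun B τ hτ h => (ht B τ hτ h).1
    tD_eq := fun B τ hτ h => (ht B τ hτ h).2
    cV_one := ?_
    cD_one := ?_ }⟩
  · intro B k A j h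
    obtain rfl := ha' h
    obtain ⟨h2, h3⟩ := hmain B k _ _ h
    have h4 := hfd (a B k)
    rw [h2] at h4
    rcases h3 with h3 | ⟨h3, σ, hσ, h5⟩
    · simp only [if_pos h3]
      rwa [← h3] at h4
    · simp only [if_neg h3]
      have := h4.comp (hts B σ hσ).2
      rwa [show (g (a B k)).1 * σ.1 = k.1 from congrArg Subtype.val h5.symm] at this
  · intro B σ hσ k x hx
    obtain ⟨h2, ⟨h3, h4⟩ | ⟨h3, h4⟩⟩ := hswap B σ hσ k
    · simp only [h2, if_pos h3, if_neg h4, Function.comp]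
    · simp only [h2, if_neg h3, if_pos h4, Function.comp]
      rw [hinvV B σ hσ x hx]
  · intro B σ hσ k x hx
    obtain ⟨h2, ⟨h3, h4⟩ | ⟨h3, h4⟩⟩ := hswap B σ hσ k
    · simp only [h2, if_pos h3, if_neg h4, Function.comp]
    · simp only [h2, if_neg h3, if_pos h4, Function.comp]
      rw [hinvD B σ hσ x hx]
  · intro B x _
    obtain ⟨h2, h3, -⟩ := h1 B.1 B.2
    simp only [hone, h2, if_true, h3, id]
  · intro B x _
    obtain ⟨h2, -, h3⟩ := h1 B.1 B.2
    simp only [hone, h2, if_true, h3, id]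

/-! ### The action of the group on the original graph -/

namespace Charts

/-- The ambiguity in the representation of vertices by charts. -/
theorem vert_eq (K : Charts hΓ' X) (hG : G.IsConnectedLoopless) (hR : G.IsRoot R) {B B' : X.reps} {h h' : Γ'}
    {x x' : V} (hx : x ∈ B.1.1.inn) (hx' : x' ∈ B'.1.1.inn) (e : K.cV B h x = K.cV B' h' x') :
    B = B' ∧ ((h = h' ∧ x = x') ∨ ∃ σ : Γ', σ.1.2 (.inr (B.1, false)) = .inr (B.1, true) ∧
      h = h' * σ ∧ x' = K.tV B x) := by
  obtain ⟨A, j, hA⟩ := exists_act hΓ' h B.1 false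
  obtain ⟨A', j', hA'⟩ := exists_act hΓ' h' B'.1 false
  have hm := K.isMatch B h A j hA
  have hm' := K.isMatch B' h' A' j' hA'
  have hAA : A = A' := Atom.eq_of_mem_inn hG hR (hm.bijOn_inn.mapsTo hx)
    (by rw [e]; exact hm'.bijOn_inn.mapsTo hx')
  subst hAA
  obtain ⟨rfl, rfl | ⟨σ, hσ, rfl⟩⟩ := Expansion.eq_or_swap (hΓ' := hΓ') hA hA'
  · exact ⟨rfl, Or.inl ⟨rfl, hm.bijOn_inn.injOn hx hx' e⟩⟩
  · refine ⟨rfl, Or.inr ⟨σ, hσ, rfl, ?_⟩⟩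
    rw [K.cV_swap B σ hσ h' x (Or.inr hx)] at e
    exact (hm'.bijOn_inn.injOn ((K.halving B σ hσ).transport.bijOn_inn.mapsTo hx) hx' e).symm

/-- The ambiguity in the representation of half-edges by charts. -/
theorem dart_eq (K : Charts hΓ' X) (hG : G.IsConnectedLoopless) (hR : G.IsRoot R) {B B' : X.reps} {h h' : Γ'}
    {x x' : D} (hx : x ∈ B.1.1.darts) (hx' : x' ∈ B'.1.1.darts) (e : K.cD B h x = K.cD B' h' x') :
    B = B' ∧ ((h = h' ∧ x = x') ∨ ∃ σ : Γ', σ.1.2 (.inr (B.1, false)) = .inr (B.1, true) ∧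
      h = h' * σ ∧ x' = K.tD B x) := by
  obtain ⟨A, j, hA⟩ := exists_act hΓ' h B.1 false
  obtain ⟨A', j', hA'⟩ := exists_act hΓ' h' B'.1 false
  have hm := K.isMatch B h A j hA
  have hm' := K.isMatch B' h' A' j' hA'
  have hAA : A = A' := Atom.eq_of_mem_darts hG hR (hm.bijOn_darts.mapsTo hx)
    (by rw [e]; exact hm'.bijOn_darts.mapsTo hx')
  subst hAA
  obtain ⟨rfl, rfl | ⟨σ, hσ, rfl⟩⟩ := Expansion.eq_or_swap (hΓ' := hΓ') hA hA'
  · exact ⟨rfl, Or.inl ⟨rfl, hm.bijOn_darts.injOn hx hx' e⟩⟩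
  · refine ⟨rfl, Or.inr ⟨σ, hσ, rfl, ?_⟩⟩
    rw [K.cD_swap B σ hσ h' x hx] at e
    exact (hm'.bijOn_darts.injOn ((K.halving B σ hσ).transport.bijOn_darts.mapsTo hx) hx' e).symm

theorem cV_ne_old (K : Charts hΓ' X) (hG : G.IsConnectedLoopless) (hR : G.IsRoot R) {B : X.reps} {h : Γ'} {x : V}
    (hx : x ∈ B.1.1.inn) (v : ρ.OldV) : K.cV B h x ≠ v.1 := by
  obtain ⟨A, j, hA⟩ := exists_act hΓ' h B.1 false
  intro e
  exact ρ.notMem_inn hG hR v A (e ▸ (K.isMatch B h A j hA).bijOn_inn.mapsTo hx)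

/-- The action on the vertices of `G`. -/
theorem exists_liftV (K : Charts hΓ' X) (hG : G.IsConnectedLoopless) (hR : G.IsRoot R) (g : Γ') (v : V) : ∃ w,
    (∀ v₀ w₀ : ρ.OldV, v₀.1 = v → g.1.1 (.inl v₀) = .inl w₀ → w = w₀.1) ∧
    ∀ (B : X.reps) (h : Γ') x, x ∈ B.1.1.inn → K.cV B h x = v → w = K.cV B (g * h) x := by
  rcases K.exists_vert v with ⟨v, rfl⟩ | ⟨B, h, x, hx, rfl⟩
  · obtain ⟨w, hw⟩ := exists_inl hG hR hΓ' (γ := ⟨g.1, hΓ'.le_aut g.2⟩) g.2 v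
    refine ⟨w.1, fun v₀ w₀ hv hw₀ => ?_, fun B h x hx e => (K.cV_ne_old hG hR hx v e).elim⟩
    obtain rfl : v₀ = v := Subtype.ext hv
    exact congrArg Subtype.val (Sum.inl_injective (hw.symm.trans hw₀))
  · refine ⟨K.cV B (g * h) x, fun v₀ _ e _ => (K.cV_ne_old hG hR hx v₀ e.symm).elim,
      fun B' h' x' hx' e => ?_⟩
    obtain ⟨rfl, ⟨rfl, rfl⟩ | ⟨σ, hσ, rfl, rfl⟩⟩ := K.vert_eq hG hR hx hx' e.symm
    · rfl
    -- Two representations of the vertex differ by `σ`, and `cV_swap` moves it from the label to the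
    -- point, also after multiplication by `g`.
    · rw [← mul_assoc, K.cV_swap B σ hσ _ x (Or.inr hx)]

/-- The action on the half-edges of `G`. -/
theorem exists_liftD (K : Charts hΓ' X) (hG : G.IsConnectedLoopless) (hR : G.IsRoot R) (g : Γ') (v : D) : ∃ w,
    (∀ v₀ w₀ : ρ.OldD, v₀.1 = v → g.1.2 (.inl v₀) = .inl w₀ → w = w₀.1) ∧
    ∀ (B : X.reps) (h : Γ') x, x ∈ B.1.1.darts → K.cD B h x = v → w = K.cD B (g * h) x := by
  rcases K.exists_dart v with ⟨v, rfl⟩ | ⟨B, h, x, hx, rfl⟩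
  · obtain ⟨w, hw⟩ := exists_inl_dart (⟨g.1, hΓ'.le_aut g.2⟩ : ρ.graph.aut) v
    refine ⟨w.1, fun v₀ w₀ hv hw₀ => ?_, fun B h x hx e => (K.cD_ne_old hx v e).elim⟩
    obtain rfl : v₀ = v := Subtype.ext hv
    exact congrArg Subtype.val (Sum.inl_injective (hw.symm.trans hw₀))
  · refine ⟨K.cD B (g * h) x, fun v₀ _ e _ => (K.cD_ne_old hx v₀ e.symm).elim,
      fun B' h' x' hx' e => ?_⟩
    obtain ⟨rfl, ⟨rfl, rfl⟩ | ⟨σ, hσ, rfl, rfl⟩⟩ := K.dart_eq hG hR hx hx' e.symm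
    · rfl
    · rw [← mul_assoc, K.cD_swap B σ hσ _ x hx]

/-- The group `Γ'` acts on `G`, compatibly with its action on the reduced graph and with the
charts. -/
theorem exists_hom (K : Charts hΓ' X) (hG : G.IsConnectedLoopless) (hR : G.IsRoot R) :
    ∃ Ψ : Γ' →* Equiv.Perm V × Equiv.Perm D,
      (∀ (g : Γ') (v w : ρ.OldV), g.1.1 (.inl v) = .inl w → (Ψ g).1 v.1 = w.1) ∧
      (∀ (g : Γ') (v w : ρ.OldD), g.1.2 (.inl v) = .inl w → (Ψ g).2 v.1 = w.1) ∧
      (∀ (g h : Γ') (B : X.reps), ∀ x ∈ B.1.1.verts, (Ψ g).1 (K.cV B h x) = K.cV B (g * h) x) ∧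
      ∀ (g h : Γ') (B : X.reps), ∀ x ∈ B.1.1.darts, (Ψ g).2 (K.cD B h x) = K.cD B (g * h) x := by
  choose fV hV1 hV2 using K.exists_liftV hG hR
  choose fD hD1 hD2 using K.exists_liftD hG hR
  have hmulV : ∀ g h v, fV (g * h) v = fV g (fV h v) := by
    intro g h v
    rcases K.exists_vert v with ⟨v, rfl⟩ | ⟨B, k, x, hx, rfl⟩
    · obtain ⟨w, hw⟩ := exists_inl hG hR hΓ' (γ := ⟨h.1, hΓ'.le_aut h.2⟩) h.2 v
      obtain ⟨u, hu⟩ := exists_inl hG hR hΓ' (γ := ⟨g.1, hΓ'.le_aut g.2⟩) g.2 w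
      rw [hV1 h v.1 v w rfl hw, hV1 g w.1 w u rfl hu]
      refine hV1 (g * h) v.1 v u rfl ?_
      change g.1.1 (h.1.1 _) = _
      exact (congrArg g.1.1 hw).trans hu
    · rw [hV2 (g * h) _ B k x hx rfl, hV2 h _ B k x hx rfl, hV2 g _ B (h * k) x hx rfl, mul_assoc]
  have honeV : ∀ v, fV 1 v = v := by
    intro v
    rcases K.exists_vert v with ⟨v, rfl⟩ | ⟨B, k, x, hx, rfl⟩
    · exact hV1 1 v.1 v v rfl rfl
    · rw [hV2 1 _ B k x hx rfl, one_mul]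
  have hmulD : ∀ g h v, fD (g * h) v = fD g (fD h v) := by
    intro g h v
    rcases K.exists_dart v with ⟨v, rfl⟩ | ⟨B, k, x, hx, rfl⟩
    · obtain ⟨w, hw⟩ := exists_inl_dart (⟨h.1, hΓ'.le_aut h.2⟩ : ρ.graph.aut) v
      obtain ⟨u, hu⟩ := exists_inl_dart (⟨g.1, hΓ'.le_aut g.2⟩ : ρ.graph.aut) w
      rw [hD1 h v.1 v w rfl hw, hD1 g w.1 w u rfl hu]
      refine hD1 (g * h) v.1 v u rfl ?_
      change g.1.2 (h.1.2 _) = _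
      exact (congrArg g.1.2 hw).trans hu
    · rw [hD2 (g * h) _ B k x hx rfl, hD2 h _ B k x hx rfl, hD2 g _ B (h * k) x hx rfl, mul_assoc]
  have honeD : ∀ v, fD 1 v = v := by
    intro v
    rcases K.exists_dart v with ⟨v, rfl⟩ | ⟨B, k, x, hx, rfl⟩
    · exact hD1 1 v.1 v v rfl rfl
    · rw [hD2 1 _ B k x hx rfl, one_mul]
  let Ψ : Γ' →* Equiv.Perm V × Equiv.Perm D := MonoidHom.prod
    (MonoidHom.toHomPerm ⟨⟨fV, funext honeV⟩, fun g h => funext (hmulV g h)⟩)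
    (MonoidHom.toHomPerm ⟨⟨fD, funext honeD⟩, fun g h => funext (hmulD g h)⟩)
  refine ⟨Ψ, fun g v w h => hV1 g v.1 v w rfl h, fun g v w h => hD1 g v.1 v w rfl h,
    fun g h B x hx => ?_, fun g h B x hx => hD2 g _ B h x hx rfl⟩
  -- Charts take boundary vertices to old vertices, where both sides are given by the action of `Γ'`
  -- on the reduced graph.
  rcases hx with hx | hx
  · obtain ⟨A, j, hA⟩ := exists_act hΓ' h B.1 false
    obtain ⟨A', j', hA'⟩ := exists_act hΓ' (g * h) B.1 false
    obtain ⟨w, hw, hw'⟩ := (K.isMatch B h A j hA).agrees ⟨x, Or.inl ⟨B.1, hx⟩⟩ hx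
    obtain ⟨u, hu, hu'⟩ := (K.isMatch B (g * h) A' j' hA').agrees ⟨x, Or.inl ⟨B.1, hx⟩⟩ hx
    rw [← hw, ← hu]
    refine hV1 g w.1 w u rfl ?_
    rw [← hw', ← hu']
    rfl
  · exact hV2 g _ B h x hx rfl

end Charts

/-- Every expansion of a quotient of the reduced graph is the quotient by an extension. -/
theorem Expansion.exists_extension (hG : G.IsConnectedLoopless) (hR : G.IsRoot R)
    (hΓ' : ρ.graph.Semiregular Γ') (X : ρ.Expansion hΓ'.le_aut) :
    ∃ (Γ : Subgroup (Equiv.Perm V × Equiv.Perm D)) (hΓ : G.Semiregular Γ),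
      ρ.Extends Γ Γ' ∧ X.Realizes Γ hΓ.le_aut := by
  obtain ⟨K⟩ := Expansion.nonempty_charts (hΓ' := hΓ') hG hR X
  obtain ⟨Ψ, hV, hD, hcV, hcD⟩ := K.exists_hom hG hR
  have hΓ : G.Semiregular Ψ.range := by
    refine ⟨?_, ?_, ?_, ?_⟩
    · rintro _ ⟨g, rfl⟩ k
      rcases K.exists_dart k with ⟨k, rfl⟩ | ⟨B, h, x, hx, rfl⟩
      · have haut := hΓ'.le_aut g.2
        obtain ⟨l, hl⟩ := exists_inl_dart (⟨g.1, haut⟩ : ρ.graph.aut) k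
        obtain ⟨h1, h2, h3, h4⟩ := haut (.inl k)
        have hl : g.1.2 (.inl k) = .inl l := hl
        rw [hl] at h1 h2 h3 h4
        rw [hD g k l hl]
        exact ⟨(hV g _ _ h1.symm).symm, (hD g _ _ h2.symm).symm, Sum.inl_injective h3, h4⟩
      · obtain ⟨A, j, hA⟩ := Charts.exists_act hΓ' h B.1 false
        obtain ⟨A', j', hA'⟩ := Charts.exists_act hΓ' (g * h) B.1 false
        have hm := K.isMatch B h A j hA
        have hm' := K.isMatch B (g * h) A' j' hA'
        rw [hcD g h B x hx, hm.vert x hx, hm.inv x hx, hm.color x hx, hm.kind x hx, hm'.vert x hx,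
          hm'.inv x hx, hm'.color x hx, hm'.kind x hx, hcV g h B _ (B.1.1.vert_mem x hx),
          hcD g h B _ (B.1.1.inv_mem x hx)]
        exact ⟨rfl, rfl, rfl, rfl⟩
    · rintro _ ⟨g, rfl⟩ hne v hv
      have hg : g ≠ 1 := fun e => hne (by rw [e, map_one])
      rcases K.exists_vert v with ⟨v, rfl⟩ | ⟨B, h, x, hx, rfl⟩
      · obtain ⟨w, hw⟩ := exists_inl hG hR hΓ' (γ := ⟨g.1, hΓ'.le_aut g.2⟩) g.2 v
        rw [hV g v w hw] at hv
        refine hΓ'.vert_free g.1 g.2 (fun e => hg (Subtype.ext e)) (.inl v) ?_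
        exact hw.trans (congrArg Sum.inl (Subtype.ext hv))
      · rw [hcV g h B x (Or.inr hx)] at hv
        -- A fixed interior vertex has two labels `g * h` and `h`: either they agree, or the halving
        -- of `B` fixes `x`.
        obtain ⟨-, ⟨h1, -⟩ | ⟨σ, hσ, -, h1⟩⟩ := K.vert_eq hG hR hx hx hv
        · exact hg (mul_eq_right.1 h1)
        · exact (K.halving B σ hσ).vert_free x (Or.inr hx) h1.symm
    · rintro _ ⟨g, rfl⟩ hne v hv
      have hg : g ≠ 1 := fun e => hne (by rw [e, map_one])
      rcases K.exists_dart v with ⟨v, rfl⟩ | ⟨B, h, x, hx, rfl⟩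
      · obtain ⟨w, hw⟩ := exists_inl_dart (⟨g.1, hΓ'.le_aut g.2⟩ : ρ.graph.aut) v
        rw [hD g v w hw] at hv
        refine hΓ'.dart_free g.1 g.2 (fun e => hg (Subtype.ext e)) (.inl v) ?_
        exact hw.trans (congrArg Sum.inl (Subtype.ext hv))
      · rw [hcD g h B x hx] at hv
        obtain ⟨-, ⟨h1, -⟩ | ⟨σ, hσ, -, h1⟩⟩ := K.dart_eq hG hR hx hx hv
        · exact hg (mul_eq_right.1 h1)
        · exact (K.halving B σ hσ).dart_free x hx h1.symm
    · rintro _ ⟨g, rfl⟩ hne v hv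
      have hg : g ≠ 1 := fun e => hne (by rw [e, map_one])
      rcases K.exists_dart v with ⟨v, rfl⟩ | ⟨B, h, x, hx, rfl⟩
      · obtain ⟨w, hw⟩ := exists_inl_dart (⟨g.1, hΓ'.le_aut g.2⟩ : ρ.graph.aut) v
        rw [hD g v w hw] at hv
        refine hΓ'.halvable_of_reversed g.1 g.2 (fun e => hg (Subtype.ext e)) (.inl v) ?_
        exact hw.trans (congrArg Sum.inl (Subtype.ext hv))
      · obtain ⟨A, j, hA⟩ := Charts.exists_act hΓ' h B.1 false
        have hm := K.isMatch B h A j hA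
        have hx' := B.1.1.inv_mem x hx
        rw [hcD g h B x hx, hm.inv x hx] at hv
        rw [hm.kind x hx]
        -- A reversed edge inside an atom is, in the chart, an edge reversed by the halving.
        obtain ⟨-, ⟨h1, -⟩ | ⟨σ, hσ, -, h1⟩⟩ := K.dart_eq hG hR hx hx' hv
        · exact (hg (mul_eq_right.1 h1)).elim
        · exact (K.halving B σ hσ).halvable x hx h1.symm
  have hind : ∀ g : Γ', ρ.Induces (Ψ g) g.1 := by
    intro g
    refine ⟨fun v => ?_, fun k => ?_, fun A => ?_⟩
    · obtain ⟨w, hw⟩ := exists_inl hG hR hΓ' (γ := ⟨g.1, hΓ'.le_aut g.2⟩) g.2 v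
      exact ⟨w, (hV g v w hw).symm, hw⟩
    · obtain ⟨w, hw⟩ := exists_inl_dart (⟨g.1, hΓ'.le_aut g.2⟩ : ρ.graph.aut) k
      exact ⟨w, (hD g k w hw).symm, hw⟩
    · obtain ⟨B, h, j, hA⟩ := Charts.exists_chart (hΓ' := hΓ') X A
      obtain ⟨A', j', hA'⟩ := Charts.exists_act hΓ' (g * h) B.1 false
      have hm := K.isMatch B h A j hA
      have hm' := K.isMatch B (g * h) A' j' hA'
      refine ⟨A', ?_, ?_, ?_, fun i => ?_⟩
      · rw [← hm.bijOn_bdry.image_eq, ← hm'.bijOn_bdry.image_eq, Set.image_image]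
        exact Set.image_congr fun x hx => (hcV g h B x (Or.inl hx)).symm
      · rw [← hm.bijOn_inn.image_eq, ← hm'.bijOn_inn.image_eq, Set.image_image]
        exact Set.image_congr fun x hx => (hcV g h B x (Or.inr hx)).symm
      · rw [← hm.bijOn_darts.image_eq, ← hm'.bijOn_darts.image_eq, Set.image_image]
        exact Set.image_congr fun x hx => (hcD g h B x hx).symm
      · have hgA : g.1.2 (.inr (A, j)) = .inr (A', j') := by
          rw [← hA, ← hA']
          rfl
        have : ∃ l, g.1.2 (.inr (A, i)) = .inr (A', l) := by
          by_cases hij : i = j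
          · exact ⟨j', hij ▸ hgA⟩
          · obtain rfl : i = !j := by
              revert hij
              cases i <;> cases j <;> simp
            exact ⟨_, act_not_of_mem hΓ' hgA⟩
        obtain ⟨l, hl⟩ := this
        obtain ⟨h1, h2⟩ := act_end hG hR hΓ' (γ := ⟨g.1, hΓ'.le_aut g.2⟩) g.2 hl
        exact ⟨l, hl, (hV g _ _ h1).symm, h2⟩
  have hE : ρ.Extends Ψ.range Γ' := by
    refine ⟨?_, fun g hg => ⟨Ψ ⟨g, hg⟩, ⟨_, rfl⟩, hind ⟨g, hg⟩⟩⟩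
    rintro _ ⟨g, rfl⟩
    exact ⟨g.1, g.2, hind g⟩
  refine ⟨Ψ.range, hΓ, hE, X.realizes hG hR hE hΓ fun B τ hτ hq => ?_⟩
  have hc := X.corresponds B
  rw [hq] at hc
  obtain ⟨σ, hσ', hσ⟩ := projD_eq_iff.1 hc
  refine ⟨Ψ ⟨σ, hσ'⟩, ⟨_, rfl⟩, fun x => ?_, fun x => ?_⟩
  -- The chart labelled `1` is the identity on `B`, so the reversing element acts on `B` exactly as
  -- the selected involution.
  · have h1 := hcV ⟨σ, hσ'⟩ 1 B x.1 x.2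
    rw [K.cV_one B x.1 x.2, mul_one, ← one_mul (⟨σ, hσ'⟩ : Γ'),
      K.cV_swap B ⟨σ, hσ'⟩ hσ 1 x.1 x.2, K.tV_eq B τ hτ hq, K.cV_one B _ (τ.1 x).2, one_mul] at h1
    exact h1.symm
  · have h1 := hcD ⟨σ, hσ'⟩ 1 B x.1 x.2
    rw [K.cD_one B x.1 x.2, mul_one, ← one_mul (⟨σ, hσ'⟩ : Γ'),
      K.cD_swap B ⟨σ, hσ'⟩ hσ 1 x.1 x.2, K.tD_eq B τ hτ hq, K.cD_one B _ (τ.2 x).2, one_mul] at h1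
    exact h1.symm

end ColGraph.Reduction

theorem mainTheorem1 {V D C : Type*} [Finite V] [Finite D] (G : ColGraph V D C)
    (hG : G.IsConnectedLoopless) (R : Set V) (hR : G.IsRoot R) (ρ : G.Reduction R) :
    (∀ (Γ : Subgroup (Equiv.Perm V × Equiv.Perm D)) (hΓ : G.Semiregular Γ),
      (∃ Γ', ρ.graph.Semiregular Γ' ∧ ρ.Extends Γ Γ') ∧
      ∀ (Γ' : Subgroup (Equiv.Perm ρ.NewV × Equiv.Perm ρ.NewD))
        (hΓ' : ρ.graph.Semiregular Γ'), ρ.Extends Γ Γ' →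
        ∃ X : ρ.Expansion hΓ'.le_aut, X.Realizes Γ hΓ.le_aut) ∧
    (∀ (Γ' : Subgroup (Equiv.Perm ρ.NewV × Equiv.Perm ρ.NewD))
      (hΓ' : ρ.graph.Semiregular Γ') (X : ρ.Expansion hΓ'.le_aut),
      ∃ (Γ : Subgroup (Equiv.Perm V × Equiv.Perm D)) (hΓ : G.Semiregular Γ),
        ρ.Extends Γ Γ' ∧ X.Realizes Γ hΓ.le_aut) := by
  exact ⟨fun Γ hΓ => ⟨ρ.exists_extends hR hΓ, fun Γ' hΓ' hE => hE.exists_expansion hG hR hΓ hΓ'⟩,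
    fun Γ' hΓ' X => ColGraph.Reduction.Expansion.exists_extension hG hR hΓ' X⟩
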